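/- Let $\Omega=\mathbb R\times(0,1)$, let $r>0$, let $\Omega_r=(-r,r)\times(0,1)$, and let $k>0$ with $k\notin\pi\mathbb N=\{0,\pi,2\pi,\dots\}$. For $n\in\mathbb N$ put $\varphi_0=1$, $\varphi_n(y)=\sqrt2\cos(n\pi y)$ for $n\ge1$, and let $k_n$ be the square root of $k^2-n^2\pi^2$ with $\operatorname{Re}k_n\ge0$, $\operatorname{Im}k_n\ge0$. Write $\mathrm H^2_{\mathrm{loc}}(\Omega)$ for the space of functions on $\Omega$ that lie in $\mathrm H^2(\Omega_R)$ for every $R>0$; all functions are complex valued. A function $u\in\mathrm H^2_{\mathrm{loc}}(\Omega)$ is called outgoing if for every $n\in\mathbb N$ the coefficient $w_n(x)=\int_0^1u(x,y)\varphi_n(y)\,\mathrm dy$ satisfies $\left|w_n'(x)\frac{x}{|x|}-ik_nw_n(x)\right|\to0$ as $|x|\to\infty$. For every $s\in\mathrm L^2(\Omega_r)$, extended by $0$ to $\Omega$, the problem $$\Delta u_k+k^2u_k=-s\ \text{ in }\Omega,\qquad \partial_\nu u_k=0\ \text{ on }\partial\Omega,\qquad u_k\ \text{outgoing}$$ has exactly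 one solution $u_k\in\mathrm H^2_{\mathrm{loc}}(\Omega)$, and the operator $$\mathcal H_k:\mathrm L^2(\Omega_r)\to\mathrm H^2(\Omega_r),\qquad s\mapsto u_k|_{\Omega_r},$$ is thus well defined; it is linear and continuous. Hence there is a constant $C>0$ depending only on $k$ and $r$ such that $$\|u_k\|_{\mathrm H^2(\Omega_r)}\le C\,\|s\|_{\mathrm L^2(\Omega_r)}\qquad\text{for all }s\in\mathrm L^2(\Omega_r).$$ Moreover, for fixed $r$, the best such constant, i.e. the operator norm $\|\mathcal H_k\|$, tends to $+\infty$ as the distance from $k$ to $\pi\mathbb N$ tends to $0$: for every $M$ there is $\delta>0$ such that $\|\mathcal H_k\|>M$ for all $k>0$, $k\notin\pi\mathbb N$, with $\operatorname{dist}(k,\pi\mathbb N)<\delta$. Here $\|v\|_{\mathrm H^2(\Omega_r)}^2=\|v\|^2+\sum_{j}\|\partial_jv\|^2+\sum_{i,j}\|\partial_i\partial_jv\|^2$ with $\mathrm L^2(\Omega_r)$ norms. -/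

import Mathlib

open MeasureTheory Set Filter Topology

noncomputable section

namespace Waveguide

/-- The infinite waveguide `ℝ × (0,1)`. -/
def guide : Set (ℝ × ℝ) := univ ×ˢ Ioo 0 1

/-- The restricted waveguide `(-r,r) × (0,1)`. -/
def box (r : ℝ) : Set (ℝ × ℝ) := Ioo (-r) r ×ˢ Ioo 0 1

/-- The admissible frequencies: `k > 0` with `k ≠ nπ` for all `n ∈ ℕ`. -/
abbrev Frequency : Type := {k : ℝ // 0 < k ∧ ∀ n : ℕ, k ≠ n * Real.pi}

/-- The set `πℕ = {0, π, 2π, …}`. -/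
def cutoffs : Set ℝ := range fun n : ℕ => (n : ℝ) * Real.pi

/-- The canonical basis `(1,0)`, `(0,1)` of the plane. -/
def basisVec (i : Fin 2) : ℝ × ℝ := if i = 0 then (1, 0) else (0, 1)

/-- The partial derivative `∂ᵢφ` of a differentiable function. -/
def partialDeriv (i : Fin 2) (φ : ℝ × ℝ → ℝ) (p : ℝ × ℝ) : ℝ := fderiv ℝ φ p (basisVec i)

/-- Real test functions: smooth with compact support contained in `V`. -/
structure IsTest (V : Set (ℝ × ℝ)) (φ : ℝ × ℝ → ℝ) : Prop where
  smooth : ContDiff ℝ ((⊤ : ℕ∞) : WithTop ℕ∞) φ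
  compact : HasCompactSupport φ
  supp : tsupport φ ⊆ V

/-- The complex space `L²(U)`. -/
abbrev L2 (U : Set (ℝ × ℝ)) : Type := Lp ℂ 2 (volume.restrict U)

/-- `g` is the weak partial derivative `∂ᵢf` in `U`, for `f, g ∈ L²(U)`. -/
def IsWeakPartial (U : Set (ℝ × ℝ)) (i : Fin 2) (f g : L2 U) : Prop :=
  ∀ φ : ℝ × ℝ → ℝ, IsTest U φ →
    ∫ p in U, partialDeriv i φ p • f p = -∫ p in U, φ p • g p

theorem IsTest.memLp {V : Set (ℝ × ℝ)} {φ : ℝ × ℝ → ℝ} (hφ : IsTest V φ)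
    (μ : Measure (ℝ × ℝ)) [IsFiniteMeasureOnCompacts μ] : MemLp φ 2 μ :=
  hφ.smooth.continuous.memLp_of_hasCompactSupport hφ.compact

theorem IsTest.memLp_partialDeriv {V : Set (ℝ × ℝ)} {φ : ℝ × ℝ → ℝ} (hφ : IsTest V φ)
    (i : Fin 2) (μ : Measure (ℝ × ℝ)) [IsFiniteMeasureOnCompacts μ] :
    MemLp (partialDeriv i φ) 2 μ := by
  have hc : Continuous (partialDeriv i φ) :=
    (hφ.smooth.continuous_fderiv (by simp)).clm_apply continuous_const
  exact hc.memLp_of_hasCompactSupport (hφ.compact.fderiv_apply ℝ (basisVec i))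

theorem integrable_test_smul {U : Set (ℝ × ℝ)} {φ : ℝ × ℝ → ℝ}
    (hφ : MemLp φ 2 (volume.restrict U)) (f : L2 U) :
    IntegrableOn (fun p => φ p • f p) U :=
  memLp_one_iff_integrable.1 ((Lp.memLp f).smul hφ)

theorem IsWeakPartial.zero (U : Set (ℝ × ℝ)) (i : Fin 2) :
    IsWeakPartial U i (0 : L2 U) (0 : L2 U) := by
  intro φ _
  have h := Lp.coeFn_zero ℂ 2 (volume.restrict U)
  have h1 : ∫ p in U, partialDeriv i φ p • (0 : L2 U) p = 0 := by
    rw [integral_eq_zero_of_ae]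
    filter_upwards [h] with p hp
    simp only [hp, Pi.zero_apply, smul_zero]
  have h2 : ∫ p in U, φ p • (0 : L2 U) p = 0 := by
    rw [integral_eq_zero_of_ae]
    filter_upwards [h] with p hp
    simp only [hp, Pi.zero_apply, smul_zero]
  rw [h1, h2, neg_zero]

theorem integral_test_smul_add {U : Set (ℝ × ℝ)} {φ : ℝ × ℝ → ℝ}
    (hφ : MemLp φ 2 (volume.restrict U)) (f g : L2 U) :
    ∫ p in U, φ p • (f + g) p = (∫ p in U, φ p • f p) + ∫ p in U, φ p • g p := by
  rw [← integral_add (integrable_test_smul hφ f) (integrable_test_smul hφ g)]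
  apply integral_congr_ae
  filter_upwards [Lp.coeFn_add f g] with p hp
  simp only [hp, Pi.add_apply, smul_add]

theorem integral_test_smul_smul {U : Set (ℝ × ℝ)} (φ : ℝ × ℝ → ℝ) (c : ℂ) (f : L2 U) :
    ∫ p in U, φ p • (c • f) p = c * ∫ p in U, φ p • f p := by
  rw [← integral_const_mul]
  apply integral_congr_ae
  filter_upwards [Lp.coeFn_smul c f] with p hp
  simp only [hp, Pi.smul_apply, smul_eq_mul, mul_smul_comm]

theorem IsWeakPartial.add {U : Set (ℝ × ℝ)} {i : Fin 2} {f g f' g' : L2 U}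
    (h : IsWeakPartial U i f g) (h' : IsWeakPartial U i f' g') :
    IsWeakPartial U i (f + f') (g + g') := by
  intro φ hφ
  rw [integral_test_smul_add (hφ.memLp_partialDeriv i _), integral_test_smul_add (hφ.memLp _),
    h φ hφ, h' φ hφ, neg_add]

theorem IsWeakPartial.smul {U : Set (ℝ × ℝ)} {i : Fin 2} {f g : L2 U} (c : ℂ)
    (h : IsWeakPartial U i f g) : IsWeakPartial U i (c • f) (c • g) := by
  intro φ hφ
  rw [integral_test_smul_smul, integral_test_smul_smul, h φ hφ, mul_neg]

/-- Labels for a function, its first partial derivatives `∂ⱼ` and its second partial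
derivatives `∂ᵢ∂ⱼ`. -/
abbrev JetIndex : Type := Unit ⊕ Fin 2 ⊕ Fin 2 × Fin 2

/-- The Hilbert space `H²(U)`: a function in `L²(U)` is stored together with its weak derivatives
of order one and two, all required to lie in `L²(U)` (for open `U` they are determined by the
function). The norm inherited from the `ℓ²` product is
`(‖u‖² + ∑ⱼ ‖∂ⱼu‖² + ∑ᵢⱼ ‖∂ᵢ∂ⱼu‖²)^(1/2)`, with `L²(U)` norms. -/
def H2 (U : Set (ℝ × ℝ)) : Submodule ℂ (PiLp 2 fun _ : JetIndex => L2 U) where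
  carrier := {v | (∀ j, IsWeakPartial U j (v (.inl ())) (v (.inr (.inl j)))) ∧
    ∀ i j, IsWeakPartial U i (v (.inr (.inl j))) (v (.inr (.inr (i, j))))}
  zero_mem' := ⟨fun j => IsWeakPartial.zero U j, fun i _ => IsWeakPartial.zero U i⟩
  add_mem' h h' := ⟨fun j => (h.1 j).add (h'.1 j), fun i j => (h.2 i j).add (h'.2 i j)⟩
  smul_mem' c _ h := ⟨fun j => (h.1 j).smul c, fun i j => (h.2 i j).smul c⟩

/-- The underlying function of an element of `H²(U)`. -/
def val {U : Set (ℝ × ℝ)} (v : H2 U) : L2 U := v.1 (.inl ())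

/-- The weak derivative `∂ⱼv`. -/
def grad {U : Set (ℝ × ℝ)} (v : H2 U) (j : Fin 2) : L2 U := v.1 (.inr (.inl j))

/-- The weak derivative `∂ᵢ∂ⱼv`. -/
def hess {U : Set (ℝ × ℝ)} (v : H2 U) (i j : Fin 2) : L2 U := v.1 (.inr (.inr (i, j)))

/-- `v ∈ H²(U)` is the restriction to `U` of the function `u` (almost everywhere). -/
def IsRestriction {U : Set (ℝ × ℝ)} (v : H2 U) (u : ℝ × ℝ → ℂ) : Prop :=
  val v =ᵐ[volume.restrict U] u

/-- `u ∈ H²_loc` of the waveguide, up to its boundary: `u ∈ H²((-R,R) × (0,1))` for all `R`. -/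
def MemH2loc (u : ℝ × ℝ → ℂ) : Prop :=
  ∀ R : ℝ, 0 < R → ∃ v : H2 (box R), IsRestriction v u

/-- `Δu + k²u = -s` almost everywhere in the waveguide, for `u ∈ H²_loc`. -/
def SolvesHelmholtz (k : ℝ) (s u : ℝ × ℝ → ℂ) : Prop :=
  ∀ R : ℝ, 0 < R → ∀ v : H2 (box R), IsRestriction v u →
    ∀ᵐ p ∂volume.restrict (box R), hess v 0 0 p + hess v 1 1 p + (k : ℂ) ^ 2 * u p = -s p

/-- The homogeneous Neumann condition `∂_ν u = 0` on `ℝ × {0,1}` for `u ∈ H²_loc`: the boundary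
term in Green's formula `∫ (Δu) φ + ∇u · ∇φ = ∫_∂ (∂_ν u) φ` vanishes for all `φ ∈ C_c^∞(ℝ²)`
(here `φ` need not vanish on `ℝ × {0,1}`). -/
def NeumannCondition (u : ℝ × ℝ → ℂ) : Prop :=
  ∀ R : ℝ, 0 < R → ∀ v : H2 (box R), IsRestriction v u →
    ∀ φ : ℝ × ℝ → ℝ, IsTest (Ioo (-R) R ×ˢ univ) φ →
      ∫ p in box R, (φ p • (hess v 0 0 p + hess v 1 1 p) +
        (partialDeriv 0 φ p • grad v 0 p + partialDeriv 1 φ p • grad v 1 p)) = 0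

/-- The transverse modes: `φ₀ = 1` and `φₙ(y) = √2 cos(nπy)` for `n ≥ 1`. -/
def mode (n : ℕ) (y : ℝ) : ℝ :=
  if n = 0 then 1 else Real.sqrt 2 * Real.cos (n * Real.pi * y)

/-- The modal wavenumber `kₙ`: the square root of `k² - n²π²` with nonnegative real and imaginary
parts. -/
def waveNumber (k : ℝ) (n : ℕ) : ℂ :=
  if n * Real.pi ≤ k then (Real.sqrt (k ^ 2 - (n * Real.pi) ^ 2) : ℂ)
  else Complex.I * (Real.sqrt ((n * Real.pi) ^ 2 - k ^ 2) : ℂ)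

/-- The radiation condition: for each `n`, the coefficient `w(x) = ⟨u(x,·), φₙ⟩` in `L²(0,1)`
(taken as its `C¹` representative) satisfies `w'(x) x/|x| - i kₙ w(x) → 0` as `|x| → ∞`. -/
def IsOutgoing (k : ℝ) (u : ℝ × ℝ → ℂ) : Prop :=
  ∀ n : ℕ, ∃ w : ℝ → ℂ, ContDiff ℝ 1 w ∧
    (∀ᵐ x : ℝ, w x = ∫ y in Ioo (0 : ℝ) 1, mode n y • u (x, y)) ∧
    Tendsto (fun x : ℝ => ‖deriv w x * ((x / |x| : ℝ) : ℂ) - Complex.I * waveNumber k n * w x‖)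
      (cocompact ℝ) (𝓝 0)

/-- `u ∈ H²_loc` is a solution of `Δu + k²u = -s` in the waveguide, `∂_ν u = 0` on its boundary,
`u` outgoing. -/
structure IsSolution (k : ℝ) (s u : ℝ × ℝ → ℂ) : Prop where
  memH2loc : MemH2loc u
  helmholtz : SolvesHelmholtz k s u
  neumann : NeumannCondition u
  outgoing : IsOutgoing k u

/-- The extension by zero of a source `s ∈ L²((-r,r) × (0,1))`. -/
def extendByZero {r : ℝ} (s : L2 (box r)) : ℝ × ℝ → ℂ := (box r).indicator s

end Waveguide

end

/-!
Expanding in the Neumann eigenfunctions `φₙ(y) = √2 cos(nπy)` decouples the problem into the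
one-dimensional equations `wₙ'' + kₙ² wₙ = -sₙ`, whose outgoing solutions are
`wₙ(x) = i / (2 kₙ) ∫ exp(i kₙ |x - t|) sₙ(t) dt`. The modal terms `wₙ(x) φₙ(y)` and their
derivatives up to order two are orthogonal in `L²` of a box, so their `H²` norms add up, and
Schur's test on the kernel, which gains a factor `|kₙ|⁻²` from the exponential decay of the
evanescent modes, bounds the sum by the norm of the source. For uniqueness, testing the difference
of two solutions against `χ(x) φₙ(y)` shows that its modal coefficients solve `w'' + kₙ² w = 0`
on the line, and no nonzero combination of `exp(± i kₙ x)` is outgoing at both ends. As `k`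
approaches `nπ` the factor `1 / kₙ` blows up, which is seen on the source `φₙ` supported near
`x = 0`.
-/

noncomputable section

namespace Waveguide

section Primitive

variable {E : Type*} [NormedAddCommGroup E] [NormedSpace ℝ E] {F f G g : ℝ → E}

/-- `F` is absolutely continuous on every bounded interval, with almost everywhere derivative
`f`: the pairs `(F, F')` with `F` in `W^{1,1}_loc(ℝ)`, encoded by the fundamental theorem of
calculus. -/
structure IsPrimitive (F f : ℝ → E) : Prop where
  locallyIntegrable : LocallyIntegrable f
  integral_eq : ∀ a b : ℝ, ∫ x in a..b, f x = F b - F a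

namespace IsPrimitive

theorem intervalIntegrable (h : IsPrimitive F f) (a b : ℝ) : IntervalIntegrable f volume a b :=
  (h.locallyIntegrable.integrableOn_isCompact isCompact_uIcc).intervalIntegrable

theorem eq_const_add_integral (h : IsPrimitive F f) (a : ℝ) :
    F = fun x => F a + ∫ t in a..x, f t :=
  funext fun x => by rw [h.integral_eq, add_sub_cancel]

theorem continuous (h : IsPrimitive F f) : Continuous F := by
  rw [h.eq_const_add_integral 0]
  exact continuous_const.add (intervalIntegral.continuous_primitive h.intervalIntegrable 0)

theorem congr_ae (h : IsPrimitive F f) (hfg : f =ᵐ[volume] g) : IsPrimitive F g :=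
  ⟨h.locallyIntegrable.congr hfg, fun a b => by
    rw [← h.integral_eq]
    exact (intervalIntegral.integral_congr_ae (hfg.mono fun x hx _ => hx)).symm⟩

theorem add (hF : IsPrimitive F f) (hG : IsPrimitive G g) :
    IsPrimitive (fun x => F x + G x) (fun x => f x + g x) :=
  ⟨hF.locallyIntegrable.add hG.locallyIntegrable, fun a b => by
    rw [intervalIntegral.integral_add (hF.intervalIntegrable a b) (hG.intervalIntegrable a b),
      hF.integral_eq, hG.integral_eq]
    abel⟩

theorem const_smul {𝕜 : Type*} [RCLike 𝕜] [NormedSpace 𝕜 E] (c : 𝕜)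
    (hF : IsPrimitive F f) : IsPrimitive (fun x => c • F x) (fun x => c • f x) :=
  ⟨hF.locallyIntegrable.smul c, fun a b => by
    rw [intervalIntegral.integral_smul, hF.integral_eq, smul_sub]⟩

theorem absolutelyContinuousOnInterval (h : IsPrimitive F f) (a b : ℝ) :
    AbsolutelyContinuousOnInterval F a b := by
  have hnorm : ∀ x y : ℝ, IntervalIntegrable (fun t => ‖f t‖) volume x y :=
    fun x y => (h.intervalIntegrable x y).norm
  refine squeeze_zero (fun _ => Finset.sum_nonneg fun _ _ => dist_nonneg) (fun _ => ?_)
    ((hnorm a b).absolutelyContinuousOnInterval_intervalIntegral (c := a) left_mem_uIcc)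
  refine Finset.sum_le_sum fun i _ => ?_
  rw [dist_comm, dist_eq_norm, ← h.integral_eq, dist_comm, Real.dist_eq,
    intervalIntegral.integral_interval_sub_left (hnorm _ _) (hnorm _ _)]
  exact intervalIntegral.norm_integral_le_abs_integral_norm

theorem of_locallyIntegrable (hf : LocallyIntegrable f) (a : ℝ) :
    IsPrimitive (fun x => ∫ t in a..x, f t) f := by
  have hint : ∀ x y : ℝ, IntervalIntegrable f volume x y :=
    fun x y => (hf.integrableOn_isCompact isCompact_uIcc).intervalIntegrable
  exact ⟨hf, fun x y =>
    (intervalIntegral.integral_interval_sub_left (hint a y) (hint a x)).symm⟩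

variable [CompleteSpace E]

theorem hasDerivAt (h : IsPrimitive F f) (hf : Continuous f) (x : ℝ) : HasDerivAt F (f x) x := by
  rw [h.eq_const_add_integral 0]
  exact (hf.integral_hasStrictDerivAt 0 x).hasDerivAt.const_add _

theorem contDiff_one (h : IsPrimitive F f) (hf : Continuous f) : ContDiff ℝ 1 F := by
  have hderiv : deriv F = f := funext fun x => (h.hasDerivAt hf x).deriv
  exact contDiff_one_iff_deriv.2
    ⟨fun x => (h.hasDerivAt hf x).differentiableAt, hderiv ▸ hf⟩

theorem ae_hasDerivAt (h : IsPrimitive F f) : ∀ᵐ x, HasDerivAt F (f x) x := by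
  filter_upwards [_root_.LocallyIntegrable.ae_hasDerivAt_integral h.locallyIntegrable] with x hx
  rw [h.eq_const_add_integral 0]
  exact (hx 0).const_add _

theorem of_hasDerivAt (h : ∀ x, HasDerivAt F (f x) x) (hf : Continuous f) : IsPrimitive F f :=
  ⟨hf.locallyIntegrable, fun a b =>
    intervalIntegral.integral_eq_sub_of_hasDerivAt (fun x _ => h x) (hf.intervalIntegrable a b)⟩

theorem of_absolutelyContinuous (hF : ∀ a b, AbsolutelyContinuousOnInterval F a b)
    (hderiv : ∀ᵐ x, HasDerivAt F (f x) x) (hf : LocallyIntegrable f) : IsPrimitive F f := by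
  refine ⟨hf, fun a b => ?_⟩
  have hJ := of_locallyIntegrable hf a
  have hAC := (hF a b).sub (hJ.absolutelyContinuousOnInterval a b)
  obtain ⟨C, hC⟩ := hAC.const_of_ae_hasDerivAt_zero (by
    filter_upwards [hderiv, hJ.ae_hasDerivAt] with x hFx hJx _
    simpa only [sub_self] using hFx.sub hJx)
  have hab := (hC b right_mem_uIcc).trans (hC a left_mem_uIcc).symm
  simp only [Pi.sub_apply, intervalIntegral.integral_same, sub_zero] at hab
  rw [← hab, sub_sub_cancel]

theorem smul {𝕜 : Type*} [RCLike 𝕜] [NormedSpace 𝕜 E] {φ φ' : ℝ → 𝕜}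
    (hφ : IsPrimitive φ φ') (hF : IsPrimitive F f) :
    IsPrimitive (fun x => φ x • F x) (fun x => φ x • f x + φ' x • F x) := by
  refine of_absolutelyContinuous (fun a b => (hφ.absolutelyContinuousOnInterval a b).smul
    (hF.absolutelyContinuousOnInterval a b)) ?_ (.add ?_ ?_)
  · filter_upwards [hφ.ae_hasDerivAt, hF.ae_hasDerivAt] with x hφx hFx using hφx.smul hFx
  · exact hF.locallyIntegrable.continuous_smul hφ.continuous
  · exact hφ.locallyIntegrable.smul_continuous hF.continuous

theorem setIntegral_Ioo_deriv_smul {𝕜 : Type*} [RCLike 𝕜] [NormedSpace 𝕜 E] {φ φ' : ℝ → 𝕜}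
    {a b : ℝ} (hφ : IsPrimitive φ φ') (hF : IsPrimitive F f) (ha : φ a • F a = 0)
    (hb : φ b • F b = 0) :
    ∫ x in Ioo a b, φ' x • F x = -∫ x in Ioo a b, φ x • f x := by
  rcases lt_or_ge b a with hab | hab
  · simp [Ioo_eq_empty_of_le hab.le]
  have hparts := (hφ.smul hF).integral_eq a b
  rw [ha, hb, sub_zero, intervalIntegral.integral_add
    ((hF.intervalIntegrable a b).continuousOn_smul hφ.continuous.continuousOn)
    ((hφ.intervalIntegrable a b).smul_continuousOn hF.continuous.continuousOn)] at hparts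
  simp only [← integral_Ioc_eq_integral_Ioo, ← intervalIntegral.integral_of_le hab]
  exact eq_neg_of_add_eq_zero_right hparts

end IsPrimitive

end Primitive

section Modes

/-- The transverse wavenumber `nπ` of the mode `φₙ`. -/
def freq (n : ℕ) : ℝ := n * Real.pi

theorem freq_nonneg (n : ℕ) : 0 ≤ freq n := by unfold freq; positivity

theorem freq_injective : Function.Injective freq := fun _ _ h =>
  Nat.cast_injective (mul_right_cancel₀ Real.pi_ne_zero h)

theorem freq_zero : freq 0 = 0 := by simp [freq]

theorem mode_zero (y : ℝ) : mode 0 y = 1 := if_pos rfl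

theorem mode_of_ne_zero {n : ℕ} (hn : n ≠ 0) (y : ℝ) :
    mode n y = Real.sqrt 2 * Real.cos (freq n * y) := if_neg hn

/-- The derivative `φₙ'` of the mode `φₙ`; the factor `freq n` covers the constant mode `n = 0`. -/
def modeDeriv (n : ℕ) (y : ℝ) : ℝ := -(Real.sqrt 2 * freq n * Real.sin (freq n * y))

theorem modeDeriv_zero_right (n : ℕ) : modeDeriv n 0 = 0 := by simp [modeDeriv]

theorem modeDeriv_one_right (n : ℕ) : modeDeriv n 1 = 0 := by
  simp [modeDeriv, freq, Real.sin_nat_mul_pi]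

theorem hasDerivAt_mode (n : ℕ) (y : ℝ) : HasDerivAt (mode n) (modeDeriv n y) y := by
  rcases eq_or_ne n 0 with rfl | hn
  · simpa [modeDeriv, freq_zero] using (hasDerivAt_const y (1 : ℝ)).congr_of_eventuallyEq
      (.of_forall mode_zero)
  · rw [funext (mode_of_ne_zero hn)]
    refine (((hasDerivAt_id y).const_mul (freq n)).cos.const_mul _).congr_deriv ?_
    simp only [modeDeriv, id]
    ring

theorem hasDerivAt_modeDeriv (n : ℕ) (y : ℝ) :
    HasDerivAt (modeDeriv n) (-freq n ^ 2 * mode n y) y := by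
  refine (((hasDerivAt_id y).const_mul (freq n)).sin.const_mul
    (Real.sqrt 2 * freq n)).neg.congr_deriv ?_
  rcases eq_or_ne n 0 with rfl | hn
  · simp [freq_zero]
  · simp only [mode_of_ne_zero hn, id]
    ring

theorem contDiff_mode {m : WithTop ℕ∞} (n : ℕ) : ContDiff ℝ m (mode n) := by
  rcases eq_or_ne n 0 with rfl | hn
  · rw [funext mode_zero]
    exact contDiff_const
  · rw [funext (mode_of_ne_zero hn)]
    exact contDiff_const.mul (Real.contDiff_cos.comp (contDiff_const.mul contDiff_id))

theorem contDiff_modeDeriv {m : WithTop ℕ∞} (n : ℕ) : ContDiff ℝ m (modeDeriv n) :=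
  (contDiff_const.mul (Real.contDiff_sin.comp (contDiff_const.mul contDiff_id))).neg

@[fun_prop]
theorem continuous_mode (n : ℕ) : Continuous (mode n) := (contDiff_mode (m := 0) n).continuous

@[fun_prop]
theorem continuous_modeDeriv (n : ℕ) : Continuous (modeDeriv n) :=
  (contDiff_modeDeriv (m := 0) n).continuous

theorem abs_mode_le (n : ℕ) (y : ℝ) : |mode n y| ≤ 2 := by
  rcases eq_or_ne n 0 with rfl | hn
  · rw [mode_zero, abs_one]
    exact one_le_two
  · rw [mode_of_ne_zero hn, abs_mul, abs_of_nonneg (Real.sqrt_nonneg 2)]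
    have hsqrt : Real.sqrt 2 ≤ 2 := Real.sqrt_le_iff.2 (by norm_num)
    nlinarith [Real.abs_cos_le_one (freq n * y), Real.sqrt_nonneg 2]

theorem modeDeriv_sq (n : ℕ) (y : ℝ) :
    modeDeriv n y ^ 2 = 2 * freq n ^ 2 - freq n ^ 2 * mode n y ^ 2 := by
  rcases eq_or_ne n 0 with rfl | hn
  · simp [modeDeriv, freq_zero]
  · have hsq : Real.sqrt 2 ^ 2 = 2 := Real.sq_sqrt zero_le_two
    rw [mode_of_ne_zero hn, modeDeriv, neg_sq, mul_pow, mul_pow, mul_pow, hsq, Real.sin_sq]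
    ring

theorem isPrimitive_mode (n : ℕ) : IsPrimitive (mode n) (modeDeriv n) :=
  .of_hasDerivAt (hasDerivAt_mode n) (continuous_modeDeriv n)

theorem isPrimitive_modeDeriv (n : ℕ) :
    IsPrimitive (modeDeriv n) (fun y => -freq n ^ 2 * mode n y) :=
  .of_hasDerivAt (hasDerivAt_modeDeriv n) (by fun_prop)

-- Green's formula: both modes satisfy the Neumann condition.
theorem integral_modeDeriv_mul_modeDeriv_eq (n m : ℕ) :
    ∫ y in Ioo (0 : ℝ) 1, modeDeriv n y * modeDeriv m y
      = freq m ^ 2 * ∫ y in Ioo (0 : ℝ) 1, mode n y * mode m y := by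
  have hparts := (isPrimitive_modeDeriv m).setIntegral_Ioo_deriv_smul (isPrimitive_mode n)
    (a := 0) (b := 1) (by simp [modeDeriv_zero_right]) (by simp [modeDeriv_one_right])
  rw [← neg_eq_iff_eq_neg, ← integral_neg] at hparts
  rw [← integral_const_mul]
  refine Eq.trans (integral_congr_ae (.of_forall fun y => mul_comm _ _))
    (hparts.symm.trans (integral_congr_ae (.of_forall fun y => ?_)))
  simp only [smul_eq_mul]
  ring

theorem integral_mode_sq (n : ℕ) : ∫ y in Ioo (0 : ℝ) 1, mode n y * mode n y = 1 := by
  rcases eq_or_ne n 0 with rfl | hn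
  · simp [mode_zero]
  have hgreen := integral_modeDeriv_mul_modeDeriv_eq n n
  simp only [← pow_two, modeDeriv_sq] at hgreen ⊢
  rw [integral_sub (integrable_const _)
    ((Continuous.integrableOn_Icc (by fun_prop)).mono_set Ioo_subset_Icc_self)] at hgreen
  simp only [integral_const_mul, integral_const, MeasurableSet.univ, measureReal_restrict_apply,
    univ_inter, Real.volume_real_Ioo_of_le zero_le_one, sub_zero, one_smul] at hgreen
  have hfreq : freq n ^ 2 ≠ 0 := pow_ne_zero 2 fun h => hn (freq_injective (h.trans freq_zero.symm))
  exact mul_left_cancel₀ hfreq (by linarith)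

theorem integral_mode_mul_mode (n m : ℕ) :
    ∫ y in Ioo (0 : ℝ) 1, mode n y * mode m y = if n = m then 1 else 0 := by
  split_ifs with hnm
  · rw [hnm, integral_mode_sq]
  have hgreen := integral_modeDeriv_mul_modeDeriv_eq n m
  have hgreen' := integral_modeDeriv_mul_modeDeriv_eq m n
  simp only [mul_comm (modeDeriv m _), mul_comm (mode m _)] at hgreen'
  have hfreq : freq m ^ 2 - freq n ^ 2 ≠ 0 := sub_ne_zero.2 fun h =>
    hnm (freq_injective ((pow_left_inj₀ (freq_nonneg n) (freq_nonneg m) two_ne_zero).1 h.symm))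
  exact (mul_eq_zero.1 (by linarith : (freq m ^ 2 - freq n ^ 2) *
    ∫ y in Ioo (0 : ℝ) 1, mode n y * mode m y = 0)).resolve_left hfreq

/-- The mode `φₙ` with its first and second derivatives. -/
def modeJet (n : ℕ) : Fin 3 → ℝ → ℝ := ![mode n, modeDeriv n, fun y => -freq n ^ 2 * mode n y]

theorem continuous_modeJet (n : ℕ) (a : Fin 3) : Continuous (modeJet n a) := by
  fin_cases a
  exacts [continuous_mode n, continuous_modeDeriv n, (continuous_mode n).const_mul _]

theorem integral_modeJet_mul_modeJet (n m : ℕ) (a : Fin 3) :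
    ∫ y in Ioo (0 : ℝ) 1, modeJet n a y * modeJet m a y
      = if n = m then freq n ^ (2 * (a : ℕ)) else 0 := by
  fin_cases a
  · simpa [modeJet] using integral_mode_mul_mode n m
  · simp only [modeJet, Fin.mk_one, Matrix.cons_val_one, Matrix.cons_val_zero,
      integral_modeDeriv_mul_modeDeriv_eq, integral_mode_mul_mode]
    split_ifs with hnm <;> simp [hnm]
  · have hfactor : ∀ y, modeJet n 2 y * modeJet m 2 y
        = freq n ^ 2 * freq m ^ 2 * (mode n y * mode m y) := fun y => by
      simp only [modeJet, Matrix.cons_val]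
      ring
    simp only [Fin.reduceFinMk, hfactor, integral_const_mul, integral_mode_mul_mode]
    split_ifs with hnm
    · rw [hnm]; ring
    · simp

end Modes

section SeparatedVariables

/-- The function with separated variables `(x, y) ↦ g y • F x`, such as a modal term
`w(x) φₙ(y)`. -/
def sep (F : ℝ → ℂ) (g : ℝ → ℝ) (p : ℝ × ℝ) : ℂ := g p.2 • F p.1

variable {R : ℝ} {F F' : ℝ → ℂ} {g g' : ℝ → ℝ}

theorem volume_restrict_box (R : ℝ) : (volume : Measure (ℝ × ℝ)).restrict (box R)
    = (volume.restrict (Ioo (-R) R)).prod (volume.restrict (Ioo (0 : ℝ) 1)) := by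
  rw [Measure.prod_restrict]
  rfl

theorem ae_restrict_box_of_ae {P : ℝ → Prop} (h : ∀ᵐ x ∂volume.restrict (Ioo (-R) R), P x) :
    ∀ᵐ p ∂volume.restrict (box R), P p.1 := by
  rw [volume_restrict_box]
  exact Measure.quasiMeasurePreserving_fst.ae h

theorem memLp_Ioo_of_continuous {E : Type*} [NormedAddCommGroup E] {f : ℝ → E}
    (hf : Continuous f) (p : ENNReal) (a b : ℝ) : MemLp f p (volume.restrict (Ioo a b)) := by
  obtain ⟨C, hC⟩ := (isCompact_Icc (a := a) (b := b)).exists_bound_of_continuousOn hf.continuousOn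
  exact .of_bound hf.aestronglyMeasurable C ((ae_restrict_mem measurableSet_Ioo).mono
    fun x hx => hC x (Ioo_subset_Icc_self hx))

theorem memLp_sep (hF : MemLp F 2 (volume.restrict (Ioo (-R) R))) (hg : Continuous g) :
    MemLp (sep F g) 2 (volume.restrict (box R)) := by
  have hgL := memLp_Ioo_of_continuous hg 2 0 1
  rw [volume_restrict_box, memLp_two_iff_integrable_sq_norm
    (show AEStronglyMeasurable (sep F g) _ from hgL.1.comp_snd.smul hF.1.comp_fst)]
  have hprod := ((memLp_two_iff_integrable_sq_norm hF.1).1 hF).mul_prod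
    ((memLp_two_iff_integrable_sq_norm hgL.1).1 hgL)
  simpa only [sep, norm_smul, mul_pow, mul_comm] using hprod

/-- The class in `L²` of a function with separated variables. -/
def sepLp (hF : MemLp F 2 (volume.restrict (Ioo (-R) R))) (hg : Continuous g) : L2 (box R) :=
  (memLp_sep hF hg).toLp

theorem coeFn_sepLp (hF : MemLp F 2 (volume.restrict (Ioo (-R) R))) (hg : Continuous g) :
    sepLp hF hg =ᵐ[volume.restrict (box R)] sep F g :=
  (memLp_sep hF hg).coeFn_toLp

theorem inner_sepLp_sepLp (hF : MemLp F 2 (volume.restrict (Ioo (-R) R))) (hg : Continuous g)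
    (hF' : MemLp F' 2 (volume.restrict (Ioo (-R) R))) (hg' : Continuous g') :
    inner ℂ (sepLp hF hg) (sepLp hF' hg')
      = (∫ x in Ioo (-R) R, inner ℂ (F x) (F' x)) * ↑(∫ y in Ioo (0 : ℝ) 1, g y * g' y) := by
  rw [L2.inner_def, ← integral_complex_ofReal, ← integral_prod_mul, ← volume_restrict_box]
  refine integral_congr_ae ?_
  filter_upwards [coeFn_sepLp hF hg, coeFn_sepLp hF' hg'] with p hp hp'
  simp only [hp, hp', sep, RCLike.inner_apply, Complex.real_smul, map_mul, Complex.conj_ofReal,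
    Complex.ofReal_mul]
  ring

/-- The squared norm of `F` in `L²(-R, R)`. -/
def normSq (R : ℝ) (F : ℝ → ℂ) : ℝ := ∫ x in Ioo (-R) R, ‖F x‖ ^ 2

theorem normSq_nonneg (R : ℝ) (F : ℝ → ℂ) : 0 ≤ normSq R F :=
  integral_nonneg fun _ => sq_nonneg _

theorem norm_sepLp_sq (hF : MemLp F 2 (volume.restrict (Ioo (-R) R))) (hg : Continuous g) :
    ‖sepLp hF hg‖ ^ 2 = normSq R F * ∫ y in Ioo (0 : ℝ) 1, g y * g y := by
  apply Complex.ofReal_injective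
  have hinner := inner_sepLp_sepLp hF hg hF hg
  simp only [inner_self_eq_norm_sq_to_K] at hinner
  rw [normSq, Complex.ofReal_mul, ← integral_complex_ofReal]
  simpa using hinner

end SeparatedVariables

section Slices

variable {R : ℝ} {F f : ℝ → ℂ} {G g : ℝ → ℝ} {φ : ℝ × ℝ → ℝ} {U V : Set (ℝ × ℝ)}

theorem IsTest.mono (hφ : IsTest V φ) (h : V ⊆ U) : IsTest U φ :=
  ⟨hφ.smooth, hφ.compact, hφ.supp.trans h⟩

theorem IsTest.eq_zero (hφ : IsTest V φ) {p : ℝ × ℝ} (hp : p ∉ V) : φ p = 0 :=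
  image_eq_zero_of_notMem_tsupport fun h => hp (hφ.supp h)

theorem IsTest.continuous_partialDeriv (hφ : IsTest V φ) (i : Fin 2) :
    Continuous (partialDeriv i φ) :=
  (hφ.smooth.continuous_fderiv (by simp)).clm_apply continuous_const

theorem IsTest.isPrimitive_slice_fst (hφ : IsTest V φ) (y : ℝ) :
    IsPrimitive (fun x => φ (x, y)) (fun x => partialDeriv 0 φ (x, y)) := by
  refine .of_hasDerivAt (fun x => ?_) ((hφ.continuous_partialDeriv 0).comp (by fun_prop))
  have hφ' := (hφ.smooth.differentiable (by simp) (x, y)).hasFDerivAt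
  simpa [partialDeriv, basisVec] using!
    hφ'.comp_hasDerivAt x ((hasDerivAt_id x).prodMk (hasDerivAt_const x y))

theorem IsTest.isPrimitive_slice_snd (hφ : IsTest V φ) (x : ℝ) :
    IsPrimitive (fun y => φ (x, y)) (fun y => partialDeriv 1 φ (x, y)) := by
  refine .of_hasDerivAt (fun y => ?_) ((hφ.continuous_partialDeriv 1).comp (by fun_prop))
  have hφ' := (hφ.smooth.differentiable (by simp) (x, y)).hasFDerivAt
  simpa [partialDeriv, basisVec] using!
    hφ'.comp_hasDerivAt y ((hasDerivAt_const y x).prodMk (hasDerivAt_id y))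

theorem integrable_smul_sep {ψ : ℝ × ℝ → ℝ} (hψ : Continuous ψ) (hF : LocallyIntegrable F)
    (hg : Continuous g) (R : ℝ) :
    Integrable (fun p => ψ p • sep F g p)
      ((volume.restrict (Ioo (-R) R)).prod (volume.restrict (Ioo (0 : ℝ) 1))) := by
  have hFi : Integrable F (volume.restrict (Ioo (-R) R)) :=
    (hF.integrableOn_isCompact isCompact_Icc).mono_set Ioo_subset_Icc_self
  have hψg : Continuous fun p : ℝ × ℝ => ψ p * g p.2 := by fun_prop
  obtain ⟨C, hC⟩ := ((isCompact_Icc (a := -R) (b := R)).prod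
    (isCompact_Icc (a := (0 : ℝ)) (b := 1))).exists_bound_of_continuousOn hψg.continuousOn
  have hbound : ∀ᵐ p ∂(volume.restrict (Ioo (-R) R)).prod (volume.restrict (Ioo (0 : ℝ) 1)),
      ‖ψ p * g p.2‖ ≤ C := by
    rw [Measure.prod_restrict]
    filter_upwards [ae_restrict_mem (measurableSet_Ioo.prod measurableSet_Ioo)] with p hp
    exact hC p ⟨Ioo_subset_Icc_self hp.1, Ioo_subset_Icc_self hp.2⟩
  have hint := (hFi.comp_fst _).bdd_smul C hψg.aestronglyMeasurable hbound
  simp only [sep, ← mul_smul]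
  exact hint

theorem integral_partialDeriv_zero_smul_sep (hφ : IsTest (Ioo (-R) R ×ˢ univ) φ)
    (hF : IsPrimitive F f) (hg : Continuous g) :
    ∫ p in box R, partialDeriv 0 φ p • sep F g p = -∫ p in box R, φ p • sep f g p := by
  rw [volume_restrict_box,
    integral_prod_symm _ (integrable_smul_sep (hφ.continuous_partialDeriv 0)
      hF.continuous.locallyIntegrable hg R),
    integral_prod_symm _ (integrable_smul_sep hφ.smooth.continuous hF.locallyIntegrable hg R),
    ← integral_neg]
  refine integral_congr_ae (.of_forall fun y => ?_)
  have hzero : ∀ x, x ∉ Ioo (-R) R → φ (x, y) = 0 := fun x hx => hφ.eq_zero fun h => hx h.1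
  have hparts := (hφ.isPrimitive_slice_fst y).setIntegral_Ioo_deriv_smul hF
    (a := -R) (b := R) (by simp [hzero]) (by simp [hzero])
  simp only [sep, smul_comm _ (g y), integral_smul, hparts, smul_neg]

theorem integral_partialDeriv_one_smul_sep (hφ : IsTest V φ) (hF : LocallyIntegrable F)
    (hG : IsPrimitive G g) (hg : Continuous g) (h0 : ∀ x, φ (x, 0) * G 0 = 0)
    (h1 : ∀ x, φ (x, 1) * G 1 = 0) :
    ∫ p in box R, partialDeriv 1 φ p • sep F G p = -∫ p in box R, φ p • sep F g p := by
  rw [volume_restrict_box,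
    integral_prod _ (integrable_smul_sep (hφ.continuous_partialDeriv 1) hF hG.continuous R),
    integral_prod _ (integrable_smul_sep hφ.smooth.continuous hF hg R), ← integral_neg]
  refine integral_congr_ae (.of_forall fun x => ?_)
  have hparts := (hφ.isPrimitive_slice_snd x).setIntegral_Ioo_deriv_smul hG (h0 x) (h1 x)
  simp only [sep, smul_smul, integral_smul_const]
  simp only [smul_eq_mul] at hparts
  rw [hparts, neg_smul]

theorem isWeakPartial_zero_sepLp (hF : IsPrimitive F f)
    (hFL : MemLp F 2 (volume.restrict (Ioo (-R) R)))
    (hf : MemLp f 2 (volume.restrict (Ioo (-R) R))) (hg : Continuous g) :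
    IsWeakPartial (box R) 0 (sepLp hFL hg) (sepLp hf hg) := fun φ hφ => by
  rw [integral_congr_ae ((coeFn_sepLp hFL hg).mono fun p hp => congrArg _ hp),
    integral_congr_ae ((coeFn_sepLp hf hg).mono fun p hp => congrArg _ hp)]
  exact integral_partialDeriv_zero_smul_sep (hφ.mono (prod_mono_right (subset_univ _))) hF hg

theorem isWeakPartial_one_sepLp (hF : LocallyIntegrable F)
    (hFL : MemLp F 2 (volume.restrict (Ioo (-R) R))) (hG : IsPrimitive G g)
    (hg : Continuous g) :
    IsWeakPartial (box R) 1 (sepLp hFL hG.continuous) (sepLp hFL hg) := fun φ hφ => by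
  have hzero : ∀ x y, y ∉ Ioo (0 : ℝ) 1 → φ (x, y) = 0 := fun x y hy =>
    hφ.eq_zero fun h => hy h.2
  rw [integral_congr_ae ((coeFn_sepLp hFL hG.continuous).mono fun p hp => congrArg _ hp),
    integral_congr_ae ((coeFn_sepLp hFL hg).mono fun p hp => congrArg _ hp)]
  exact integral_partialDeriv_one_smul_sep hφ hF hG hg (by simp [hzero]) (by simp [hzero])

end Slices

section SobolevSpace

variable {U : Set (ℝ × ℝ)}

/-- Integration against a real function of class `L²`, as a continuous functional on `L²(U)`. -/
def testCLM {φ : ℝ × ℝ → ℝ} (hφ : MemLp φ 2 (volume.restrict U)) : L2 U →L[ℂ] ℂ :=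
  innerSL ℂ (hφ.ofReal (K := ℂ)).toLp

theorem testCLM_apply {φ : ℝ × ℝ → ℝ} (hφ : MemLp φ 2 (volume.restrict U)) (f : L2 U) :
    testCLM hφ f = ∫ p in U, φ p • f p := by
  rw [testCLM, innerSL_apply_apply, L2.inner_def]
  refine integral_congr_ae ?_
  filter_upwards [(hφ.ofReal (K := ℂ)).coeFn_toLp] with p hp
  rw [RCLike.inner_apply, hp, Complex.real_smul, mul_comm]
  exact congrArg (· * f p) (Complex.conj_ofReal _)

theorem isClosed_setOf_isWeakPartial {X : Type*} [TopologicalSpace X] {f g : X → L2 U}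
    (hf : Continuous f) (hg : Continuous g) (i : Fin 2) :
    IsClosed {v : X | IsWeakPartial U i (f v) (g v)} := by
  simp only [IsWeakPartial, ofPred_forall]
  refine isClosed_iInter fun φ => isClosed_iInter fun hφ => ?_
  simp only [← testCLM_apply (hφ.memLp _), ← testCLM_apply (hφ.memLp_partialDeriv i _)]
  exact isClosed_eq ((testCLM _).continuous.comp hf) ((testCLM _).continuous.comp hg).neg

theorem isClosed_H2 (U : Set (ℝ × ℝ)) :
    IsClosed (H2 U : Set (PiLp 2 fun _ : JetIndex => L2 U)) := by
  have hcont : ∀ i, Continuous fun v : PiLp 2 fun _ : JetIndex => L2 U => v i :=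
    fun i => PiLp.continuous_apply 2 _ i
  have hinter : (H2 U : Set (PiLp 2 fun _ : JetIndex => L2 U)) =
      (⋂ j, {v | IsWeakPartial U j (v (.inl ())) (v (.inr (.inl j)))}) ∩
      ⋂ i, ⋂ j, {v | IsWeakPartial U i (v (.inr (.inl j))) (v (.inr (.inr (i, j))))} := by
    ext v
    simp [H2]
  rw [hinter]
  exact (isClosed_iInter fun j => isClosed_setOf_isWeakPartial (hcont _) (hcont _) j).inter
    (isClosed_iInter fun i => isClosed_iInter fun j =>
      isClosed_setOf_isWeakPartial (hcont _) (hcont _) i)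

instance (U : Set (ℝ × ℝ)) : CompleteSpace (H2 U) := (isClosed_H2 U).completeSpace_coe

/-- The map sending an element of `H²(U)` to one of its derivatives. -/
def jetCLM (U : Set (ℝ × ℝ)) (i : JetIndex) : H2 U →L[ℂ] L2 U :=
  (PiLp.proj 2 (fun _ : JetIndex => L2 U) i).comp (H2 U).subtypeL

theorem val_eq_jetCLM (v : H2 U) : val v = jetCLM U (.inl ()) v := rfl

theorem grad_eq_jetCLM (v : H2 U) (j : Fin 2) : grad v j = jetCLM U (.inr (.inl j)) v := rfl

theorem hess_eq_jetCLM (v : H2 U) (i j : Fin 2) :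
    hess v i j = jetCLM U (.inr (.inr (i, j))) v := rfl

theorem norm_sq_eq_sum_jetCLM (v : H2 U) : ‖v‖ ^ 2 = ∑ i, ‖jetCLM U i v‖ ^ 2 :=
  PiLp.norm_sq_eq_of_L2 _ _

theorem inner_eq_sum_jetCLM (v w : H2 U) :
    inner ℂ v w = ∑ i, inner ℂ (jetCLM U i v) (jetCLM U i w) :=
  PiLp.inner_apply _ _

theorem IsWeakPartial.unique (hU : IsOpen U) {i : Fin 2} {f g g' : L2 U}
    (h : IsWeakPartial U i f g) (h' : IsWeakPartial U i f g') : g = g' := by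
  have hlocal : LocallyIntegrableOn (g - g' : L2 U) U := by
    refine (locallyIntegrableOn_iff hU.isLocallyClosed).2 fun K hK hKc => ?_
    have : IsFiniteMeasure (volume.restrict K) := ⟨by simpa using hKc.measure_lt_top⟩
    exact ((Lp.memLp (g - g')).mono_measure (Measure.restrict_mono hK le_rfl)).integrable
      one_le_two
  have hzero : ∀ᵐ p, p ∈ U → (g - g' : L2 U) p = 0 := by
    refine hU.ae_eq_zero_of_integral_contDiff_smul_eq_zero hlocal fun φ h1 h2 h3 => ?_
    have hφ : IsTest U φ := ⟨h1, h2, h3⟩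
    rw [← setIntegral_eq_integral_of_forall_compl_eq_zero (s := U) fun p hp => by
        rw [hφ.eq_zero hp, zero_smul],
      ← testCLM_apply (hφ.memLp _), map_sub, testCLM_apply, testCLM_apply, sub_eq_zero]
    exact neg_injective ((h φ hφ).symm.trans (h' φ hφ))
  rw [← sub_eq_zero, Lp.eq_zero_iff_ae_eq_zero, EventuallyEq, ae_restrict_iff' hU.measurableSet]
  exact hzero

theorem H2.ext_val (hU : IsOpen U) {v w : H2 U} (h : val v = val w) : v = w := by
  have hgrad : ∀ j, grad v j = grad w j := fun j =>
    (v.2.1 j).unique hU (show IsWeakPartial U j (val v) _ from h ▸ w.2.1 j)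
  have hhess : ∀ i j, hess v i j = hess w i j := fun i j =>
    (v.2.2 i j).unique hU (show IsWeakPartial U i (grad v j) _ from hgrad j ▸ w.2.2 i j)
  refine Subtype.ext (PiLp.ext ?_)
  rintro (_ | j | ⟨i, j⟩)
  exacts [h, hgrad j, hhess i j]

theorem isOpen_box (R : ℝ) : IsOpen (box R) := isOpen_Ioo.prod isOpen_Ioo

end SobolevSpace

section Jets

/-- The number of derivatives in the direction `j` contained in a jet index. -/
def derivOrder (j : Fin 2) : JetIndex → Fin 3
  | .inl _ => 0
  | .inr (.inl i) => if i = j then 1 else 0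
  | .inr (.inr (i, i')) => (if i = j then 1 else 0) + (if i' = j then 1 else 0)

/-- `w` is a function on the real line of class `H²_loc` together with its first and second
derivatives. -/
structure IsProfile (w : Fin 3 → ℝ → ℂ) : Prop where
  isPrimitive_zero : IsPrimitive (w 0) (w 1)
  isPrimitive_one : IsPrimitive (w 1) (w 2)
  memLp_two : ∀ R, MemLp (w 2) 2 (volume.restrict (Ioo (-R) R))

variable {w w' : Fin 3 → ℝ → ℂ}

theorem IsProfile.memLp (h : IsProfile w) (R : ℝ) (a : Fin 3) :
    MemLp (w a) 2 (volume.restrict (Ioo (-R) R)) := by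
  fin_cases a
  exacts [memLp_Ioo_of_continuous h.isPrimitive_zero.continuous _ _ _,
    memLp_Ioo_of_continuous h.isPrimitive_one.continuous _ _ _, h.memLp_two R]

/-- The element `w(x) φₙ(y)` of `H²(box R)`. -/
def sepH2 (R : ℝ) (h : IsProfile w) (n : ℕ) : H2 (box R) where
  val := WithLp.toLp 2 fun i =>
    sepLp (h.memLp R (derivOrder 0 i)) (continuous_modeJet n (derivOrder 1 i))
  property := by
    have hw0 := h.isPrimitive_zero.continuous.locallyIntegrable (μ := volume)
    have hw1 := h.isPrimitive_one.continuous.locallyIntegrable (μ := volume)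
    have hmode := continuous_modeJet n
    constructor
    · intro j
      fin_cases j
      exacts [isWeakPartial_zero_sepLp h.isPrimitive_zero (h.memLp R 0) (h.memLp R 1) (hmode 0),
        isWeakPartial_one_sepLp hw0 (h.memLp R 0) (isPrimitive_mode n) (hmode 1)]
    · intro i j
      fin_cases i <;> fin_cases j
      exacts [isWeakPartial_zero_sepLp h.isPrimitive_one (h.memLp R 1) (h.memLp R 2) (hmode 0),
        isWeakPartial_zero_sepLp h.isPrimitive_zero (h.memLp R 0) (h.memLp R 1) (hmode 1),
        isWeakPartial_one_sepLp hw1 (h.memLp R 1) (isPrimitive_mode n) (hmode 1),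
        isWeakPartial_one_sepLp hw0 (h.memLp R 0) (isPrimitive_modeDeriv n) (hmode 2)]

theorem jetCLM_sepH2 (R : ℝ) (h : IsProfile w) (n : ℕ) (i : JetIndex) :
    jetCLM (box R) i (sepH2 R h n)
      = sepLp (h.memLp R (derivOrder 0 i)) (continuous_modeJet n (derivOrder 1 i)) := rfl

theorem inner_sepH2_of_ne (R : ℝ) (h : IsProfile w) (h' : IsProfile w') {n m : ℕ}
    (hnm : n ≠ m) : inner ℂ (sepH2 R h n) (sepH2 R h' m) = 0 := by
  simp only [inner_eq_sum_jetCLM, jetCLM_sepH2, inner_sepLp_sepLp, integral_modeJet_mul_modeJet,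
    if_neg hnm, Complex.ofReal_zero, mul_zero, Finset.sum_const_zero]

theorem norm_sepH2_sq (R : ℝ) (h : IsProfile w) (n : ℕ) :
    ‖sepH2 R h n‖ ^ 2 = (1 + freq n ^ 2 + freq n ^ 4) * normSq R (w 0)
      + (1 + 2 * freq n ^ 2) * normSq R (w 1) + normSq R (w 2) := by
  simp only [norm_sq_eq_sum_jetCLM, jetCLM_sepH2, norm_sepLp_sq, integral_modeJet_mul_modeJet,
    if_true, Fintype.sum_sum_type, Fintype.sum_prod_type, Fin.sum_univ_two, derivOrder]
  simp
  ring

end Jets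

section OrthogonalSeries

variable {𝕜 E ι : Type*} [RCLike 𝕜] [NormedAddCommGroup E] [InnerProductSpace 𝕜 E]
  {v : ι → E} {c : ι → ℝ}

theorem norm_sum_sq_of_pairwise_inner_eq_zero
    (hv : Pairwise fun i j => inner 𝕜 (v i) (v j) = 0) (s : Finset ι) :
    ‖∑ i ∈ s, v i‖ ^ 2 = ∑ i ∈ s, ‖v i‖ ^ 2 := by
  classical
  apply RCLike.ofReal_injective (K := 𝕜)
  push_cast
  simp only [← inner_self_eq_norm_sq_to_K, sum_inner, inner_sum]
  exact Finset.sum_congr rfl fun i hi =>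
    Finset.sum_eq_single_of_mem i hi fun j _ hji => hv hji

theorem summable_of_pairwise_inner_eq_zero [CompleteSpace E]
    (hv : Pairwise fun i j => inner 𝕜 (v i) (v j) = 0) (hc : Summable c)
    (hle : ∀ i, ‖v i‖ ^ 2 ≤ c i) : Summable v := by
  rw [summable_iff_vanishing_norm]
  intro ε hε
  obtain ⟨s, hs⟩ := summable_iff_vanishing_norm.1 hc (ε ^ 2) (by positivity)
  refine ⟨s, fun t ht => lt_of_pow_lt_pow_left₀ 2 hε.le ?_⟩
  rw [norm_sum_sq_of_pairwise_inner_eq_zero hv]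
  exact (Finset.sum_le_sum fun i _ => hle i).trans_lt ((le_abs_self _).trans_lt (hs t ht))

theorem norm_tsum_sq_le_of_pairwise_inner_eq_zero
    (hv : Pairwise fun i j => inner 𝕜 (v i) (v j) = 0) (hsum : Summable v) (hc : Summable c)
    (hle : ∀ i, ‖v i‖ ^ 2 ≤ c i) : ‖∑' i, v i‖ ^ 2 ≤ ∑' i, c i := by
  refine le_of_tendsto (hsum.hasSum.norm.pow 2) (.of_forall fun s => ?_)
  rw [norm_sum_sq_of_pairwise_inner_eq_zero hv]
  exact (Finset.sum_le_sum fun i _ => hle i).trans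
    (hc.sum_le_tsum s fun i _ => (sq_nonneg _).trans (hle i))

theorem sum_norm_sq_le_of_inner_eq (hv : Pairwise fun i j => inner 𝕜 (v i) (v j) = 0) {h : E}
    (hh : ∀ i, inner 𝕜 (v i) h = (‖v i‖ : 𝕜) ^ 2) (s : Finset ι) :
    ∑ i ∈ s, ‖v i‖ ^ 2 ≤ ‖h‖ ^ 2 := by
  have hinner : inner 𝕜 (∑ i ∈ s, v i) h = ((‖∑ i ∈ s, v i‖ ^ 2 : ℝ) : 𝕜) := by
    rw [sum_inner, norm_sum_sq_of_pairwise_inner_eq_zero hv]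
    push_cast
    exact Finset.sum_congr rfl fun i _ => hh i
  have hcauchy := norm_inner_le_norm (𝕜 := 𝕜) (∑ i ∈ s, v i) h
  rw [hinner, RCLike.norm_ofReal, abs_of_nonneg (sq_nonneg _)] at hcauchy
  rw [← norm_sum_sq_of_pairwise_inner_eq_zero hv]
  nlinarith [sq_nonneg (‖∑ i ∈ s, v i‖ - ‖h‖)]

theorem norm_le_norm_of_hasSum_of_pairwise_inner_eq_zero {V : E}
    (hv : Pairwise fun i j => inner 𝕜 (v i) (v j) = 0) (hV : HasSum v V) (i : ι) :
    ‖v i‖ ≤ ‖V‖ := by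
  have hinner (i : ι) : inner 𝕜 (v i) V = (‖v i‖ : 𝕜) ^ 2 :=
    (((innerSL 𝕜 (v i)).hasSum hV).unique (hasSum_single i fun j hj => hv hj.symm)).trans
      (inner_self_eq_norm_sq_to_K _)
  have hsq := sum_norm_sq_le_of_inner_eq hv hinner {i}
  rw [Finset.sum_singleton] at hsq
  exact (pow_le_pow_iff_left₀ (norm_nonneg _) (norm_nonneg _) two_ne_zero).1 hsq

end OrthogonalSeries

section Completeness

theorem integrableOn_Ioo_continuous_smul {𝕜 E : Type*} [RCLike 𝕜] [NormedAddCommGroup E]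
    [NormedSpace 𝕜 E] {a b : ℝ} {f : ℝ → E} (hf : IntegrableOn f (Ioo a b)) {g : ℝ → 𝕜}
    (hg : Continuous g) : IntegrableOn (fun y => g y • f y) (Ioo a b) :=
  memLp_one_iff_integrable.1
    ((memLp_one_iff_integrable.2 hf).smul (memLp_Ioo_of_continuous hg ⊤ a b))

variable {E : Type*} [NormedAddCommGroup E] [NormedSpace ℝ E] {f : ℝ → E} {a b : ℝ}

theorem integral_polynomial_cos_smul_eq_zero (hf : IntegrableOn f (Ioo 0 1))
    (h : ∀ n : ℕ, ∫ y in Ioo (0 : ℝ) 1, mode n y • f y = 0) (P : Polynomial ℝ) :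
    ∫ y in Ioo (0 : ℝ) 1, P.eval (Real.cos (Real.pi * y)) • f y = 0 := by
  have hspan : P ∈ Submodule.span ℝ
      (range fun n => Polynomial.Chebyshev.chebyshevTsequence ℝ n) := by
    rw [Polynomial.Sequence.span _ fun n => by
      simp [Polynomial.Chebyshev.chebyshevTsequence]]
    exact Submodule.mem_top
  have hint (Q : Polynomial ℝ) : IntegrableOn
      (fun y => Q.eval (Real.cos (Real.pi * y)) • f y) (Ioo 0 1) :=
    integrableOn_Ioo_continuous_smul hf (by fun_prop)
  induction hspan using Submodule.span_induction with
  | zero => simp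
  | add P Q _ _ hP hQ =>
    simp only [Polynomial.eval_add, add_smul]
    rw [integral_add (hint P) (hint Q), hP, hQ, add_zero]
  | smul c P _ hP =>
    simp only [Polynomial.eval_smul, smul_assoc]
    rw [integral_smul, hP, smul_zero]
  | mem P hP =>
    obtain ⟨n, rfl⟩ := hP
    simp only [Polynomial.Chebyshev.chebyshevTsequence, Polynomial.Chebyshev.T_real_cos]
    have hn := h n
    rcases eq_or_ne n 0 with rfl | hn0
    · simpa [mode_zero] using hn
    · simp only [mode_of_ne_zero hn0, mul_smul, integral_smul] at hn
      simp only [smul_eq_zero, Real.sqrt_eq_zero', not_le.2 two_pos, false_or, freq] at hn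
      simpa [mul_assoc] using hn

theorem exists_polynomial_cos_near {g : ℝ → ℝ} (hg : Continuous g) {ε : ℝ} (hε : 0 < ε) :
    ∃ P : Polynomial ℝ, ∀ y ∈ Icc (0 : ℝ) 1, |g y - P.eval (Real.cos (Real.pi * y))| ≤ ε := by
  have hcont : ContinuousOn (fun t => g (Real.arccos t / Real.pi)) (Icc (-1) 1) := by
    have := Real.continuous_arccos
    fun_prop
  obtain ⟨P, hP⟩ := exists_polynomial_near_of_continuousOn (-1) 1 _ hcont ε hε
  refine ⟨P, fun y hy => ?_⟩
  have hnear := hP (Real.cos (Real.pi * y)) ⟨Real.neg_one_le_cos _, Real.cos_le_one _⟩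
  rw [Real.arccos_cos (by have := Real.pi_pos; have := hy.1; positivity)
      (mul_le_of_le_one_right Real.pi_pos.le hy.2),
    mul_div_cancel_left₀ _ Real.pi_ne_zero, abs_sub_comm] at hnear
  exact hnear.le

theorem integral_continuous_smul_eq_zero_of_mode (hf : IntegrableOn f (Ioo 0 1))
    (h : ∀ n : ℕ, ∫ y in Ioo (0 : ℝ) 1, mode n y • f y = 0) {g : ℝ → ℝ} (hg : Continuous g) :
    ∫ y in Ioo (0 : ℝ) 1, g y • f y = 0 := by
  set K := ∫ y in Ioo (0 : ℝ) 1, ‖f y‖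
  have hK : 0 ≤ K := integral_nonneg fun _ => norm_nonneg _
  rw [← norm_le_zero_iff]
  refine le_of_forall_pos_le_add fun ε hε => ?_
  obtain ⟨P, hP⟩ := exists_polynomial_cos_near hg (ε := ε / (K + 1)) (by positivity)
  calc ‖∫ y in Ioo (0 : ℝ) 1, g y • f y‖
      = ‖∫ y in Ioo (0 : ℝ) 1, (g y - P.eval (Real.cos (Real.pi * y))) • f y‖ := by
        simp only [sub_smul]
        rw [integral_sub (integrableOn_Ioo_continuous_smul hf hg)
            (integrableOn_Ioo_continuous_smul hf (by fun_prop)),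
          integral_polynomial_cos_smul_eq_zero hf h, sub_zero]
    _ ≤ ∫ y in Ioo (0 : ℝ) 1, ε / (K + 1) * ‖f y‖ := by
        refine norm_integral_le_of_norm_le (hf.norm.const_mul _) ?_
        filter_upwards [ae_restrict_mem measurableSet_Ioo] with y hy
        rw [norm_smul]
        exact mul_le_mul_of_nonneg_right (hP y (Ioo_subset_Icc_self hy)) (norm_nonneg _)
    _ = ε / (K + 1) * K := integral_const_mul _ _
    _ ≤ ε / (K + 1) * (K + 1) := by gcongr; linarith
    _ = 0 + ε := by field_simp; ring

theorem ae_eq_zero_of_integral_mode [CompleteSpace E] (hf : IntegrableOn f (Ioo 0 1))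
    (h : ∀ n : ℕ, ∫ y in Ioo (0 : ℝ) 1, mode n y • f y = 0) :
    f =ᵐ[volume.restrict (Ioo (0 : ℝ) 1)] 0 := by
  rw [EventuallyEq, ae_restrict_iff' measurableSet_Ioo]
  refine isOpen_Ioo.ae_eq_zero_of_integral_contDiff_smul_eq_zero hf.locallyIntegrableOn
    fun g hg _ hsupp => ?_
  rw [← integral_continuous_smul_eq_zero_of_mode hf h hg.continuous,
    setIntegral_eq_integral_of_forall_compl_eq_zero]
  intro y hy
  rw [image_eq_zero_of_notMem_tsupport fun hy' => hy (hsupp hy'), zero_smul]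

end Completeness

section ModalCoefficients

theorem norm_integral_sq_le {α E : Type*} [MeasurableSpace α] {μ : Measure α}
    [IsProbabilityMeasure μ] [NormedAddCommGroup E] [NormedSpace ℝ E] [CompleteSpace E]
    {f : α → E} (hf : Integrable f μ) (hf2 : Integrable (fun x => ‖f x‖ ^ 2) μ) :
    ‖∫ x, f x ∂μ‖ ^ 2 ≤ ∫ x, ‖f x‖ ^ 2 ∂μ :=
  (convexOn_univ_norm.pow (fun _ _ => norm_nonneg _) 2).map_integral_le
    (by fun_prop) isClosed_univ (by simp) hf hf2

theorem memLp_two_integral_prod {α β E : Type*} [MeasurableSpace α] [MeasurableSpace β]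
    {μ : Measure α} {ν : Measure β} [IsFiniteMeasure μ] [IsProbabilityMeasure ν]
    [NormedAddCommGroup E] [NormedSpace ℝ E] [CompleteSpace E] {f : α × β → E}
    (hf : MemLp f 2 (μ.prod ν)) : MemLp (fun x => ∫ y, f (x, y) ∂ν) 2 μ := by
  have hsq := (memLp_two_iff_integrable_sq_norm hf.1).1 hf
  have hmeas := hf.1.integral_prod_right'
  rw [memLp_two_iff_integrable_sq_norm hmeas]
  refine hsq.integral_prod_left.mono (hmeas.norm.pow 2) ?_
  filter_upwards [(hf.integrable one_le_two).prod_right_ae, hsq.prod_right_ae] with x hx hx2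
  rw [Real.norm_of_nonneg (by positivity)]
  exact (norm_integral_sq_le hx hx2).trans (le_abs_self _)

theorem ae_eq_zero_prod_of_ae_ae {α β E : Type*} [MeasurableSpace α] [MeasurableSpace β]
    {μ : Measure α} {ν : Measure β} [SFinite ν] [NormedAddCommGroup E] {f : α × β → E}
    (hf : AEStronglyMeasurable f (μ.prod ν)) (h : ∀ᵐ x ∂μ, ∀ᵐ y ∂ν, f (x, y) = 0) :
    f =ᵐ[μ.prod ν] 0 := by
  refine hf.ae_eq_mk.trans ((Measure.ae_prod_iff_ae_ae ?_).2 ?_)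
  · exact hf.stronglyMeasurable_mk.measurableSet_eq_fun stronglyMeasurable_zero
  · filter_upwards [h, Measure.ae_ae_of_ae_prod hf.ae_eq_mk] with x hx hmk
    filter_upwards [hx, hmk] with y hy hy'
    exact hy'.symm.trans hy

/-- The coefficient of a function on the waveguide along the mode `φₙ`, as a function of the
longitudinal variable. -/
def coef (n : ℕ) (u : ℝ × ℝ → ℂ) (x : ℝ) : ℂ := ∫ y in Ioo (0 : ℝ) 1, mode n y • u (x, y)

variable {R : ℝ} {u v : ℝ × ℝ → ℂ} {F : ℝ → ℂ}

instance : IsProbabilityMeasure (volume.restrict (Ioo (0 : ℝ) 1)) := ⟨by simp⟩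

theorem coef_congr_ae (h : u =ᵐ[volume.restrict (box R)] v) (n : ℕ) :
    coef n u =ᵐ[volume.restrict (Ioo (-R) R)] coef n v := by
  rw [volume_restrict_box] at h
  filter_upwards [Measure.ae_ae_of_ae_prod h] with x hx
  exact integral_congr_ae (hx.mono fun y hy => by simp only [hy])

theorem ae_eq_zero_of_coef (hu : Integrable u (volume.restrict (box R)))
    (h : ∀ n, coef n u =ᵐ[volume.restrict (Ioo (-R) R)] 0) :
    u =ᵐ[volume.restrict (box R)] 0 := by
  rw [volume_restrict_box] at hu ⊢
  refine ae_eq_zero_prod_of_ae_ae hu.1 ?_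
  filter_upwards [ae_all_iff.2 h, hu.prod_right_ae] with x hx hxi
  exact ae_eq_zero_of_integral_mode hxi hx

theorem integrable_of_memLp_box (hu : MemLp u 2 (volume.restrict (box R))) :
    Integrable u (volume.restrict (box R)) := by
  rw [volume_restrict_box] at hu ⊢
  exact hu.integrable one_le_two

theorem memLp_mode_smul (hu : MemLp u 2 (volume.restrict (box R))) (n : ℕ) :
    MemLp (fun p => mode n p.2 • u p) 2 (volume.restrict (box R)) :=
  hu.smul (φ := fun p : ℝ × ℝ => mode n p.2) (p := ⊤)
    (memLp_top_of_bound ((continuous_mode n).comp continuous_snd).aestronglyMeasurable 2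
      (.of_forall fun p => abs_mode_le n p.2))

theorem memLp_coef (hu : MemLp u 2 (volume.restrict (box R))) (n : ℕ) :
    MemLp (coef n u) 2 (volume.restrict (Ioo (-R) R)) :=
  memLp_two_integral_prod (f := fun p => mode n p.2 • u p)
    (volume_restrict_box R ▸ memLp_mode_smul hu n)

theorem integral_inner_sep_mode (hF : MemLp F 2 (volume.restrict (Ioo (-R) R))) (n : ℕ)
    (hu : MemLp u 2 (volume.restrict (box R))) :
    ∫ p in box R, inner ℂ (sep F (mode n) p) (u p)
      = ∫ x in Ioo (-R) R, inner ℂ (F x) (coef n u x) := by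
  have hint : Integrable (fun p => u p * starRingEnd ℂ (sep F (mode n) p))
      (volume.restrict (box R)) :=
    hu.integrable_mul (memLp_sep hF (continuous_mode n)).star
  simp only [RCLike.inner_apply]
  rw [volume_restrict_box] at hint ⊢
  rw [integral_prod _ hint]
  refine integral_congr_ae (.of_forall fun x => ?_)
  simp only [coef, ← integral_mul_const, sep, Complex.real_smul, map_mul, Complex.conj_ofReal]
  exact integral_congr_ae (.of_forall fun y => by ring)

theorem inner_sepLp_mode (hF : MemLp F 2 (volume.restrict (Ioo (-R) R))) (n : ℕ)
    (h : L2 (box R)) :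
    inner ℂ (sepLp hF (continuous_mode n)) h
      = ∫ x in Ioo (-R) R, inner ℂ (F x) (coef n h x) := by
  rw [← integral_inner_sep_mode hF n (Lp.memLp h), L2.inner_def]
  exact integral_congr_ae ((coeFn_sepLp hF (continuous_mode n)).mono
    fun p hp => congrArg (inner ℂ · (h p)) hp)

/-- The component of a function along the mode `φₙ`. -/
def modePart (n : ℕ) (h : L2 (box R)) : L2 (box R) :=
  sepLp (memLp_coef (Lp.memLp h) n) (continuous_mode n)

theorem norm_modePart_sq (n : ℕ) (h : L2 (box R)) :
    ‖modePart n h‖ ^ 2 = normSq R (coef n h) := by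
  rw [modePart, norm_sepLp_sq, integral_mode_mul_mode, if_pos rfl, mul_one]

theorem inner_sepLp_mode_modePart (hF : MemLp F 2 (volume.restrict (Ioo (-R) R))) (n m : ℕ)
    (h : L2 (box R)) :
    inner ℂ (sepLp hF (continuous_mode n)) (modePart m h)
      = if n = m then inner ℂ (sepLp hF (continuous_mode n)) h else 0 := by
  rw [modePart, inner_sepLp_sepLp, integral_mode_mul_mode]
  split_ifs with hnm
  · subst hnm
    rw [inner_sepLp_mode, Complex.ofReal_one, mul_one]
  · rw [Complex.ofReal_zero, mul_zero]

theorem inner_modePart_modePart_of_ne (h h' : L2 (box R)) {n m : ℕ} (hnm : n ≠ m) :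
    inner ℂ (modePart n h) (modePart m h') = 0 :=
  (inner_sepLp_mode_modePart _ n m h').trans (if_neg hnm)

theorem inner_modePart_self (n : ℕ) (h : L2 (box R)) :
    inner ℂ (modePart n h) h = (‖modePart n h‖ : ℂ) ^ 2 := by
  have hinner := inner_sepLp_mode_modePart (memLp_coef (Lp.memLp h) n) n n h
  rw [if_pos rfl] at hinner
  exact hinner.symm.trans (inner_self_eq_norm_sq_to_K _)

theorem sum_normSq_coef_le (h : L2 (box R)) (s : Finset ℕ) :
    ∑ n ∈ s, normSq R (coef n h) ≤ ‖h‖ ^ 2 := by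
  simp only [← norm_modePart_sq]
  exact sum_norm_sq_le_of_inner_eq (𝕜 := ℂ)
    (fun _ _ hnm => inner_modePart_modePart_of_ne h h hnm) (fun n => inner_modePart_self n h) s

theorem summable_normSq_coef (h : L2 (box R)) : Summable fun n => normSq R (coef n h) :=
  summable_of_sum_le (fun n => normSq_nonneg R (coef n h)) (sum_normSq_coef_le h)

theorem tsum_normSq_coef_le (h : L2 (box R)) : ∑' n, normSq R (coef n h) ≤ ‖h‖ ^ 2 :=
  (summable_normSq_coef h).tsum_le_of_sum_le (sum_normSq_coef_le h)

theorem eq_zero_of_modePart_eq_zero {h : L2 (box R)} (hzero : ∀ n, modePart n h = 0) :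
    h = 0 := by
  rw [Lp.eq_zero_iff_ae_eq_zero]
  refine ae_eq_zero_of_coef (integrable_of_memLp_box (Lp.memLp h)) fun n => ?_
  have hsq : normSq R (coef n h) = 0 := by rw [← norm_modePart_sq, hzero, norm_zero]; simp
  have hcoef := memLp_coef (Lp.memLp h) n
  rw [normSq, integral_eq_zero_iff_of_nonneg (fun _ => by positivity)
    ((memLp_two_iff_integrable_sq_norm hcoef.1).1 hcoef)] at hsq
  filter_upwards [hsq] with x hx
  simpa using hx

theorem hasSum_modePart (h : L2 (box R)) : HasSum (fun n => modePart n h) h := by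
  have hsum : Summable fun n => modePart n h :=
    summable_of_pairwise_inner_eq_zero (𝕜 := ℂ)
      (fun _ _ hnm => inner_modePart_modePart_of_ne h h hnm)
      (summable_normSq_coef h) (fun n => (norm_modePart_sq n h).le)
  set d := h - ∑' n, modePart n h with hd
  have horth (n : ℕ) {F : ℝ → ℂ} (hF : MemLp F 2 (volume.restrict (Ioo (-R) R))) :
      inner ℂ (sepLp hF (continuous_mode n)) d = 0 := by
    have htsum := (innerSL ℂ (sepLp hF (continuous_mode n))).map_tsum hsum
    simp only [innerSL_apply_apply, inner_sepLp_mode_modePart, tsum_ite_eq'] at htsum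
    rw [hd, inner_sub_right, htsum]
    simp
  have hd0 : d = 0 := eq_zero_of_modePart_eq_zero fun n => by
    have := inner_modePart_self n d
    rw [modePart, horth] at this
    rw [modePart]
    simpa using this.symm
  have hh : ∑' n, modePart n h = h := (sub_eq_zero.1 hd0).symm
  simpa only [hh] using hsum.hasSum

end ModalCoefficients

section SchurTest

open ENNReal

variable {α β : Type*} [MeasurableSpace α] [MeasurableSpace β]

theorem lintegral_mul_sq_le {ν : Measure β} {K g : β → ℝ≥0∞} (hK : Measurable K)
    (hg : AEMeasurable g ν) :
    (∫⁻ t, K t * g t ∂ν) ^ 2 ≤ (∫⁻ t, K t ∂ν) * ∫⁻ t, K t * g t ^ 2 ∂ν := by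
  have hhalf (z : ℝ≥0∞) : (z ^ (1 / 2 : ℝ)) ^ 2 = z := by
    rw [← ENNReal.rpow_natCast, ← ENNReal.rpow_mul]
    norm_num
  have hsplit (t : β) : K t * g t = K t ^ (1 / 2 : ℝ) * (K t ^ (1 / 2 : ℝ) * g t) := by
    rw [← mul_assoc, ← sq, hhalf]
  have hholder := ENNReal.lintegral_mul_le_Lp_mul_Lq ν .two_two
    (hK.pow_const (1 / 2 : ℝ)).aemeasurable
    ((hK.pow_const (1 / 2 : ℝ)).aemeasurable.mul hg)
  simp only [Pi.mul_apply, ← hsplit, ENNReal.rpow_two, mul_pow, hhalf] at hholder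
  simpa only [mul_pow, hhalf] using pow_le_pow_left₀ zero_le hholder 2

theorem lintegral_lintegral_mul_sq_le {μ : Measure α} {ν : Measure β} [SFinite μ] [SFinite ν]
    {K : α → β → ℝ≥0∞} (hK : Measurable (Function.uncurry K)) {g : β → ℝ≥0∞}
    (hg : AEMeasurable g ν) {C D : ℝ≥0∞} (hC : ∀ x, ∫⁻ t, K x t ∂ν ≤ C)
    (hD : ∀ t, ∫⁻ x, K x t ∂μ ≤ D) :
    ∫⁻ x, (∫⁻ t, K x t * g t ∂ν) ^ 2 ∂μ ≤ C * D * ∫⁻ t, g t ^ 2 ∂ν := by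
  have hmeas : AEMeasurable (Function.uncurry fun x t => K x t * g t ^ 2) (μ.prod ν) :=
    hK.aemeasurable.mul (hg.pow_const 2).comp_snd
  calc ∫⁻ x, (∫⁻ t, K x t * g t ∂ν) ^ 2 ∂μ
      ≤ ∫⁻ x, C * ∫⁻ t, K x t * g t ^ 2 ∂ν ∂μ := lintegral_mono fun x =>
        (lintegral_mul_sq_le (hK.comp measurable_prodMk_left) hg).trans
          (mul_le_mul_left (hC x) _)
    _ = C * ∫⁻ t, (∫⁻ x, K x t ∂μ) * g t ^ 2 ∂ν := by
        have houter : AEMeasurable (fun x => ∫⁻ t, K x t * g t ^ 2 ∂ν) μ :=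
          hmeas.lintegral_prod_right'
        rw [lintegral_const_mul'' _ houter, lintegral_lintegral_swap hmeas]
        exact congrArg (C * ·) <| lintegral_congr fun t =>
          lintegral_mul_const _ (hK.comp measurable_prodMk_right)
    _ ≤ C * D * ∫⁻ t, g t ^ 2 ∂ν := by
        rw [mul_assoc, ← lintegral_const_mul'' D (hg.pow_const 2)]
        gcongr with t
        exact hD t

end SchurTest

section OneDimensionalHelmholtz

variable {r R : ℝ} {f g : ℝ → ℂ} {κ : ℂ} {x : ℝ}

/-- A source on the line: a function in `L²(ℝ)` that vanishes outside `(-r, r)`. -/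
structure IsSource (r : ℝ) (f : ℝ → ℂ) : Prop where
  memLp : MemLp f 2
  eq_zero : ∀ t, t ∉ Ioo (-r) r → f t = 0

theorem IsSource.integrable_continuous_mul (hf : IsSource r f) {h : ℝ → ℂ} (hh : Continuous h) :
    Integrable fun t => h t * f t :=
  (integrableOn_iff_integrable_of_support_subset (s := Ioo (-r) r) fun t ht => by
    contrapose! ht
    simp [hf.eq_zero t ht]).1 <|
    integrableOn_Ioo_continuous_smul ((hf.memLp.restrict _).integrable one_le_two) hh

/-- The exponential `e^{iκx}`. -/
def wave (κ : ℂ) (x : ℝ) : ℂ := Complex.exp (Complex.I * κ * x)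

theorem hasDerivAt_wave (κ : ℂ) (x : ℝ) :
    HasDerivAt (wave κ) (Complex.I * κ * wave κ x) x := by
  have h := ((hasDerivAt_id x).ofReal_comp.const_mul (Complex.I * κ)).cexp
  simp only [id, Complex.ofReal_one, mul_one] at h
  rw [mul_comm]
  exact h

@[fun_prop]
theorem continuous_wave (κ : ℂ) : Continuous (wave κ) := by unfold wave; fun_prop

theorem isPrimitive_wave (κ : ℂ) : IsPrimitive (wave κ) fun x => Complex.I * κ * wave κ x :=
  .of_hasDerivAt (hasDerivAt_wave κ) (by fun_prop)

theorem wave_add (κ : ℂ) (x y : ℝ) : wave κ (x + y) = wave κ x * wave κ y := by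
  simp only [wave, ← Complex.exp_add, Complex.ofReal_add, mul_add]

theorem wave_neg (κ : ℂ) (x : ℝ) : wave (-κ) x = wave κ (-x) := by
  simp [wave]

theorem wave_zero_right (κ : ℂ) : wave κ 0 = 1 := by simp [wave]

theorem norm_wave (κ : ℂ) (x : ℝ) : ‖wave κ x‖ = Real.exp (-(κ.im * x)) := by
  simp [wave, Complex.norm_exp]

/-- The wave travelling to the right that is generated by the sources on the left of `x`. -/
def rightgoing (κ : ℂ) (f : ℝ → ℂ) (x : ℝ) : ℂ := ∫ t in Iic x, wave κ (x - t) * f t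

/-- The wave travelling to the left that is generated by the sources on the right of `x`. -/
def leftgoing (κ : ℂ) (f : ℝ → ℂ) (x : ℝ) : ℂ := ∫ t in Ioi x, wave κ (t - x) * f t

theorem isPrimitive_rightgoing (hf : IsSource r f) :
    IsPrimitive (rightgoing κ f) fun x => Complex.I * κ * rightgoing κ f x + f x := by
  have hi : Integrable fun t => wave (-κ) t * f t := hf.integrable_continuous_mul (by fun_prop)
  have hamp : IsPrimitive (fun x => ∫ t in Iic x, wave (-κ) t * f t) fun t => wave (-κ) t * f t :=
    ⟨hi.locallyIntegrable, fun a b => (intervalIntegral.integral_Iic_sub_Iic hi.integrableOn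
      hi.integrableOn).symm⟩
  have hfactor : rightgoing κ f = fun x => wave κ x • ∫ t in Iic x, wave (-κ) t * f t := by
    ext x
    simp only [rightgoing, sub_eq_add_neg, wave_add, wave_neg, smul_eq_mul, mul_assoc,
      integral_const_mul]
  rw [hfactor]
  refine ((isPrimitive_wave κ).smul hamp).congr_ae (.of_forall fun x => ?_)
  have hcancel : wave κ x * wave (-κ) x = 1 := by
    rw [wave_neg, ← wave_add, add_neg_cancel, wave_zero_right]
  simp only [smul_eq_mul]
  linear_combination f x * hcancel

theorem isPrimitive_leftgoing (hf : IsSource r f) :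
    IsPrimitive (leftgoing κ f) fun x => -(Complex.I * κ * leftgoing κ f x) - f x := by
  have hi : Integrable fun t => wave κ t * f t := hf.integrable_continuous_mul (by fun_prop)
  have hamp : IsPrimitive (fun x => ∫ t in Ioi x, wave κ t * f t) fun t => -(wave κ t * f t) := by
    refine ⟨hi.neg.locallyIntegrable, fun a b => ?_⟩
    rw [intervalIntegral.integral_neg, neg_eq_iff_eq_neg, neg_sub,
      intervalIntegral.integral_Ioi_sub_Ioi' hi.integrableOn hi.integrableOn]
  have hfactor : leftgoing κ f = fun x => wave (-κ) x • ∫ t in Ioi x, wave κ t * f t := by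
    ext x
    simp only [leftgoing, sub_eq_neg_add, wave_add, wave_neg, smul_eq_mul, mul_assoc,
      integral_const_mul]
  rw [hfactor]
  refine ((isPrimitive_wave (-κ)).smul hamp).congr_ae (.of_forall fun x => ?_)
  have hcancel : wave κ x * wave (-κ) x = 1 := by
    rw [wave_neg, ← wave_add, add_neg_cancel, wave_zero_right]
  simp only [smul_eq_mul]
  linear_combination -(f x) * hcancel

theorem rightgoing_eq_zero (hf : IsSource r f) (hx : x ≤ -r) : rightgoing κ f x = 0 :=
  setIntegral_eq_zero_of_forall_eq_zero fun t ht => by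
    rw [hf.eq_zero t fun h => (h.1.trans_le ht).not_ge hx, mul_zero]

theorem leftgoing_eq_zero (hf : IsSource r f) (hx : r ≤ x) : leftgoing κ f x = 0 :=
  setIntegral_eq_zero_of_forall_eq_zero fun t ht => by
    rw [hf.eq_zero t fun h => (hx.trans_lt ht).not_gt h.2, mul_zero]

/-- The outgoing solution of `w'' + κ² w = -f` on the line, i.e. the convolution of `f` with
`i e^{iκ|x|} / (2κ)`, together with its first and second derivatives. -/
def outgoing (κ : ℂ) (f : ℝ → ℂ) : Fin 3 → ℝ → ℂ :=
  ![fun x => Complex.I / (2 * κ) * (rightgoing κ f x + leftgoing κ f x),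
    fun x => 2⁻¹ * (leftgoing κ f x - rightgoing κ f x),
    fun x => -κ ^ 2 * (Complex.I / (2 * κ) * (rightgoing κ f x + leftgoing κ f x)) - f x]

theorem outgoing_two (κ : ℂ) (f : ℝ → ℂ) (x : ℝ) :
    outgoing κ f 2 x = -κ ^ 2 * outgoing κ f 0 x - f x := rfl

theorem isProfile_outgoing (hκ : κ ≠ 0) (hf : IsSource r f) : IsProfile (outgoing κ f) := by
  have hR := isPrimitive_rightgoing (κ := κ) hf
  have hL := isPrimitive_leftgoing (κ := κ) hf
  have h0 : IsPrimitive (outgoing κ f 0) (outgoing κ f 1) := by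
    refine ((hR.add hL).const_smul (Complex.I / (2 * κ))).congr_ae (.of_forall fun x => ?_)
    simp only [outgoing, smul_eq_mul, Matrix.cons_val_one, Matrix.cons_val_zero]
    field_simp
    linear_combination κ * (rightgoing κ f x - leftgoing κ f x) * Complex.I_sq
  have h1 : IsPrimitive (outgoing κ f 1) (outgoing κ f 2) := by
    have hsub : outgoing κ f 1
        = fun x => (2⁻¹ : ℂ) • (leftgoing κ f x + (-1 : ℂ) • rightgoing κ f x) := by
      ext x
      simp [outgoing, sub_eq_add_neg]
    rw [hsub]
    refine ((hL.add (hR.const_smul (-1 : ℂ))).const_smul (2⁻¹ : ℂ)).congr_ae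
      (.of_forall fun x => ?_)
    simp only [outgoing, smul_eq_mul, Matrix.cons_val]
    field_simp
    ring
  exact ⟨h0, h1, fun R => ((memLp_Ioo_of_continuous h0.continuous _ _ _).const_mul _).sub
    (hf.memLp.restrict _)⟩

theorem outgoing_one_of_le (hκ : κ ≠ 0) (hf : IsSource r f) (hx : r ≤ x) :
    outgoing κ f 1 x = Complex.I * κ * outgoing κ f 0 x := by
  simp only [outgoing, Matrix.cons_val_one, Matrix.cons_val_zero, leftgoing_eq_zero hf hx]
  field_simp
  linear_combination -rightgoing κ f x * Complex.I_sq

theorem outgoing_one_of_le_neg (hκ : κ ≠ 0) (hf : IsSource r f) (hx : x ≤ -r) :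
    outgoing κ f 1 x = -(Complex.I * κ * outgoing κ f 0 x) := by
  simp only [outgoing, Matrix.cons_val_one, Matrix.cons_val_zero, rightgoing_eq_zero hf hx]
  field_simp
  linear_combination leftgoing κ f x * Complex.I_sq

theorem outgoing_zero_eq_integral (hf : IsSource r f) (x : ℝ) :
    outgoing κ f 0 x = Complex.I / (2 * κ) * ∫ t, wave κ |x - t| * f t := by
  have hi : Integrable fun t => wave κ |x - t| * f t :=
    hf.integrable_continuous_mul (by fun_prop)
  have hleft : rightgoing κ f x = ∫ t in Iic x, wave κ |x - t| * f t :=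
    setIntegral_congr_fun measurableSet_Iic fun t (ht : t ≤ x) => by
      simp only [abs_of_nonneg (sub_nonneg.2 ht)]
  have hright : leftgoing κ f x = ∫ t in Ioi x, wave κ |x - t| * f t :=
    setIntegral_congr_fun measurableSet_Ioi fun t (ht : x < t) => by
      simp only [abs_sub_comm x t, abs_of_pos (sub_pos.2 ht)]
  rw [← intervalIntegral.integral_Iic_add_Ioi hi.integrableOn hi.integrableOn, ← hleft, ← hright]
  rfl

theorem outgoing_zero_eq_setIntegral (hf : IsSource r f) (x : ℝ) :
    outgoing κ f 0 x = Complex.I / (2 * κ) * ∫ t in Ioo (-r) r, wave κ |x - t| * f t := by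
  rw [outgoing_zero_eq_integral hf, setIntegral_eq_integral_of_forall_compl_eq_zero]
  intro t ht
  rw [hf.eq_zero t ht, mul_zero]

theorem enorm_rightgoing_add_enorm_leftgoing_le (hf : IsSource r f) (x : ℝ) :
    ‖rightgoing κ f x‖ₑ + ‖leftgoing κ f x‖ₑ
      ≤ ∫⁻ t in Ioo (-r) r, ‖wave κ |x - t|‖ₑ * ‖f t‖ₑ := by
  have hR : ‖rightgoing κ f x‖ₑ ≤ ∫⁻ t in Iic x, ‖wave κ |x - t|‖ₑ * ‖f t‖ₑ := by
    refine (enorm_integral_le_lintegral_enorm _).trans_eq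
      (setLIntegral_congr_fun measurableSet_Iic fun t (ht : t ≤ x) => ?_)
    simp only [enorm_mul, abs_of_nonneg (sub_nonneg.2 ht)]
  have hL : ‖leftgoing κ f x‖ₑ ≤ ∫⁻ t in Ioi x, ‖wave κ |x - t|‖ₑ * ‖f t‖ₑ := by
    refine (enorm_integral_le_lintegral_enorm _).trans_eq
      (setLIntegral_congr_fun measurableSet_Ioi fun t (ht : x < t) => ?_)
    simp only [enorm_mul, abs_sub_comm x t, abs_of_pos (sub_pos.2 ht)]
  refine (add_le_add hR hL).trans_eq ?_
  rw [← compl_Iic, lintegral_add_compl _ measurableSet_Iic, setLIntegral_eq_of_support_subset]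
  intro t ht
  contrapose! ht
  simp [hf.eq_zero t ht]

theorem enorm_outgoing_zero_le (hf : IsSource r f) (x : ℝ) :
    ‖outgoing κ f 0 x‖ₑ
      ≤ ENNReal.ofReal (2 * ‖κ‖)⁻¹ * ∫⁻ t in Ioo (-r) r, ‖wave κ |x - t|‖ₑ * ‖f t‖ₑ := by
  have hc : ‖Complex.I / (2 * κ)‖ₑ = ENNReal.ofReal (2 * ‖κ‖)⁻¹ := by
    rw [← ofReal_norm, norm_div, norm_mul, Complex.norm_I, Complex.norm_ofNat, one_div]
  calc ‖outgoing κ f 0 x‖ₑ = ‖Complex.I / (2 * κ)‖ₑ * ‖rightgoing κ f x + leftgoing κ f x‖ₑ :=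
        enorm_mul _ _
    _ ≤ _ := by
        rw [hc]
        gcongr
        exact (enorm_add_le _ _).trans (enorm_rightgoing_add_enorm_leftgoing_le hf x)

theorem enorm_outgoing_one_le (hf : IsSource r f) (x : ℝ) :
    ‖outgoing κ f 1 x‖ₑ
      ≤ ENNReal.ofReal 2⁻¹ * ∫⁻ t in Ioo (-r) r, ‖wave κ |x - t|‖ₑ * ‖f t‖ₑ := by
  have hc : ‖(2⁻¹ : ℂ)‖ₑ = ENNReal.ofReal 2⁻¹ := by
    rw [← ofReal_norm, norm_inv, Complex.norm_ofNat]
  calc ‖outgoing κ f 1 x‖ₑ = ‖(2⁻¹ : ℂ)‖ₑ * ‖leftgoing κ f x - rightgoing κ f x‖ₑ :=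
        enorm_mul _ _
    _ ≤ _ := by
        rw [hc]
        gcongr
        exact enorm_sub_le.trans
          ((add_comm _ _).trans_le (enorm_rightgoing_add_enorm_leftgoing_le hf x))

theorem ofReal_normSq {F : ℝ → ℂ} (hF : MemLp F 2 (volume.restrict (Ioo (-R) R))) :
    ENNReal.ofReal (normSq R F) = ∫⁻ x in Ioo (-R) R, ‖F x‖ₑ ^ 2 := by
  rw [normSq, ofReal_integral_eq_lintegral_ofReal
    ((memLp_two_iff_integrable_sq_norm hF.1).1 hF) (.of_forall fun x => sq_nonneg _)]
  simp only [ENNReal.ofReal_pow (norm_nonneg _), ofReal_norm]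

theorem normSq_le_of_enorm_le_lintegral_wave {F : ℝ → ℂ} {c D : ℝ} (hc : 0 ≤ c)
    (hD : 0 ≤ D) (hF : MemLp F 2 (volume.restrict (Ioo (-R) R)))
    (hf : MemLp f 2 (volume.restrict (Ioo (-r) r)))
    (hle : ∀ x, ‖F x‖ₑ
      ≤ ENNReal.ofReal c * ∫⁻ t in Ioo (-r) r, ‖wave κ |x - t|‖ₑ * ‖f t‖ₑ)
    (hr : ∀ x, ∫⁻ t in Ioo (-r) r, ‖wave κ |x - t|‖ₑ ≤ ENNReal.ofReal D)
    (hR : ∀ x, ∫⁻ t in Ioo (-R) R, ‖wave κ |x - t|‖ₑ ≤ ENNReal.ofReal D) :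
    normSq R F ≤ (c * D) ^ 2 * normSq r f := by
  have hK : Measurable (Function.uncurry fun x t : ℝ => ‖wave κ |x - t|‖ₑ) :=
    Continuous.measurable (by unfold Function.uncurry; fun_prop)
  have hnn : 0 ≤ (c * D) ^ 2 * normSq r f := mul_nonneg (sq_nonneg _) (normSq_nonneg r f)
  rw [← ENNReal.ofReal_le_ofReal_iff hnn, ENNReal.ofReal_mul (sq_nonneg _), ofReal_normSq hF,
    ofReal_normSq hf]
  calc ∫⁻ x in Ioo (-R) R, ‖F x‖ₑ ^ 2
      ≤ ∫⁻ x in Ioo (-R) R,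
          ENNReal.ofReal c ^ 2 * (∫⁻ t in Ioo (-r) r, ‖wave κ |x - t|‖ₑ * ‖f t‖ₑ) ^ 2 := by
        gcongr with x
        rw [← mul_pow]
        exact pow_le_pow_left₀ zero_le (hle x) 2
    _ ≤ ENNReal.ofReal c ^ 2 *
          (ENNReal.ofReal D * ENNReal.ofReal D * ∫⁻ t in Ioo (-r) r, ‖f t‖ₑ ^ 2) := by
        rw [lintegral_const_mul' _ _ (ENNReal.pow_ne_top ENNReal.ofReal_ne_top)]
        gcongr
        refine lintegral_lintegral_mul_sq_le hK hf.1.enorm hr fun t => ?_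
        simpa only [abs_sub_comm] using hR t
    _ = _ := by
        rw [ENNReal.ofReal_pow (mul_nonneg hc hD), ENNReal.ofReal_mul hc]
        ring

theorem lintegral_enorm_wave_abs_le_two_mul (hκ : 0 ≤ κ.im) (a x : ℝ) :
    ∫⁻ t in Ioo (-a) a, ‖wave κ |x - t|‖ₑ ≤ ENNReal.ofReal (2 * a) := by
  calc ∫⁻ t in Ioo (-a) a, ‖wave κ |x - t|‖ₑ ≤ ∫⁻ _ in Ioo (-a) a, 1 := by
        gcongr with t
        rw [← ofReal_norm, norm_wave]
        exact ENNReal.ofReal_le_one.2 (Real.exp_le_one_iff.2 (by simpa using by positivity))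
    _ = ENNReal.ofReal (2 * a) := by
        rw [setLIntegral_one, Real.volume_Ioo]
        ring_nf

theorem lintegral_enorm_wave_abs_le_two_div (hκ : 0 < κ.im) (x : ℝ) :
    ∫⁻ t, ‖wave κ |x - t|‖ₑ ≤ ENNReal.ofReal (2 / κ.im) := by
  have hexp : ∫ y : ℝ, Real.exp (-κ.im * |y|) = 2 / κ.im := by
    rw [integral_comp_abs (f := fun y => Real.exp (-κ.im * y)),
      integral_exp_mul_Ioi (neg_lt_zero.2 hκ)]
    simp [div_eq_mul_inv]
  have hint : Integrable fun y : ℝ => Real.exp (-κ.im * |y|) :=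
    .of_integral_ne_zero (hexp ▸ (div_pos two_pos hκ).ne')
  rw [lintegral_sub_left_eq_self (fun y : ℝ => ‖wave κ |y|‖ₑ), ← hexp,
    ofReal_integral_eq_lintegral_ofReal hint (.of_forall fun y => (Real.exp_pos _).le)]
  simp only [← ofReal_norm, norm_wave, neg_mul, le_refl]

variable {D : ℝ}

theorem normSq_outgoing_zero_le (hκ : κ ≠ 0) (hf : IsSource r f) (hD : 0 ≤ D)
    (hr : ∀ x, ∫⁻ t in Ioo (-r) r, ‖wave κ |x - t|‖ₑ ≤ ENNReal.ofReal D)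
    (hR : ∀ x, ∫⁻ t in Ioo (-R) R, ‖wave κ |x - t|‖ₑ ≤ ENNReal.ofReal D) :
    normSq R (outgoing κ f 0) ≤ ((2 * ‖κ‖)⁻¹ * D) ^ 2 * normSq r f :=
  normSq_le_of_enorm_le_lintegral_wave (by positivity) hD ((isProfile_outgoing hκ hf).memLp R 0)
    (hf.memLp.restrict _) (enorm_outgoing_zero_le hf) hr hR

theorem normSq_outgoing_one_le (hκ : κ ≠ 0) (hf : IsSource r f) (hD : 0 ≤ D)
    (hr : ∀ x, ∫⁻ t in Ioo (-r) r, ‖wave κ |x - t|‖ₑ ≤ ENNReal.ofReal D)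
    (hR : ∀ x, ∫⁻ t in Ioo (-R) R, ‖wave κ |x - t|‖ₑ ≤ ENNReal.ofReal D) :
    normSq R (outgoing κ f 1) ≤ (2⁻¹ * D) ^ 2 * normSq r f :=
  normSq_le_of_enorm_le_lintegral_wave (by positivity) hD ((isProfile_outgoing hκ hf).memLp R 1)
    (hf.memLp.restrict _) (enorm_outgoing_one_le hf) hr hR

theorem normSq_sub_le {F G : ℝ → ℂ} (hF : MemLp F 2 (volume.restrict (Ioo (-R) R)))
    (hG : MemLp G 2 (volume.restrict (Ioo (-R) R))) :
    normSq R (fun x => F x - G x) ≤ 2 * normSq R F + 2 * normSq R G := by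
  have hF2 := ((memLp_two_iff_integrable_sq_norm hF.1).1 hF).const_mul 2
  have hG2 := ((memLp_two_iff_integrable_sq_norm hG.1).1 hG).const_mul 2
  simp only [normSq]
  rw [← integral_const_mul, ← integral_const_mul, ← integral_add hF2 hG2]
  refine integral_mono_of_nonneg (.of_forall fun x => sq_nonneg _) (hF2.add hG2)
    (.of_forall fun x => ?_)
  have hparallelogram := parallelogram_law_with_norm ℂ (F x) (G x)
  dsimp only [Pi.add_apply]
  nlinarith [sq_nonneg ‖F x + G x‖]

theorem IsSource.normSq_le (hf : IsSource r f) (R : ℝ) : normSq R f ≤ normSq r f := by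
  have htotal : normSq r f = ∫ x, ‖f x‖ ^ 2 :=
    setIntegral_eq_integral_of_forall_compl_eq_zero fun t ht => by simp [hf.eq_zero t ht]
  rw [htotal]
  exact setIntegral_le_integral ((memLp_two_iff_integrable_sq_norm hf.memLp.1).1 hf.memLp)
    (.of_forall fun t => sq_nonneg _)

theorem normSq_outgoing_two_le (hκ : κ ≠ 0) (hf : IsSource r f) :
    normSq R (outgoing κ f 2)
      ≤ 2 * (‖κ‖ ^ 4 * normSq R (outgoing κ f 0)) + 2 * normSq r f := by
  have hw := (isProfile_outgoing hκ hf).memLp R 0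
  have hscale : normSq R (fun x => -κ ^ 2 * outgoing κ f 0 x)
      = ‖κ‖ ^ 4 * normSq R (outgoing κ f 0) := by
    simp only [normSq, norm_mul, norm_neg, norm_pow, mul_pow, ← pow_mul, integral_const_mul]
  calc normSq R (outgoing κ f 2)
      ≤ 2 * normSq R (fun x => -κ ^ 2 * outgoing κ f 0 x) + 2 * normSq R f :=
        normSq_sub_le (hw.const_mul _) (hf.memLp.restrict _)
    _ ≤ _ := by
        rw [hscale]
        gcongr
        exact hf.normSq_le R

end OneDimensionalHelmholtz

section WaveNumbers

theorem waveNumber_of_le {k : ℝ} {n : ℕ} (h : freq n ≤ k) :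
    waveNumber k n = (Real.sqrt (k ^ 2 - freq n ^ 2) : ℂ) := if_pos h

theorem waveNumber_of_lt {k : ℝ} {n : ℕ} (h : k < freq n) :
    waveNumber k n = Complex.I * (Real.sqrt (freq n ^ 2 - k ^ 2) : ℂ) := if_neg h.not_ge

theorem waveNumber_sq {k : ℝ} (hk : 0 ≤ k) (n : ℕ) :
    waveNumber k n ^ 2 = (k : ℂ) ^ 2 - (freq n : ℂ) ^ 2 := by
  rcases le_or_gt (freq n) k with h | h
  · have hsq : freq n ^ 2 ≤ k ^ 2 := pow_le_pow_left₀ (freq_nonneg n) h 2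
    rw [waveNumber_of_le h, ← Complex.ofReal_pow, Real.sq_sqrt (sub_nonneg.2 hsq)]
    push_cast
    rfl
  · have hsq : k ^ 2 ≤ freq n ^ 2 := pow_le_pow_left₀ hk h.le 2
    rw [waveNumber_of_lt h, mul_pow, Complex.I_sq, ← Complex.ofReal_pow,
      Real.sq_sqrt (sub_nonneg.2 hsq)]
    push_cast
    ring

theorem waveNumber_im_nonneg (k : ℝ) (n : ℕ) : 0 ≤ (waveNumber k n).im := by
  rcases le_or_gt (freq n) k with h | h
  · rw [waveNumber_of_le h, Complex.ofReal_im]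
  · rw [waveNumber_of_lt h, Complex.I_mul_im, Complex.ofReal_re]
    exact Real.sqrt_nonneg _

theorem norm_waveNumber_sq {k : ℝ} (hk : 0 ≤ k) (n : ℕ) :
    ‖waveNumber k n‖ ^ 2 = |k ^ 2 - freq n ^ 2| := by
  rw [← norm_pow, waveNumber_sq hk, ← Real.norm_eq_abs, ← Complex.norm_real]
  push_cast
  rfl

theorem waveNumber_im_of_lt {k : ℝ} {n : ℕ} (h : k < freq n) :
    (waveNumber k n).im = ‖waveNumber k n‖ := by
  rw [waveNumber_of_lt h, Complex.I_mul_im, Complex.ofReal_re, norm_mul, Complex.norm_I,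
    one_mul, Complex.norm_real, Real.norm_of_nonneg (Real.sqrt_nonneg _)]

theorem norm_waveNumber_le_of_le {k : ℝ} {n : ℕ} (h : freq n ≤ k) : ‖waveNumber k n‖ ≤ k := by
  have hk : 0 ≤ k := (freq_nonneg n).trans h
  rw [waveNumber_of_le h, Complex.norm_real, Real.norm_of_nonneg (Real.sqrt_nonneg _),
    Real.sqrt_le_left hk]
  exact sub_le_self _ (sq_nonneg _)

theorem waveNumber_ne_zero (k : Frequency) (n : ℕ) : waveNumber k n ≠ 0 := by
  intro h
  have hsq := waveNumber_sq k.2.1.le n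
  rw [h, zero_pow two_ne_zero, eq_comm, sub_eq_zero] at hsq
  exact k.2.2 n ((pow_left_inj₀ k.2.1.le (freq_nonneg n) two_ne_zero).1 (by exact_mod_cast hsq))

theorem norm_waveNumber_pos (k : Frequency) (n : ℕ) : 0 < ‖waveNumber k n‖ :=
  norm_pos_iff.2 (waveNumber_ne_zero k n)

theorem lintegral_enorm_wave_waveNumber_le (k : Frequency) (n : ℕ) {a : ℝ} (ha : 0 ≤ a)
    (x : ℝ) :
    ∫⁻ t in Ioo (-a) a, ‖wave (waveNumber k n) |x - t|‖ₑ
      ≤ ENNReal.ofReal ((2 * a * k + 2) / ‖waveNumber k n‖) := by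
  have hκ := norm_waveNumber_pos k n
  have hk := k.2.1
  rcases le_or_gt (freq n) (k : ℝ) with h | h
  · refine (lintegral_enorm_wave_abs_le_two_mul (waveNumber_im_nonneg k n) a x).trans ?_
    gcongr
    rw [le_div_iff₀ hκ]
    have := mul_le_mul_of_nonneg_left (norm_waveNumber_le_of_le h) (by positivity : 0 ≤ 2 * a)
    linarith
  · have him := waveNumber_im_of_lt h
    refine (setLIntegral_le_lintegral _ _).trans
      ((lintegral_enorm_wave_abs_le_two_div (him ▸ hκ) x).trans ?_)
    rw [him]
    gcongr
    linarith [mul_nonneg (mul_nonneg zero_le_two ha) hk.le]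

theorem tendsto_norm_waveNumber_sq (k : Frequency) :
    Tendsto (fun n => ‖waveNumber k n‖ ^ 2) atTop atTop := by
  have hfreq : Tendsto freq atTop atTop :=
    tendsto_natCast_atTop_atTop.atTop_mul_const Real.pi_pos
  refine tendsto_atTop_mono (fun n => ?_) (tendsto_atTop_add_const_right _ (-(k : ℝ) ^ 2)
    ((tendsto_pow_atTop two_ne_zero).comp hfreq))
  rw [norm_waveNumber_sq k.2.1.le]
  simp only [Function.comp_apply]
  linarith [neg_le_abs ((k : ℝ) ^ 2 - freq n ^ 2)]

theorem exists_one_add_freq_sq_le (k : Frequency) :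
    ∃ C : ℝ, 0 < C ∧ ∀ n, 1 + freq n ^ 2 ≤ C * ‖waveNumber k n‖ ^ 2 := by
  obtain ⟨B, hB⟩ := (tendsto_norm_waveNumber_sq k).inv_tendsto_atTop.bddAbove_range
  have hB (n : ℕ) : (‖waveNumber k n‖ ^ 2)⁻¹ ≤ B := hB ⟨n, rfl⟩
  have hB0 : 0 ≤ B := le_trans (by positivity) (hB 0)
  refine ⟨(1 + (k : ℝ) ^ 2) * B + 1, by positivity, fun n => ?_⟩
  have hpos : 0 < ‖waveNumber k n‖ ^ 2 := pow_pos (norm_waveNumber_pos k n) 2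
  have h_one : 1 ≤ B * ‖waveNumber k n‖ ^ 2 := (inv_le_iff_one_le_mul₀ hpos).1 (hB n)
  have hfreq : freq n ^ 2 ≤ k ^ 2 + ‖waveNumber k n‖ ^ 2 := by
    rw [norm_waveNumber_sq k.2.1.le]
    linarith [neg_le_abs ((k : ℝ) ^ 2 - freq n ^ 2)]
  linarith [mul_le_mul_of_nonneg_left h_one (by positivity : 0 ≤ 1 + (k : ℝ) ^ 2)]

theorem summable_inv_one_add_freq_sq : Summable fun n => (1 + freq n ^ 2)⁻¹ := by
  have hs : Summable fun n : ℕ => 2 * (((n : ℝ) + 1) ^ 2)⁻¹ := by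
    simpa using ((summable_nat_add_iff 1).2
      (Real.summable_nat_pow_inv.2 one_lt_two)).mul_left 2
  refine hs.of_nonneg_of_le (fun n => by positivity) fun n => ?_
  have hn : (n : ℝ) ≤ freq n :=
    le_mul_of_one_le_right n.cast_nonneg (by linarith [Real.pi_gt_three])
  rw [← div_eq_mul_inv, inv_eq_one_div, div_le_div_iff₀ (by positivity) (by positivity)]
  nlinarith [sq_nonneg ((n : ℝ) - 1), pow_le_pow_left₀ n.cast_nonneg hn 2]

theorem summable_inv_norm_waveNumber_sq (k : Frequency) :
    Summable fun n => (‖waveNumber k n‖ ^ 2)⁻¹ := by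
  obtain ⟨C, _, h⟩ := exists_one_add_freq_sq_le k
  refine (summable_inv_one_add_freq_sq.mul_left C).of_nonneg_of_le (fun n => by positivity)
    fun n => ?_
  rw [← div_eq_mul_inv, inv_eq_one_div,
    div_le_div_iff₀ (pow_pos (norm_waveNumber_pos k n) 2) (by positivity), one_mul]
  exact h n

end WaveNumbers

section ModalBounds

variable {r R D : ℝ} {f : ℝ → ℂ} {κ : ℂ}

theorem norm_outgoing_zero_le (hκ : 0 ≤ κ.im) (hf : IsSource r f) (x : ℝ) :
    ‖outgoing κ f 0 x‖
      ≤ 4⁻¹ * (volume.real (Ioo (-r) r) * (‖κ‖ ^ 2)⁻¹ + normSq r f) := by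
  have hf2 : Integrable (fun t => ‖f t‖ ^ 2) (volume.restrict (Ioo (-r) r)) :=
    (memLp_two_iff_integrable_sq_norm hf.memLp.1).1 hf.memLp |>.integrableOn
  have hmajorant : Integrable (fun t => 4⁻¹ * ((‖κ‖ ^ 2)⁻¹ + ‖f t‖ ^ 2))
      (volume.restrict (Ioo (-r) r)) := ((integrable_const _).add hf2).const_mul _
  have hle (t : ℝ) : ‖Complex.I / (2 * κ) * (wave κ |x - t| * f t)‖
      ≤ 4⁻¹ * ((‖κ‖ ^ 2)⁻¹ + ‖f t‖ ^ 2) := by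
    have hwave : ‖wave κ |x - t|‖ ≤ 1 := by
      rw [norm_wave, Real.exp_le_one_iff]
      exact neg_nonpos.2 (mul_nonneg hκ (abs_nonneg _))
    calc ‖Complex.I / (2 * κ) * (wave κ |x - t| * f t)‖
        = 2⁻¹ * ‖κ‖⁻¹ * (‖wave κ |x - t|‖ * ‖f t‖) := by
          simp only [norm_mul, norm_div, Complex.norm_I, Complex.norm_ofNat, one_div, mul_inv]
      _ ≤ 2⁻¹ * ‖κ‖⁻¹ * (1 * ‖f t‖) := by gcongr
      _ ≤ 4⁻¹ * ((‖κ‖ ^ 2)⁻¹ + ‖f t‖ ^ 2) := by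
          rw [← inv_pow]
          nlinarith [sq_nonneg (‖κ‖⁻¹ - ‖f t‖)]
  calc ‖outgoing κ f 0 x‖
      = ‖∫ t in Ioo (-r) r, Complex.I / (2 * κ) * (wave κ |x - t| * f t)‖ := by
        rw [integral_const_mul, outgoing_zero_eq_setIntegral hf]
    _ ≤ ∫ t in Ioo (-r) r, 4⁻¹ * ((‖κ‖ ^ 2)⁻¹ + ‖f t‖ ^ 2) :=
        norm_integral_le_of_norm_le hmajorant (ae_of_all _ hle)
    _ = 4⁻¹ * (volume.real (Ioo (-r) r) * (‖κ‖ ^ 2)⁻¹ + normSq r f) := by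
        rw [integral_const_mul, integral_add (integrable_const _) hf2, setIntegral_const,
          smul_eq_mul, normSq]

theorem norm_sepH2_outgoing_sq_le (hκ : κ ≠ 0) (hf : IsSource r f) (hD : 0 ≤ D)
    (hr : ∀ x, ∫⁻ t in Ioo (-r) r, ‖wave κ |x - t|‖ₑ ≤ ENNReal.ofReal D)
    (hR : ∀ x, ∫⁻ t in Ioo (-R) R, ‖wave κ |x - t|‖ₑ ≤ ENNReal.ofReal D) (n : ℕ) :
    ‖sepH2 R (isProfile_outgoing hκ hf) n‖ ^ 2
      ≤ ((1 + freq n ^ 2 + freq n ^ 4 + 2 * ‖κ‖ ^ 4) * ((2 * ‖κ‖)⁻¹ * D) ^ 2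
        + (1 + 2 * freq n ^ 2) * (2⁻¹ * D) ^ 2 + 2) * normSq r f := by
  have h0 := normSq_outgoing_zero_le hκ hf hD hr hR
  have h1 := normSq_outgoing_one_le hκ hf hD hr hR
  calc ‖sepH2 R (isProfile_outgoing hκ hf) n‖ ^ 2
      ≤ (1 + freq n ^ 2 + freq n ^ 4) * normSq R (outgoing κ f 0)
        + (1 + 2 * freq n ^ 2) * normSq R (outgoing κ f 1)
        + (2 * (‖κ‖ ^ 4 * normSq R (outgoing κ f 0)) + 2 * normSq r f) := by
        rw [norm_sepH2_sq]
        gcongr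
        exact normSq_outgoing_two_le hκ hf
    _ ≤ (1 + freq n ^ 2 + freq n ^ 4) * (((2 * ‖κ‖)⁻¹ * D) ^ 2 * normSq r f)
        + (1 + 2 * freq n ^ 2) * ((2⁻¹ * D) ^ 2 * normSq r f)
        + (2 * (‖κ‖ ^ 4 * (((2 * ‖κ‖)⁻¹ * D) ^ 2 * normSq r f)) + 2 * normSq r f) := by
        gcongr
    _ = _ := by ring

theorem modal_factor_le {ν m A C : ℝ} (hm : 0 < m) (h : 1 + ν ^ 2 ≤ C * m ^ 2) :
    (1 + ν ^ 2 + ν ^ 4 + 2 * m ^ 4) * ((2 * m)⁻¹ * (A / m)) ^ 2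
        + (1 + 2 * ν ^ 2) * (2⁻¹ * (A / m)) ^ 2 + 2
      ≤ (C ^ 2 + 2 * C + 2) * A ^ 2 / 4 + 2 := by
  have h_two : 1 + 2 * ν ^ 2 ≤ 2 * (C * m ^ 2) := by linarith
  have h_four : 1 + ν ^ 2 + ν ^ 4 ≤ (C * m ^ 2) ^ 2 := by
    nlinarith [sq_nonneg ν, pow_le_pow_left₀ (by positivity) h 2]
  calc _ ≤ ((C * m ^ 2) ^ 2 + 2 * m ^ 4) * ((2 * m)⁻¹ * (A / m)) ^ 2
        + 2 * (C * m ^ 2) * (2⁻¹ * (A / m)) ^ 2 + 2 := by gcongr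
    _ = (C ^ 2 + 2 * C + 2) * A ^ 2 / 4 + 2 := by field_simp; ring

theorem exists_norm_sepH2_outgoing_sq_le (r R : ℝ) (k : Frequency) :
    ∃ C : ℝ, 0 < C ∧ ∀ (n : ℕ) (f : ℝ → ℂ) (hf : IsSource r f),
      ‖sepH2 R (isProfile_outgoing (waveNumber_ne_zero k n) hf) n‖ ^ 2 ≤ C * normSq r f := by
  obtain ⟨C, hC, hfreq⟩ := exists_one_add_freq_sq_le k
  set a := max |r| |R|
  set A := 2 * a * k + 2
  have ha : 0 ≤ a := (abs_nonneg r).trans (le_max_left _ _)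
  have hA : 0 < A := by have := k.2.1; positivity
  have hkernel (b : ℝ) (hb : |b| ≤ a) (n : ℕ) (x : ℝ) :
      ∫⁻ t in Ioo (-b) b, ‖wave (waveNumber k n) |x - t|‖ₑ
        ≤ ENNReal.ofReal (A / ‖waveNumber k n‖) := by
    have hba : b ≤ a := (le_abs_self b).trans hb
    exact (lintegral_mono_set (Ioo_subset_Ioo (neg_le_neg hba) hba)).trans
      (lintegral_enorm_wave_waveNumber_le k n ha x)
  refine ⟨(C ^ 2 + 2 * C + 2) * A ^ 2 / 4 + 2, by positivity, fun n f hf => ?_⟩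
  refine (norm_sepH2_outgoing_sq_le (waveNumber_ne_zero k n) hf (by positivity)
    (hkernel r (le_max_left _ _) n) (hkernel R (le_max_right _ _) n) n).trans ?_
  exact mul_le_mul_of_nonneg_right (modal_factor_le (norm_waveNumber_pos k n) (hfreq n))
    (normSq_nonneg _ _)

end ModalBounds

section ModalSolution

variable {r : ℝ}

theorem memLp_extendByZero (s : L2 (box r)) : MemLp (extendByZero s) 2 volume :=
  (memLp_indicator_iff_restrict (isOpen_box r).measurableSet).2 (Lp.memLp s)

theorem extendByZero_ae_eq (s : L2 (box r)) :
    extendByZero s =ᵐ[volume.restrict (box r)] s :=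
  indicator_ae_eq_restrict (isOpen_box r).measurableSet

/-- The coefficient of a source along the mode `φₙ`. -/
def sourceCoef (s : L2 (box r)) (n : ℕ) : ℝ → ℂ := coef n (extendByZero s)

theorem isSource_sourceCoef (s : L2 (box r)) (n : ℕ) : IsSource r (sourceCoef s n) := by
  have hzero (t : ℝ) (ht : t ∉ Ioo (-r) r) : sourceCoef s n t = 0 := by
    have (y : ℝ) : extendByZero s (t, y) = 0 := indicator_of_notMem (fun h => ht h.1) _
    simp only [sourceCoef, coef, this, smul_zero, integral_zero]
  refine ⟨?_, hzero⟩
  have hsupp : (Ioo (-r) r).indicator (sourceCoef s n) = sourceCoef s n :=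
    indicator_eq_self.2 fun t ht => not_imp_comm.1 (hzero t) ht
  rw [← hsupp, memLp_indicator_iff_restrict measurableSet_Ioo]
  exact memLp_coef ((memLp_extendByZero s).restrict _) n

theorem normSq_sourceCoef (s : L2 (box r)) (n : ℕ) :
    normSq r (sourceCoef s n) = normSq r (coef n s) :=
  integral_congr_ae <| (coef_congr_ae (extendByZero_ae_eq s) n).mono fun _ ht =>
    congrArg (‖·‖ ^ 2) ht

theorem summable_normSq_sourceCoef (s : L2 (box r)) :
    Summable fun n => normSq r (sourceCoef s n) := by
  simpa only [normSq_sourceCoef] using summable_normSq_coef s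

theorem tsum_normSq_sourceCoef_le (s : L2 (box r)) :
    ∑' n, normSq r (sourceCoef s n) ≤ ‖s‖ ^ 2 := by
  simpa only [normSq_sourceCoef] using tsum_normSq_coef_le s

theorem hasSum_sepLp_sourceCoef (R : ℝ) (s : L2 (box r)) :
    HasSum (fun n => sepLp ((isSource_sourceCoef s n).memLp.restrict (Ioo (-R) R))
      (continuous_mode n)) ((memLp_extendByZero s).restrict (box R)).toLp := by
  set h := ((memLp_extendByZero s).restrict (box R)).toLp
  convert hasSum_modePart h using 2 with n
  refine Lp.ext ((coeFn_sepLp _ _).trans (EventuallyEq.trans ?_ (coeFn_sepLp _ _).symm))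
  have hcoef := coef_congr_ae ((memLp_extendByZero s).restrict (box R)).coeFn_toLp n
  filter_upwards [ae_restrict_box_of_ae hcoef] with p hp
  exact congrArg (mode n p.2 • ·) hp.symm

/-- The coefficient along `φₙ` of the outgoing solution, with its first and second derivatives. -/
def modalProfile (k : Frequency) (s : L2 (box r)) (n : ℕ) : Fin 3 → ℝ → ℂ :=
  outgoing (waveNumber k n) (sourceCoef s n)

theorem isProfile_modalProfile (k : Frequency) (s : L2 (box r)) (n : ℕ) :
    IsProfile (modalProfile k s n) :=
  isProfile_outgoing (waveNumber_ne_zero k n) (isSource_sourceCoef s n)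

/-- The component of the outgoing solution along `φₙ`, in `H²` of a bounded part of the
waveguide. -/
def modalH2 (R : ℝ) (k : Frequency) (s : L2 (box r)) (n : ℕ) : H2 (box R) :=
  sepH2 R (isProfile_modalProfile k s n) n

/-- The outgoing solution in `H²` of a bounded part of the waveguide, as a modal series. -/
def solH2 (R : ℝ) (k : Frequency) (s : L2 (box r)) : H2 (box R) :=
  ∑' n, modalH2 R k s n

theorem pairwise_inner_modalH2 (R : ℝ) (k : Frequency) (s : L2 (box r)) :
    Pairwise fun n m => inner ℂ (modalH2 R k s n) (modalH2 R k s m) = 0 :=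
  fun _ _ hnm => inner_sepH2_of_ne R _ _ hnm

theorem hasSum_modalH2 (R : ℝ) (k : Frequency) (s : L2 (box r)) :
    HasSum (modalH2 R k s) (solH2 R k s) := by
  obtain ⟨C, -, h⟩ := exists_norm_sepH2_outgoing_sq_le r R k
  exact (summable_of_pairwise_inner_eq_zero (pairwise_inner_modalH2 R k s)
    ((summable_normSq_sourceCoef s).mul_left C)
    fun n => h n _ (isSource_sourceCoef s n)).hasSum

theorem exists_norm_solH2_le (r R : ℝ) (k : Frequency) :
    ∃ C : ℝ, 0 < C ∧ ∀ s : L2 (box r), ‖solH2 R k s‖ ≤ C * ‖s‖ := by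
  obtain ⟨C, hC, h⟩ := exists_norm_sepH2_outgoing_sq_le r R k
  refine ⟨Real.sqrt C, Real.sqrt_pos.2 hC, fun s => le_of_sq_le_sq ?_ (by positivity)⟩
  calc ‖solH2 R k s‖ ^ 2 ≤ ∑' n, C * normSq r (sourceCoef s n) :=
        norm_tsum_sq_le_of_pairwise_inner_eq_zero (pairwise_inner_modalH2 R k s)
          (hasSum_modalH2 R k s).summable ((summable_normSq_sourceCoef s).mul_left C)
          fun n => h n _ (isSource_sourceCoef s n)
    _ ≤ C * ‖s‖ ^ 2 := by
        rw [tsum_mul_left]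
        exact mul_le_mul_of_nonneg_left (tsum_normSq_sourceCoef_le s) hC.le
    _ = (Real.sqrt C * ‖s‖) ^ 2 := by rw [mul_pow, Real.sq_sqrt hC.le]

/-- The outgoing solution as a function on the whole waveguide, as a modal series. -/
def solFun (k : Frequency) (s : L2 (box r)) (p : ℝ × ℝ) : ℂ :=
  ∑' n, sep (modalProfile k s n 0) (mode n) p

theorem exists_norm_sep_modalProfile_le (k : Frequency) (s : L2 (box r)) :
    ∃ c : ℕ → ℝ, Summable c ∧ ∀ n p, ‖sep (modalProfile k s n 0) (mode n) p‖ ≤ c n := by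
  refine ⟨fun n => 2 * (4⁻¹ * (volume.real (Ioo (-r) r) * (‖waveNumber k n‖ ^ 2)⁻¹
    + normSq r (sourceCoef s n))), ?_, fun n p => ?_⟩
  · exact ((((summable_inv_norm_waveNumber_sq k).mul_left _).add
      (summable_normSq_sourceCoef s)).mul_left _).mul_left _
  · rw [sep, norm_smul]
    exact mul_le_mul (abs_mode_le n p.2) (norm_outgoing_zero_le (waveNumber_im_nonneg k n)
      (isSource_sourceCoef s n) p.1) (norm_nonneg _) zero_le_two

theorem hasSum_solFun (k : Frequency) (s : L2 (box r)) (p : ℝ × ℝ) :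
    HasSum (fun n => sep (modalProfile k s n 0) (mode n) p) (solFun k s p) := by
  obtain ⟨c, hc, hle⟩ := exists_norm_sep_modalProfile_le k s
  exact (hc.of_norm_bounded fun n => hle n p).hasSum

theorem coef_solFun (k : Frequency) (s : L2 (box r)) (n : ℕ) (x : ℝ) :
    coef n (solFun k s) x = modalProfile k s n 0 x := by
  obtain ⟨c, hc, hle⟩ := exists_norm_sep_modalProfile_le k s
  have hmeas (m : ℕ) : AEStronglyMeasurable
      (fun y => mode n y • sep (modalProfile k s m 0) (mode m) (x, y))
      (volume.restrict (Ioo (0 : ℝ) 1)) :=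
    ((continuous_mode n).smul ((continuous_mode m).smul
      (continuous_const (y := modalProfile k s m 0 x)))).aestronglyMeasurable
  have hbound (m : ℕ) (y : ℝ) :
      ‖mode n y • sep (modalProfile k s m 0) (mode m) (x, y)‖ ≤ 2 * c m := by
    rw [norm_smul]
    exact mul_le_mul (abs_mode_le n y) (hle m _) (norm_nonneg _) zero_le_two
  have hsum : HasSum
      (fun m => ∫ y in Ioo (0 : ℝ) 1, mode n y • sep (modalProfile k s m 0) (mode m) (x, y))
      (∫ y in Ioo (0 : ℝ) 1, mode n y • solFun k s (x, y)) :=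
    hasSum_integral_of_dominated_convergence (fun m _ => 2 * c m) hmeas
      (fun m => ae_of_all _ (hbound m)) (ae_of_all _ fun _ => hc.mul_left 2)
      (integrable_const _) (ae_of_all _ fun y => (hasSum_solFun k s (x, y)).const_smul (mode n y))
  have horth (m : ℕ) :
      ∫ y in Ioo (0 : ℝ) 1, mode n y • sep (modalProfile k s m 0) (mode m) (x, y)
        = if m = n then modalProfile k s n 0 x else 0 := by
    simp only [sep, smul_smul, integral_smul_const, integral_mode_mul_mode]
    rcases eq_or_ne m n with rfl | hne
    · rw [if_pos rfl, if_pos rfl, one_smul]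
    · rw [if_neg hne.symm, if_neg hne, zero_smul]
  simp only [horth] at hsum
  exact hsum.unique (hasSum_ite_eq n _)

theorem ae_eq_of_hasSum_Lp {α E : Type*} [MeasurableSpace α] {μ : Measure α} [IsFiniteMeasure μ]
    [NormedAddCommGroup E] {p : ENNReal} [Fact (1 ≤ p)] {h : ℕ → Lp E p μ} {H : Lp E p μ}
    {g : ℕ → α → E} {G : α → E} (hH : HasSum h H) (hg : ∀ n, h n =ᵐ[μ] g n)
    (hG : ∀ x, HasSum (g · x) (G x)) : H =ᵐ[μ] G := by
  have hpartial (N : ℕ) : (∑ n ∈ Finset.range N, h n : Lp E p μ) =ᵐ[μ]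
      fun x => ∑ n ∈ Finset.range N, g n x := by
    refine (Lp.coeFn_finsetSum _ _).trans ?_
    filter_upwards [ae_all_iff.2 hg] with x hx
    simp only [hx, Finset.sum_apply]
  refine tendstoInMeasure_ae_unique (tendstoInMeasure_of_tendsto_Lp hH.tendsto_sum_nat)
    (tendstoInMeasure_of_tendsto_ae (fun N => Lp.aestronglyMeasurable _) ?_)
  filter_upwards [ae_all_iff.2 hpartial] with x hx
  simp only [hx]
  exact (hG x).tendsto_sum_nat

instance (R : ℝ) : IsFiniteMeasure ((volume : Measure (ℝ × ℝ)).restrict (box R)) := by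
  rw [volume_restrict_box]
  infer_instance

theorem isRestriction_solH2 (R : ℝ) (k : Frequency) (s : L2 (box r)) :
    IsRestriction (solH2 R k s) (solFun k s) := by
  rw [IsRestriction, val_eq_jetCLM]
  exact ae_eq_of_hasSum_Lp ((jetCLM (box R) (.inl ())).hasSum (hasSum_modalH2 R k s))
    (fun n => coeFn_sepLp ((isProfile_modalProfile k s n).memLp R 0) (continuous_mode n))
    (hasSum_solFun k s)

end ModalSolution

section Existence

variable {r R : ℝ} {φ : ℝ × ℝ → ℝ}

theorem IsRestriction.unique {v v' : H2 (box R)} {u u' : ℝ × ℝ → ℂ} (h : IsRestriction v u)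
    (h' : IsRestriction v' u') (hu : u =ᵐ[volume.restrict (box R)] u') : v = v' :=
  H2.ext_val (isOpen_box R) (Lp.ext (h.trans (hu.trans h'.symm)))

theorem helmholtz_modalH2 (R : ℝ) (k : Frequency) (s : L2 (box r)) (n : ℕ) :
    hess (modalH2 R k s n) 0 0 + hess (modalH2 R k s n) 1 1
      + ((k : ℝ) : ℂ) ^ 2 • val (modalH2 R k s n)
      = -sepLp ((isSource_sourceCoef s n).memLp.restrict (Ioo (-R) R)) (continuous_mode n) := by
  have hw := (isProfile_modalProfile k s n).memLp R
  have hg := continuous_modeJet n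
  have hf := (isSource_sourceCoef s n).memLp.restrict (Ioo (-R) R)
  change sepLp (hw 2) (hg 0) + sepLp (hw 0) (hg 2) + _ • sepLp (hw 0) (hg 0) = _
  apply Lp.ext
  filter_upwards [Lp.coeFn_add (sepLp (hw 2) (hg 0) + sepLp (hw 0) (hg 2))
      (((k : ℝ) : ℂ) ^ 2 • sepLp (hw 0) (hg 0)),
    Lp.coeFn_add (sepLp (hw 2) (hg 0)) (sepLp (hw 0) (hg 2)),
    Lp.coeFn_smul (((k : ℝ) : ℂ) ^ 2) (sepLp (hw 0) (hg 0)),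
    Lp.coeFn_neg (sepLp hf (continuous_mode n)), coeFn_sepLp (hw 2) (hg 0),
    coeFn_sepLp (hw 0) (hg 2), coeFn_sepLp (hw 0) (hg 0),
    coeFn_sepLp hf (continuous_mode n)] with p h1 h2 h3 h4 h20 h02 h00 hs
  have hmode : modeJet n 2 p.2 = -freq n ^ 2 * modeJet n 0 p.2 := rfl
  have hmode' : modeJet n 0 p.2 = mode n p.2 := rfl
  rw [h1, h4, Pi.add_apply, h2, h3, Pi.add_apply, Pi.smul_apply, Pi.neg_apply, h20, h02, h00, hs]
  simp only [sep, hmode, hmode', modalProfile, outgoing_two, waveNumber_sq k.2.1.le,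
    Complex.real_smul, smul_eq_mul]
  push_cast
  ring

theorem solvesHelmholtz_solFun (k : Frequency) (s : L2 (box r)) :
    SolvesHelmholtz k (extendByZero s) (solFun k s) := by
  intro R _ v hv
  obtain rfl := IsRestriction.unique hv (isRestriction_solH2 R k s) EventuallyEq.rfl
  set v := solH2 R k s
  have hmodes := hasSum_modalH2 R k s
  have hsum : HasSum (fun n => hess (modalH2 R k s n) 0 0 + hess (modalH2 R k s n) 1 1
      + ((k : ℝ) : ℂ) ^ 2 • val (modalH2 R k s n))
      (hess v 0 0 + hess v 1 1 + ((k : ℝ) : ℂ) ^ 2 • val v) :=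
    (((jetCLM _ _).hasSum hmodes).add ((jetCLM _ _).hasSum hmodes)).add
      (((jetCLM _ _).hasSum hmodes).const_smul _)
  simp only [helmholtz_modalH2] at hsum
  have heq := hsum.unique (hasSum_sepLp_sourceCoef R s).neg
  filter_upwards [Lp.coeFn_add (hess v 0 0 + hess v 1 1) (((k : ℝ) : ℂ) ^ 2 • val v),
    Lp.coeFn_add (hess v 0 0) (hess v 1 1), Lp.coeFn_smul (((k : ℝ) : ℂ) ^ 2) (val v), hv,
    Lp.coeFn_neg ((memLp_extendByZero s).restrict (box R)).toLp,
    ((memLp_extendByZero s).restrict (box R)).coeFn_toLp] with p h_lhs h_hess h_smul hu h_neg hs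
  rw [heq, h_neg, Pi.neg_apply, hs, Pi.add_apply, h_hess, h_smul, Pi.add_apply, Pi.smul_apply,
    hu, smul_eq_mul] at h_lhs
  exact h_lhs.symm

/-- The boundary term `∫ (Δv) φ + ∇v · ∇φ` of Green's formula, as a functional of `v`. -/
def greenCLM (hφ : IsTest (Ioo (-R) R ×ˢ univ) φ) : H2 (box R) →L[ℂ] ℂ :=
  (testCLM (hφ.memLp _)).comp (jetCLM (box R) (.inr (.inr (0, 0))))
    + (testCLM (hφ.memLp _)).comp (jetCLM (box R) (.inr (.inr (1, 1))))
    + ((testCLM (hφ.memLp_partialDeriv 0 _)).comp (jetCLM (box R) (.inr (.inl 0)))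
      + (testCLM (hφ.memLp_partialDeriv 1 _)).comp (jetCLM (box R) (.inr (.inl 1))))

theorem greenCLM_apply (hφ : IsTest (Ioo (-R) R ×ˢ univ) φ) (v : H2 (box R)) :
    greenCLM hφ v = (∫ p in box R, φ p • hess v 0 0 p) + (∫ p in box R, φ p • hess v 1 1 p)
      + ((∫ p in box R, partialDeriv 0 φ p • grad v 0 p)
        + ∫ p in box R, partialDeriv 1 φ p • grad v 1 p) := by
  simp only [greenCLM, _root_.add_apply, ContinuousLinearMap.comp_apply, testCLM_apply,
    hess_eq_jetCLM, grad_eq_jetCLM]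

theorem integral_green_eq_greenCLM (hφ : IsTest (Ioo (-R) R ×ˢ univ) φ) (v : H2 (box R)) :
    ∫ p in box R, (φ p • (hess v 0 0 p + hess v 1 1 p) +
        (partialDeriv 0 φ p • grad v 0 p + partialDeriv 1 φ p • grad v 1 p))
      = greenCLM hφ v := by
  have hhess (i j : Fin 2) := integrable_test_smul (hφ.memLp _) (hess v i j)
  have hgrad (i : Fin 2) := integrable_test_smul (hφ.memLp_partialDeriv i _) (grad v i)
  simp only [smul_add]
  rw [greenCLM_apply]
  exact (integral_add ((hhess 0 0).add (hhess 1 1)) ((hgrad 0).add (hgrad 1))).trans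
    (congrArg₂ (· + ·) (integral_add (hhess 0 0) (hhess 1 1))
      (integral_add (hgrad 0) (hgrad 1)))

theorem greenCLM_sepH2 {w : Fin 3 → ℝ → ℂ} (h : IsProfile w) (n : ℕ)
    (hφ : IsTest (Ioo (-R) R ×ˢ univ) φ) : greenCLM hφ (sepH2 R h n) = 0 := by
  have hsep (ψ : ℝ × ℝ → ℝ) (a b : Fin 3) :
      ∫ p in box R, ψ p • sepLp (h.memLp R a) (continuous_modeJet n b) p
        = ∫ p in box R, ψ p • sep (w a) (modeJet n b) p :=
    integral_congr_ae ((coeFn_sepLp _ _).mono fun p hp => congrArg (ψ p • ·) hp)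
  rw [greenCLM_apply]
  change (∫ p in box R, φ p • sepLp (h.memLp R 2) (continuous_modeJet n 0) p)
    + (∫ p in box R, φ p • sepLp (h.memLp R 0) (continuous_modeJet n 2) p)
    + ((∫ p in box R, partialDeriv 0 φ p • sepLp (h.memLp R 1) (continuous_modeJet n 0) p)
      + ∫ p in box R, partialDeriv 1 φ p • sepLp (h.memLp R 0) (continuous_modeJet n 1) p) = 0
  simp only [hsep]
  rw [integral_partialDeriv_zero_smul_sep hφ h.isPrimitive_one (continuous_modeJet n 0),
    integral_partialDeriv_one_smul_sep hφ h.isPrimitive_zero.continuous.locallyIntegrable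
      (show IsPrimitive (modeJet n 1) (modeJet n 2) from isPrimitive_modeDeriv n)
      (continuous_modeJet n 2) (fun x => mul_eq_zero_of_right _ (modeDeriv_zero_right n))
      (fun x => mul_eq_zero_of_right _ (modeDeriv_one_right n))]
  ring

theorem neumannCondition_solFun (k : Frequency) (s : L2 (box r)) :
    NeumannCondition (solFun k s) := by
  intro R _ v hv φ hφ
  obtain rfl := IsRestriction.unique hv (isRestriction_solH2 R k s) EventuallyEq.rfl
  have hsum := (greenCLM hφ).hasSum (hasSum_modalH2 R k s)
  simp only [modalH2, greenCLM_sepH2] at hsum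
  rw [integral_green_eq_greenCLM hφ]
  exact hsum.unique hasSum_zero

theorem tendsto_radiation {w w' : ℝ → ℂ} {κ : ℂ}
    (h_right : ∀ x, r ≤ x → w' x = Complex.I * κ * w x)
    (h_left : ∀ x, x ≤ -r → w' x = -(Complex.I * κ * w x)) :
    Tendsto (fun x : ℝ => ‖w' x * ((x / |x| : ℝ) : ℂ) - Complex.I * κ * w x‖)
      (cocompact ℝ) (𝓝 0) := by
  refine tendsto_const_nhds.congr' ?_
  rw [cocompact_eq_atBot_atTop]
  refine eventually_sup.2 ⟨?_, ?_⟩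
  · filter_upwards [eventually_le_atBot (-r), eventually_lt_atBot 0] with x hx hx0
    rw [abs_of_neg hx0, div_neg, div_self hx0.ne, h_left x hx]
    simp
  · filter_upwards [eventually_ge_atTop r, eventually_gt_atTop 0] with x hx hx0
    rw [abs_of_pos hx0, div_self hx0.ne', h_right x hx]
    simp

theorem isOutgoing_solFun (k : Frequency) (s : L2 (box r)) : IsOutgoing k (solFun k s) := by
  intro n
  have hw := isProfile_modalProfile k s n
  have hκ := waveNumber_ne_zero k n
  have hf := isSource_sourceCoef s n
  have hw' : deriv (modalProfile k s n 0) = modalProfile k s n 1 :=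
    funext fun x => (hw.isPrimitive_zero.hasDerivAt hw.isPrimitive_one.continuous x).deriv
  refine ⟨modalProfile k s n 0, hw.isPrimitive_zero.contDiff_one hw.isPrimitive_one.continuous,
    ae_of_all _ fun x => (coef_solFun k s n x).symm, ?_⟩
  rw [hw']
  exact tendsto_radiation (fun x hx => outgoing_one_of_le hκ hf hx)
    fun x hx => outgoing_one_of_le_neg hκ hf hx

theorem isSolution_solFun (k : Frequency) (s : L2 (box r)) :
    IsSolution k (extendByZero s) (solFun k s) where
  memH2loc R _ := ⟨solH2 R k s, isRestriction_solH2 R k s⟩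
  helmholtz := solvesHelmholtz_solFun k s
  neumann := neumannCondition_solFun k s
  outgoing := isOutgoing_solFun k s

end Existence

section Cutoff

/-- A smooth function vanishing on `(-∞, 1]` and equal to `1` on `[2, ∞)`. -/
def ramp (t : ℝ) : ℝ := Real.smoothTransition (t - 1)

theorem contDiff_ramp {m : WithTop ℕ∞} (hm : m ≤ ((⊤ : ℕ∞) : WithTop ℕ∞)) : ContDiff ℝ m ramp :=
  (Real.smoothTransition.contDiff.comp (contDiff_id.sub contDiff_const)).of_le hm

theorem ramp_of_le {t : ℝ} (h : t ≤ 1) : ramp t = 0 :=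
  Real.smoothTransition.zero_of_nonpos (sub_nonpos.2 h)

theorem ramp_of_ge {t : ℝ} (h : 2 ≤ t) : ramp t = 1 :=
  Real.smoothTransition.one_of_one_le (by linarith)

theorem abs_ramp_le (t : ℝ) : |ramp t| ≤ 1 := by
  rw [ramp, abs_of_nonneg (Real.smoothTransition.nonneg _)]
  exact Real.smoothTransition.le_one _

theorem deriv_ramp_eq_zero {t : ℝ} (h : t ∉ Icc (1 : ℝ) 2) : deriv ramp t = 0 := by
  rcases lt_or_ge t 1 with h1 | h1
  · have hev : ramp =ᶠ[𝓝 t] fun _ => 0 := (gt_mem_nhds h1).mono fun _ hx => ramp_of_le hx.le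
    rw [hev.deriv_eq, deriv_const]
  · have h2 : 2 < t := not_le.1 fun h2 => h ⟨h1, h2⟩
    have hev : ramp =ᶠ[𝓝 t] fun _ => 1 := (lt_mem_nhds h2).mono fun _ hx => ramp_of_ge hx.le
    rw [hev.deriv_eq, deriv_const]

theorem exists_abs_mul_deriv_ramp_le : ∃ T : ℝ, ∀ t, |t * deriv ramp t| ≤ T :=
  (continuous_id.mul ((contDiff_ramp le_rfl).continuous_deriv
    (by simp))).bounded_above_of_compact_support
      (.intro isCompact_Icc fun _ ht => mul_eq_zero_of_right _ (deriv_ramp_eq_zero ht))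

/-- Smooth cutoff functions exhausting `(0, 1)`. -/
def cutoff (m : ℕ) (y : ℝ) : ℝ := ramp (m * (y * (1 - y)))

theorem contDiff_cutoff (m : ℕ) : ContDiff ℝ ((⊤ : ℕ∞) : WithTop ℕ∞) (cutoff m) :=
  (contDiff_ramp le_rfl).comp
    (contDiff_const.mul (contDiff_id.mul (contDiff_const.sub contDiff_id)))

theorem abs_cutoff_le (m : ℕ) (y : ℝ) : |cutoff m y| ≤ 1 := abs_ramp_le _

theorem tsupport_cutoff_comp_snd_subset (m : ℕ) :
    tsupport (fun p : ℝ × ℝ => cutoff m p.2) ⊆ univ ×ˢ Ioo 0 1 := by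
  have hclosed : IsClosed {p : ℝ × ℝ | 1 ≤ m * (p.2 * (1 - p.2))} :=
    isClosed_le continuous_const (by fun_prop)
  have hsupp : Function.support (fun p : ℝ × ℝ => cutoff m p.2)
      ⊆ {p : ℝ × ℝ | 1 ≤ m * (p.2 * (1 - p.2))} :=
    fun p hp => le_of_not_ge fun h => hp (ramp_of_le h)
  refine (closure_minimal hsupp hclosed).trans fun p hp => ⟨mem_univ _, ?_⟩
  have hpos : 0 < p.2 * (1 - p.2) := pos_of_mul_pos_right (one_pos.trans_le hp) m.cast_nonneg
  constructor <;> nlinarith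

theorem eventually_cutoff_eq_one {y : ℝ} (hy : y ∈ Ioo (0 : ℝ) 1) :
    ∀ᶠ m in atTop, cutoff m =ᶠ[𝓝 y] 1 := by
  have hpos : 0 < y * (1 - y) := mul_pos hy.1 (sub_pos.2 hy.2)
  filter_upwards [(tendsto_natCast_atTop_atTop.atTop_mul_const hpos).eventually_gt_atTop (2 : ℝ)]
    with m hm
  have hcont : Continuous fun z : ℝ => (m : ℝ) * (z * (1 - z)) := by fun_prop
  exact (hcont.continuousAt.eventually (lt_mem_nhds hm)).mono fun z hz => ramp_of_ge hz.le

theorem exists_abs_deriv_cutoff_mul_le :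
    ∃ T : ℝ, ∀ m, ∀ y ∈ Ioo (0 : ℝ) 1, |deriv (cutoff m) y| * (y * (1 - y)) ≤ T := by
  obtain ⟨T, hT⟩ := exists_abs_mul_deriv_ramp_le
  refine ⟨T, fun m y hy => ?_⟩
  have hpos : 0 < y * (1 - y) := mul_pos hy.1 (sub_pos.2 hy.2)
  have hderiv : HasDerivAt (cutoff m) (deriv ramp (m * (y * (1 - y))) * (m * (1 - 2 * y))) y := by
    refine HasDerivAt.comp y (((contDiff_ramp le_rfl).differentiable (by simp) _).hasDerivAt) ?_
    convert!
      ((hasDerivAt_id' y).mul ((hasDerivAt_id' y).const_sub 1)).const_mul (m : ℝ) using 1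
    ring
  calc |deriv (cutoff m) y| * (y * (1 - y))
      = |m * (y * (1 - y)) * deriv ramp (m * (y * (1 - y)))| * |1 - 2 * y| := by
        rw [hderiv.deriv]
        nth_rewrite 2 [← abs_of_pos hpos]
        rw [← abs_mul, ← abs_mul]
        congr 1
        ring
    _ ≤ T * 1 := mul_le_mul (hT _) (abs_le.2 ⟨by linarith [hy.2], by linarith [hy.1]⟩)
        (abs_nonneg _) ((abs_nonneg _).trans (hT 0))
    _ = T := mul_one T

end Cutoff

section PartialDeriv

variable {f g : ℝ × ℝ → ℝ} {η : ℝ → ℝ} {p : ℝ × ℝ}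

theorem partialDeriv_mul (i : Fin 2) (hf : DifferentiableAt ℝ f p) (hg : DifferentiableAt ℝ g p) :
    partialDeriv i (fun q => f q * g q) p
      = f p * partialDeriv i g p + partialDeriv i f p * g p := by
  simp only [partialDeriv, fderiv_fun_mul hf hg, _root_.add_apply, smul_apply, smul_eq_mul,
    mul_comm]

theorem partialDeriv_comp_fst (i : Fin 2) (hη : DifferentiableAt ℝ η p.1) :
    partialDeriv i (fun q => η q.1) p = (basisVec i).1 * deriv η p.1 := by
  have hcomp : HasFDerivAt (fun q : ℝ × ℝ => η q.1) _ p :=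
    hη.hasDerivAt.comp_hasFDerivAt (𝕜 := ℝ) p hasFDerivAt_fst
  rw [partialDeriv, hcomp.fderiv]
  exact mul_comm _ _

theorem partialDeriv_comp_snd (i : Fin 2) (hη : DifferentiableAt ℝ η p.2) :
    partialDeriv i (fun q => η q.2) p = (basisVec i).2 * deriv η p.2 := by
  have hcomp : HasFDerivAt (fun q : ℝ × ℝ => η q.2) _ p :=
    hη.hasDerivAt.comp_hasFDerivAt (𝕜 := ℝ) p hasFDerivAt_snd
  rw [partialDeriv, hcomp.fderiv]
  exact mul_comm _ _

theorem partialDeriv_congr (i : Fin 2) (h : f =ᶠ[𝓝 p] g) :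
    partialDeriv i f p = partialDeriv i g p := by
  rw [partialDeriv, h.fderiv_eq, partialDeriv]

end PartialDeriv

section BoundaryTests

variable {V : Set (ℝ × ℝ)} {R : ℝ} {φ : ℝ × ℝ → ℝ}

theorem IsTest.exists_abs_partialDeriv_le (hφ : IsTest V φ) (i : Fin 2) :
    ∃ C, ∀ p, |partialDeriv i φ p| ≤ C :=
  (hφ.continuous_partialDeriv i).bounded_above_of_compact_support
    (hφ.compact.fderiv_apply ℝ (basisVec i))

theorem IsTest.exists_abs_le_mul_of_eq_zero (hφ : IsTest V φ) (h0 : ∀ x, φ (x, 0) = 0)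
    (h1 : ∀ x, φ (x, 1) = 0) :
    ∃ L, 0 ≤ L ∧ ∀ x, ∀ y ∈ Ioo (0 : ℝ) 1, |φ (x, y)| ≤ L * (y * (1 - y)) := by
  obtain ⟨L, hL⟩ := hφ.exists_abs_partialDeriv_le 1
  have hL0 : 0 ≤ L := (abs_nonneg _).trans (hL 0)
  have hlip (x a b : ℝ) : |φ (x, b) - φ (x, a)| ≤ L * |b - a| := by
    rw [← (hφ.isPrimitive_slice_snd x).integral_eq a b]
    exact intervalIntegral.norm_integral_le_of_norm_le_const (f := fun y => partialDeriv 1 φ (x, y))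
      fun y _ => hL (x, y)
  refine ⟨2 * L, by positivity, fun x y hy => ?_⟩
  have hy0 := hlip x 0 y
  have hy1 := hlip x 1 y
  rw [h0, sub_zero, sub_zero, abs_of_pos hy.1] at hy0
  rw [h1, sub_zero, abs_sub_comm, abs_of_pos (sub_pos.2 hy.2)] at hy1
  have hyy := mul_nonneg hL0 (mul_pos hy.1 (sub_pos.2 hy.2)).le
  rcases le_total y (1 / 2) with h | h
  · nlinarith [mul_nonneg hL0 hy.1.le]
  · nlinarith [mul_nonneg hL0 (sub_pos.2 hy.2).le]

theorem tendsto_integral_smul_of_eventually_eq {g : ℕ → ℝ × ℝ → ℝ} {G : ℝ × ℝ → ℝ} {C : ℝ}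
    (a : L2 (box R)) (hg : ∀ m, Continuous (g m)) (hC : ∀ m, ∀ p ∈ box R, |g m p| ≤ C)
    (hlim : ∀ p ∈ box R, ∀ᶠ m in atTop, g m p = G p) :
    Tendsto (fun m => ∫ p in box R, g m p • a p) atTop (𝓝 (∫ p in box R, G p • a p)) := by
  have hmem := ae_restrict_mem (μ := volume) (isOpen_box R).measurableSet
  refine tendsto_integral_of_dominated_convergence (fun p => C * ‖a p‖)
    (fun m => (hg m).aestronglyMeasurable.smul (Lp.aestronglyMeasurable a))
    ((integrable_of_memLp_box (Lp.memLp a)).norm.const_mul C) (fun m => ?_) ?_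
  · filter_upwards [hmem] with p hp
    rw [norm_smul]
    exact mul_le_mul_of_nonneg_right (hC m p hp) (norm_nonneg _)
  · filter_upwards [hmem] with p hp
    exact tendsto_const_nhds.congr' ((hlim p hp).mono fun m hm => congrArg (· • a p) hm.symm)

theorem IsTest.cutoff_mul (hφ : IsTest (Ioo (-R) R ×ˢ univ) φ) (m : ℕ) :
    IsTest (box R) fun p => cutoff m p.2 * φ p where
  smooth := ((contDiff_cutoff m).comp contDiff_snd).mul hφ.smooth
  compact := hφ.compact.mul_left
  supp _ hp := ⟨(hφ.supp (tsupport_mul_subset_right hp)).1,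
    (tsupport_cutoff_comp_snd_subset m (tsupport_mul_subset_left hp)).2⟩

theorem IsTest.partialDeriv_cutoff_mul (hφ : IsTest V φ) (i : Fin 2) (m : ℕ) (p : ℝ × ℝ) :
    partialDeriv i (fun q => cutoff m q.2 * φ q) p
      = cutoff m p.2 * partialDeriv i φ p + (basisVec i).2 * deriv (cutoff m) p.2 * φ p := by
  have hη : Differentiable ℝ (cutoff m) := (contDiff_cutoff m).differentiable (by simp)
  have hsnd : DifferentiableAt ℝ (fun q : ℝ × ℝ => cutoff m q.2) p :=
    hη.comp differentiable_snd p
  rw [partialDeriv_mul i hsnd (hφ.smooth.differentiable (by simp) p),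
    partialDeriv_comp_snd i (hη _)]

theorem IsWeakPartial.integral_partialDeriv_smul {i : Fin 2} {a b : L2 (box R)} {C : ℝ}
    (h : IsWeakPartial (box R) i a b) (hφ : IsTest (Ioo (-R) R ×ˢ univ) φ)
    (hC : ∀ m, ∀ p ∈ box R, |(basisVec i).2 * deriv (cutoff m) p.2 * φ p| ≤ C) :
    ∫ p in box R, partialDeriv i φ p • a p = -∫ p in box R, φ p • b p := by
  obtain ⟨B, hB⟩ := hφ.smooth.continuous.bounded_above_of_compact_support hφ.compact
  obtain ⟨B', hB'⟩ := hφ.exists_abs_partialDeriv_le i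
  have hcutoff (m : ℕ) (y c A : ℝ) (hc : |c| ≤ A) : |cutoff m y * c| ≤ A := by
    rw [abs_mul]
    exact (mul_le_of_le_one_left (abs_nonneg c) (abs_cutoff_le m y)).trans hc
  have hev (p : ℝ × ℝ) (hp : p ∈ box R) :
      ∀ᶠ m in atTop, (fun q => cutoff m q.2 * φ q) =ᶠ[𝓝 p] φ := by
    filter_upwards [eventually_cutoff_eq_one hp.2] with m hm
    filter_upwards [continuous_snd.continuousAt.eventually hm] with q hq
    rw [hq, Pi.one_apply, one_mul]
  have hlim_deriv := tendsto_integral_smul_of_eventually_eq a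
    (fun m => (hφ.cutoff_mul m).continuous_partialDeriv i)
    (fun m p hp => (hφ.partialDeriv_cutoff_mul i m p ▸ abs_add_le _ _).trans
      (add_le_add (hcutoff m p.2 _ _ (hB' p)) (hC m p hp)))
    (fun p hp => (hev p hp).mono fun m hm => partialDeriv_congr i hm)
  have hlim := tendsto_integral_smul_of_eventually_eq b
    (fun m => (hφ.cutoff_mul m).smooth.continuous) (fun m p _ => hcutoff m p.2 _ _ (hB p))
    (fun p hp => (hev p hp).mono fun m hm => hm.eq_of_nhds)
  exact tendsto_nhds_unique hlim_deriv (hlim.neg.congr fun m => (h _ (hφ.cutoff_mul m)).symm)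

theorem IsWeakPartial.integral_partialDeriv_zero_smul {a b : L2 (box R)}
    (h : IsWeakPartial (box R) 0 a b) (hφ : IsTest (Ioo (-R) R ×ˢ univ) φ) :
    ∫ p in box R, partialDeriv 0 φ p • a p = -∫ p in box R, φ p • b p :=
  h.integral_partialDeriv_smul (C := 0) hφ fun m p _ => by simp [basisVec]

theorem IsWeakPartial.integral_partialDeriv_one_smul {a b : L2 (box R)}
    (h : IsWeakPartial (box R) 1 a b) (hφ : IsTest (Ioo (-R) R ×ˢ univ) φ)
    (h0 : ∀ x, φ (x, 0) = 0) (h1 : ∀ x, φ (x, 1) = 0) :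
    ∫ p in box R, partialDeriv 1 φ p • a p = -∫ p in box R, φ p • b p := by
  obtain ⟨L, hL0, hL⟩ := hφ.exists_abs_le_mul_of_eq_zero h0 h1
  obtain ⟨T, hT⟩ := exists_abs_deriv_cutoff_mul_le
  refine h.integral_partialDeriv_smul (C := L * T) hφ fun m p hp => ?_
  have hbasis : (basisVec 1).2 = 1 := rfl
  rw [hbasis, one_mul, abs_mul]
  calc |deriv (cutoff m) p.2| * |φ p|
      ≤ |deriv (cutoff m) p.2| * (L * (p.2 * (1 - p.2))) := by
        gcongr
        exact hL p.1 p.2 hp.2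
    _ = L * (|deriv (cutoff m) p.2| * (p.2 * (1 - p.2))) := by ring
    _ ≤ L * T := by
        gcongr
        exact hT m p.2 hp.2

end BoundaryTests

section TestLine

/-- Test functions on the real line: smooth and compactly supported. -/
structure IsTestLine (χ : ℝ → ℝ) : Prop where
  smooth : ContDiff ℝ ((⊤ : ℕ∞) : WithTop ℕ∞) χ
  compact : HasCompactSupport χ

variable {E : Type*} [NormedAddCommGroup E] [NormedSpace ℝ E] {χ : ℝ → ℝ}

namespace IsTestLine

theorem deriv (hχ : IsTestLine χ) : IsTestLine (deriv χ) :=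
  ⟨hχ.smooth.iterate_deriv 1, hχ.compact.deriv⟩

theorem differentiable (hχ : IsTestLine χ) : Differentiable ℝ χ :=
  hχ.smooth.differentiable (by simp)

theorem comp_const_sub (hχ : IsTestLine χ) (a : ℝ) : IsTestLine fun t => χ (a - t) :=
  ⟨hχ.smooth.comp (contDiff_const.sub contDiff_id),
    hχ.compact.comp_homeomorph (Homeomorph.subLeft a)⟩

theorem integrable_smul (hχ : IsTestLine χ) {f : ℝ → E} (hf : Continuous f) :
    Integrable fun x => χ x • f x :=
  (hχ.smooth.continuous.smul hf).integrable_of_hasCompactSupport hχ.compact.smul_right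

theorem integral_deriv_smul (hχ : IsTestLine χ) {F f : ℝ → E} (hF : ∀ x, HasDerivAt F (f x) x)
    (hf : Continuous f) : ∫ x, _root_.deriv χ x • F x = -∫ x, χ x • f x := by
  have hFc : Continuous F := continuous_iff_continuousAt.2 fun x => (hF x).continuousAt
  rw [eq_neg_iff_add_eq_zero, add_comm, ← eq_neg_iff_add_eq_zero]
  exact integral_bilinear_hasDerivAt_right_eq_neg_left_of_integrable
    (L := ContinuousLinearMap.lsmul ℝ ℝ) (fun x _ => (hχ.differentiable x).hasDerivAt)
    (fun x _ => hF x) (hχ.integrable_smul hf) (hχ.deriv.integrable_smul hFc)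
    (hχ.integrable_smul hFc)

end IsTestLine

theorem eq_of_integral_deriv_smul_eq_zero [CompleteSpace E] {g : ℝ → E} (hg : Continuous g)
    (h : ∀ χ, IsTestLine χ → ∫ x, deriv χ x • g x = 0) (x y : ℝ) : g x = g y := by
  have hrOut : Tendsto (fun n : ℕ => 2 * (1 / ((n : ℝ) + 1))) atTop (𝓝 0) := by
    simpa using tendsto_one_div_add_atTop_nhds_zero_nat.const_mul (2 : ℝ)
  let bump (n : ℕ) : ContDiffBump (0 : ℝ) :=
    ⟨1 / (n + 1), 2 * (1 / (n + 1)), by positivity,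
      by linarith [Nat.one_div_pos_of_nat (α := ℝ) (n := n)]⟩
  have htest (n : ℕ) : IsTestLine ((bump n).normed volume) :=
    ⟨(bump n).contDiff_normed, (bump n).hasCompactSupport_normed⟩
  let mollified (n : ℕ) : ℝ → E :=
    convolution ((bump n).normed volume) g (ContinuousLinearMap.lsmul ℝ ℝ) volume
  have hderiv (n : ℕ) (z : ℝ) : HasDerivAt (mollified n) 0 z := by
    have hz := h _ ((htest n).comp_const_sub z)
    simp only [deriv_comp_const_sub, neg_smul, integral_neg, neg_eq_zero] at hz
    rw [← integral_sub_left_eq_self _ volume z] at hz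
    simp only [sub_sub_cancel] at hz
    exact hz ▸ (htest n).compact.hasDerivAt_convolution_left _ ((htest n).smooth.of_le (by simp))
      hg.locallyIntegrable z
  have hconst (n : ℕ) : mollified n x = mollified n y :=
    is_const_of_deriv_eq_zero (fun z => (hderiv n z).differentiableAt)
      (fun z => (hderiv n z).deriv) x y
  exact tendsto_nhds_unique
    (ContDiffBump.convolution_tendsto_right_of_continuous (φ := bump) hrOut hg x)
    ((ContDiffBump.convolution_tendsto_right_of_continuous (φ := bump) hrOut hg y).congr
      fun n => (hconst n).symm)

theorem hasDerivAt_deriv_of_integral_smul_eq_zero [CompleteSpace E] {d : ℝ → E} {c : ℝ}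
    (hd : ContDiff ℝ 1 d)
    (h : ∀ χ, IsTestLine χ → ∫ x, (deriv (deriv χ) x + c * χ x) • d x = 0) (x : ℝ) :
    HasDerivAt (deriv d) (-(c • d x)) x := by
  let D (x : ℝ) : E := ∫ t in (0 : ℝ)..x, d t
  have hD (x : ℝ) : HasDerivAt D (d x) x :=
    (hd.continuous.integral_hasStrictDerivAt 0 x).hasDerivAt
  have hDc : Continuous D := continuous_iff_continuousAt.2 fun x => (hD x).continuousAt
  have hd' (x : ℝ) : HasDerivAt d (deriv d x) x := (hd.differentiable (by simp) x).hasDerivAt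
  have hdc : Continuous (deriv d) := hd.continuous_deriv le_rfl
  have hweak (χ : ℝ → ℝ) (hχ : IsTestLine χ) : ∫ x, deriv χ x • (deriv d x + c • D x) = 0 := by
    calc ∫ x, deriv χ x • (deriv d x + c • D x)
        = (∫ x, deriv χ x • deriv d x) + c • ∫ x, deriv χ x • D x := by
          rw [← integral_smul, ← integral_add (hχ.deriv.integrable_smul hdc)
            ((hχ.deriv.integrable_smul hDc).fun_smul c)]
          simp only [smul_add, smul_comm c]
      _ = -((∫ x, deriv (deriv χ) x • d x) + c • ∫ x, χ x • d x) := by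
          rw [hχ.deriv.integral_deriv_smul hd' hdc, hχ.integral_deriv_smul hD hd.continuous,
            smul_neg, neg_add, neg_neg]
      _ = -∫ x, (deriv (deriv χ) x + c * χ x) • d x := by
          rw [← integral_smul, ← integral_add (hχ.deriv.deriv.integrable_smul hd.continuous)
            ((hχ.integrable_smul hd.continuous).fun_smul c)]
          simp only [add_smul, mul_smul]
      _ = 0 := by rw [h χ hχ, neg_zero]
  have hconst := eq_of_integral_deriv_smul_eq_zero (hdc.add (hDc.const_smul c)) hweak
  have heq : deriv d = fun x => deriv d 0 + c • D 0 - c • D x :=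
    funext fun x => eq_sub_of_add_eq (hconst x 0)
  rw [heq]
  simpa using ((hD x).const_smul c).const_sub (deriv d 0 + c • D 0)

end TestLine

section Radiation

variable {κ : ℂ} {d d' : ℝ → ℂ}

theorem eq_I_mul_of_tendsto_atTop (hκ : 0 ≤ κ.im) (hd : ∀ x, HasDerivAt d (d' x) x)
    (hd' : ∀ x, HasDerivAt d' (-(κ ^ 2 * d x)) x)
    (hrad : Tendsto (fun x => d' x - Complex.I * κ * d x) atTop (𝓝 0)) (x : ℝ) :
    d' x = Complex.I * κ * d x := by
  let G (x : ℝ) : ℂ := (d' x - Complex.I * κ * d x) * wave κ x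
  have hG (x : ℝ) : HasDerivAt G 0 x := by
    convert! ((hd' x).fun_sub ((hd x).const_mul (Complex.I * κ))).mul (hasDerivAt_wave κ x) using 1
    linear_combination (κ ^ 2 * d x * wave κ x) * Complex.I_sq
  have hbound : ∀ᶠ x in atTop, ‖wave κ x‖ ≤ 1 := by
    filter_upwards [eventually_ge_atTop 0] with x hx
    rw [norm_wave, Real.exp_le_one_iff]
    nlinarith
  have hlim : Tendsto G atTop (𝓝 0) :=
    hrad.zero_mul_isBoundedUnder_le ⟨1, hbound⟩
  have hconst : G = fun _ => G x := funext fun y =>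
    is_const_of_deriv_eq_zero (fun z => (hG z).differentiableAt) (fun z => (hG z).deriv) y x
  have hzero : G x = 0 := tendsto_nhds_unique (hconst ▸ tendsto_const_nhds) hlim
  exact sub_eq_zero.1 ((mul_eq_zero.1 hzero).resolve_right (Complex.exp_ne_zero _))

theorem eq_zero_of_helmholtz_of_radiation (hκ : κ ≠ 0) (him : 0 ≤ κ.im)
    (hd : ∀ x, HasDerivAt d (d' x) x) (hd' : ∀ x, HasDerivAt d' (-(κ ^ 2 * d x)) x)
    (hrad : Tendsto (fun x : ℝ => d' x * ((x / |x| : ℝ) : ℂ) - Complex.I * κ * d x)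
      (cocompact ℝ) (𝓝 0)) (x : ℝ) : d x = 0 := by
  rw [cocompact_eq_atBot_atTop] at hrad
  have hright : d' x = Complex.I * κ * d x := by
    refine eq_I_mul_of_tendsto_atTop him hd hd' ((hrad.mono_left le_sup_right).congr' ?_) x
    filter_upwards [eventually_gt_atTop 0] with y hy
    rw [abs_of_pos hy, div_self hy.ne', Complex.ofReal_one, mul_one]
  have hleft : -d' x = Complex.I * κ * d x := by
    have hreflect := eq_I_mul_of_tendsto_atTop (d := fun y => d (-y)) (d' := fun y => -d' (-y)) him
      (fun y => by simpa [Function.comp_def] using (hd (-y)).scomp y (hasDerivAt_neg y))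
      (fun y => by simpa [Function.comp_def] using ((hd' (-y)).scomp y (hasDerivAt_neg y)).fun_neg)
      (((hrad.mono_left le_sup_left).comp tendsto_neg_atTop_atBot).congr' ?_) (-x)
    · simpa using hreflect
    · filter_upwards [eventually_gt_atTop 0] with y hy
      rw [Function.comp_apply, abs_neg, abs_of_pos hy, neg_div, div_self hy.ne']
      push_cast
      ring
  refine (mul_eq_zero.1 ?_).resolve_left (mul_ne_zero Complex.I_ne_zero hκ)
  linear_combination (-(hright + hleft)) / 2

end Radiation

section SeparatedTests

/-- A bump function equal to `1` near `[0, 1]`: multiplying by it makes a smooth function of `y`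
compactly supported without changing it in the waveguide. -/
def plateau : ContDiffBump (1 / 2 : ℝ) := ⟨1, 2, one_pos, one_lt_two⟩

/-- The product `χ(x) ψ(y)`, cut off outside the waveguide so that it is a test function. -/
def sepTest (χ ψ : ℝ → ℝ) (p : ℝ × ℝ) : ℝ := χ p.1 * (plateau p.2 * ψ p.2)

variable {R : ℝ} {χ ψ : ℝ → ℝ} {p : ℝ × ℝ}

theorem sepTest_eventuallyEq (χ ψ : ℝ → ℝ) (hp : p.2 ∈ Icc (0 : ℝ) 1) :
    sepTest χ ψ =ᶠ[𝓝 p] fun q => χ q.1 * ψ q.2 := by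
  have hball : p.2 ∈ Metric.ball (1 / 2 : ℝ) plateau.rIn := by
    rw [Real.ball_eq_Ioo]
    exact ⟨by linarith [hp.1, show plateau.rIn = 1 from rfl],
      by linarith [hp.2, show plateau.rIn = 1 from rfl]⟩
  filter_upwards [continuous_snd.continuousAt.eventually
    (plateau.eventuallyEq_one_of_mem_ball hball)] with q hq
  rw [sepTest, hq, Pi.one_apply, one_mul]

theorem sepTest_eq (χ ψ : ℝ → ℝ) (hp : p.2 ∈ Icc (0 : ℝ) 1) : sepTest χ ψ p = χ p.1 * ψ p.2 :=
  (sepTest_eventuallyEq χ ψ hp).eq_of_nhds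

theorem partialDeriv_sepTest (i : Fin 2) (hχ : Differentiable ℝ χ) (hψ : Differentiable ℝ ψ)
    (hp : p.2 ∈ Icc (0 : ℝ) 1) :
    partialDeriv i (sepTest χ ψ) p
      = χ p.1 * ((basisVec i).2 * deriv ψ p.2) + (basisVec i).1 * deriv χ p.1 * ψ p.2 := by
  rw [partialDeriv_congr i (sepTest_eventuallyEq χ ψ hp),
    partialDeriv_mul i (f := fun q => χ q.1) (g := fun q => ψ q.2)
      (hχ.comp differentiable_fst p) (hψ.comp differentiable_snd p),
    partialDeriv_comp_fst i (hχ _), partialDeriv_comp_snd i (hψ _)]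

theorem partialDeriv_zero_sepTest (hχ : Differentiable ℝ χ) (hψ : Differentiable ℝ ψ)
    (hp : p.2 ∈ Icc (0 : ℝ) 1) :
    partialDeriv 0 (sepTest χ ψ) p = deriv χ p.1 * ψ p.2 := by
  simp [partialDeriv_sepTest 0 hχ hψ hp, basisVec]

theorem partialDeriv_one_sepTest (hχ : Differentiable ℝ χ) (hψ : Differentiable ℝ ψ)
    (hp : p.2 ∈ Icc (0 : ℝ) 1) :
    partialDeriv 1 (sepTest χ ψ) p = χ p.1 * deriv ψ p.2 := by
  simp [partialDeriv_sepTest 1 hχ hψ hp, basisVec]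

theorem isTest_sepTest (hχ : IsTestLine χ) (hψ : ContDiff ℝ ((⊤ : ℕ∞) : WithTop ℕ∞) ψ)
    (hsupp : tsupport χ ⊆ Ioo (-R) R) : IsTest (Ioo (-R) R ×ˢ univ) (sepTest χ ψ) where
  smooth := (hχ.smooth.comp contDiff_fst).mul
    ((plateau.contDiff.mul hψ).comp contDiff_snd)
  compact := by
    refine .intro (hχ.compact.isCompact.prod plateau.hasCompactSupport.isCompact) fun p hp => ?_
    rw [sepTest, mul_eq_zero, mul_eq_zero]
    exact (not_and_or.1 hp).imp image_eq_zero_of_notMem_tsupport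
      fun h => .inl (image_eq_zero_of_notMem_tsupport h)
  supp := by
    have hsub : tsupport (sepTest χ ψ) ⊆ tsupport χ ×ˢ univ :=
      closure_minimal (fun p hp => ⟨subset_tsupport χ (left_ne_zero_of_mul hp), mem_univ _⟩)
        ((isClosed_tsupport χ).prod isClosed_univ)
    exact hsub.trans (prod_mono hsupp subset_rfl)

end SeparatedTests

section Uniqueness

variable {R : ℝ} {χ : ℝ → ℝ} {u u' : ℝ × ℝ → ℂ}

theorem integral_mul_mode_smul {θ : ℝ → ℝ} (hθ : Continuous θ) (n : ℕ)
    (hu : MemLp u 2 (volume.restrict (box R))) :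
    ∫ p in box R, (θ p.1 * mode n p.2) • u p = ∫ x in Ioo (-R) R, θ x • coef n u x := by
  have h := integral_inner_sep_mode (F := fun x => (θ x : ℂ))
    (memLp_Ioo_of_continuous (by fun_prop) 2 (-R) R) n hu
  simpa [sep, RCLike.inner_apply, mul_comm, mul_assoc] using h

theorem setIntegral_box_smul_congr {f g : ℝ × ℝ → ℝ} (a : L2 (box R))
    (h : ∀ p, p.2 ∈ Icc (0 : ℝ) 1 → f p = g p) :
    ∫ p in box R, f p • a p = ∫ p in box R, g p • a p :=
  setIntegral_congr_fun (isOpen_box R).measurableSet fun p hp =>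
    congrArg (· • a p) (h p (Ioo_subset_Icc_self hp.2))

theorem integral_partialDeriv_zero_sepTest_smul {a b : L2 (box R)}
    (h : IsWeakPartial (box R) 0 a b) (hχ : IsTestLine χ) (hsupp : tsupport χ ⊆ Ioo (-R) R)
    (n : ℕ) :
    ∫ p in box R, partialDeriv 0 (sepTest χ (mode n)) p • b p
      = -∫ x in Ioo (-R) R, deriv (deriv χ) x • coef n a x := by
  have hmode := (contDiff_mode (m := 1) n).differentiable (by simp)
  have hφ := isTest_sepTest hχ.deriv (contDiff_mode n)
    (tsupport_deriv_subset.trans hsupp)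
  rw [← integral_mul_mode_smul (hχ.deriv.deriv.smooth.continuous) n (Lp.memLp a),
    ← setIntegral_box_smul_congr a fun p hp =>
      partialDeriv_zero_sepTest hχ.deriv.differentiable hmode hp,
    h.integral_partialDeriv_zero_smul hφ, neg_neg]
  exact setIntegral_box_smul_congr b fun p hp =>
    (partialDeriv_zero_sepTest hχ.differentiable hmode hp).trans (sepTest_eq _ _ hp).symm

theorem integral_partialDeriv_one_sepTest_smul {a b : L2 (box R)}
    (h : IsWeakPartial (box R) 1 a b) (hχ : IsTestLine χ) (hsupp : tsupport χ ⊆ Ioo (-R) R)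
    (n : ℕ) :
    ∫ p in box R, partialDeriv 1 (sepTest χ (mode n)) p • b p
      = freq n ^ 2 • ∫ x in Ioo (-R) R, χ x • coef n a x := by
  have hmode := (contDiff_mode (m := 1) n).differentiable (by simp)
  have hmodeDeriv := (contDiff_modeDeriv (m := 1) n).differentiable (by simp)
  have hφ := isTest_sepTest hχ (contDiff_modeDeriv n) hsupp
  have hzero (x y : ℝ) (hy : y ∈ Icc (0 : ℝ) 1) (h : modeDeriv n y = 0) :
      sepTest χ (modeDeriv n) (x, y) = 0 := by rw [sepTest_eq _ _ hy, h, mul_zero]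
  have hparts := h.integral_partialDeriv_one_smul hφ
    (fun x => hzero x 0 (left_mem_Icc.2 zero_le_one) (modeDeriv_zero_right n))
    (fun x => hzero x 1 (right_mem_Icc.2 zero_le_one) (modeDeriv_one_right n))
  rw [← integral_mul_mode_smul hχ.smooth.continuous n (Lp.memLp a)]
  calc ∫ p in box R, partialDeriv 1 (sepTest χ (mode n)) p • b p
      = ∫ p in box R, sepTest χ (modeDeriv n) p • b p :=
        setIntegral_box_smul_congr b fun p hp => by
          rw [partialDeriv_one_sepTest hχ.differentiable hmode hp, sepTest_eq _ _ hp,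
            (hasDerivAt_mode n _).deriv]
    _ = -∫ p in box R, partialDeriv 1 (sepTest χ (modeDeriv n)) p • a p := by
        rw [hparts, neg_neg]
    _ = freq n ^ 2 • ∫ p in box R, (χ p.1 * mode n p.2) • a p := by
        rw [← integral_neg, ← integral_smul]
        simp only [← neg_smul, smul_smul]
        refine setIntegral_box_smul_congr a fun p hp => ?_
        rw [partialDeriv_one_sepTest hχ.differentiable hmodeDeriv hp,
          (hasDerivAt_modeDeriv n _).deriv]
        ring

theorem integral_smul_coef_eq_zero {v : H2 (box R)} {k : ℝ}
    (hgreen : ∀ φ (hφ : IsTest (Ioo (-R) R ×ˢ univ) φ), greenCLM hφ v = 0)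
    (hhelm : hess v 0 0 + hess v 1 1 + (k : ℂ) ^ 2 • val v = 0)
    (hχ : IsTestLine χ) (hsupp : tsupport χ ⊆ Ioo (-R) R) (n : ℕ) :
    ∫ x in Ioo (-R) R, (deriv (deriv χ) x + (k ^ 2 - freq n ^ 2) * χ x) • coef n (val v) x
      = 0 := by
  have hφ := isTest_sepTest hχ (contDiff_mode n) hsupp
  have hint {θ : ℝ → ℝ} (hθ : IsTestLine θ) :
      IntegrableOn (fun x => θ x • coef n (val v) x) (Ioo (-R) R) :=
    memLp_one_iff_integrable.1 ((memLp_coef (Lp.memLp (val v)) n).smul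
      (hθ.smooth.continuous.memLp_of_hasCompactSupport hθ.compact (p := 2)))
  have htest := congrArg (testCLM (hφ.memLp _)) hhelm
  have hg := hgreen _ hφ
  have hgrad (i : Fin 2) : IsWeakPartial (box R) i (val v) (grad v i) := v.2.1 i
  rw [greenCLM_apply, integral_partialDeriv_zero_sepTest_smul (hgrad 0) hχ hsupp,
    integral_partialDeriv_one_sepTest_smul (hgrad 1) hχ hsupp] at hg
  simp only [map_add, map_smul, map_zero, testCLM_apply,
    setIntegral_box_smul_congr (val v) fun _ hp => sepTest_eq χ (mode n) hp,
    integral_mul_mode_smul hχ.smooth.continuous n (Lp.memLp (val v)), smul_eq_mul] at htest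
  simp only [add_smul, mul_smul]
  rw [integral_add (hint hχ.deriv.deriv) ((hint hχ).fun_smul (k ^ 2 - freq n ^ 2)),
    integral_smul]
  simp only [Complex.real_smul, Complex.ofReal_sub, Complex.ofReal_pow] at hg htest ⊢
  linear_combination htest - hg

theorem greenCLM_sub_eq_zero {v v' : H2 (box R)} {f : ℝ × ℝ → ℂ} {k : ℝ} (hR : 0 < R)
    (h : IsSolution k f u) (h' : IsSolution k f u') (hv : IsRestriction v u)
    (hv' : IsRestriction v' u') {φ : ℝ × ℝ → ℝ} (hφ : IsTest (Ioo (-R) R ×ˢ univ) φ) :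
    greenCLM hφ (v - v') = 0 := by
  rw [map_sub, ← integral_green_eq_greenCLM, ← integral_green_eq_greenCLM,
    h.neumann R hR v hv φ hφ, h'.neumann R hR v' hv' φ hφ, sub_zero]

theorem laplacian_sub_add_smul_eq_zero {v v' : H2 (box R)} {f : ℝ × ℝ → ℂ} {k : ℝ} (hR : 0 < R)
    (h : IsSolution k f u) (h' : IsSolution k f u') (hv : IsRestriction v u)
    (hv' : IsRestriction v' u') :
    hess (v - v') 0 0 + hess (v - v') 1 1 + (k : ℂ) ^ 2 • val (v - v') = 0 := by
  have hlap : hess v 0 0 + hess v 1 1 + (k : ℂ) ^ 2 • val v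
      = hess v' 0 0 + hess v' 1 1 + (k : ℂ) ^ 2 • val v' := by
    apply Lp.ext
    filter_upwards [h.helmholtz R hR v hv, h'.helmholtz R hR v' hv', hv, hv',
      Lp.coeFn_add (hess v 0 0 + hess v 1 1) ((k : ℂ) ^ 2 • val v),
      Lp.coeFn_add (hess v 0 0) (hess v 1 1), Lp.coeFn_smul ((k : ℂ) ^ 2) (val v),
      Lp.coeFn_add (hess v' 0 0 + hess v' 1 1) ((k : ℂ) ^ 2 • val v'),
      Lp.coeFn_add (hess v' 0 0) (hess v' 1 1), Lp.coeFn_smul ((k : ℂ) ^ 2) (val v')]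
      with p hp hp' hu hu' h_add h_hess h_smul h_add' h_hess' h_smul'
    rw [h_add, h_add', Pi.add_apply, Pi.add_apply, h_hess, h_hess', h_smul, h_smul', Pi.add_apply,
      Pi.add_apply, Pi.smul_apply, Pi.smul_apply, hu, hu', smul_eq_mul, smul_eq_mul, hp, hp']
  have hsub (i : JetIndex) : (v - v').1 i = v.1 i - v'.1 i := rfl
  simp only [hess, val, hsub] at hlap ⊢
  rw [smul_sub, sub_add_sub_comm, sub_add_sub_comm, hlap, sub_self]

theorem coef_smul_add_smul_ae (hu : MemLp u 2 (volume.restrict (box R)))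
    (hu' : MemLp u' 2 (volume.restrict (box R))) (a b : ℂ) (n : ℕ) :
    coef n (a • u + b • u')
      =ᵐ[volume.restrict (Ioo (-R) R)] a • coef n u + b • coef n u' := by
  have hint := integrable_of_memLp_box (memLp_mode_smul hu n)
  have hint' := integrable_of_memLp_box (memLp_mode_smul hu' n)
  rw [volume_restrict_box] at hint hint'
  filter_upwards [hint.prod_right_ae, hint'.prod_right_ae] with x hx hx'
  simp only [coef, Pi.add_apply, Pi.smul_apply, smul_add, smul_comm _ a, smul_comm _ b]
  rw [integral_add (hx.fun_smul a) (hx'.fun_smul b), integral_smul, integral_smul]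

theorem coef_val_sub_ae {v v' : H2 (box R)} (hv : IsRestriction v u) (hv' : IsRestriction v' u')
    (n : ℕ) : coef n (val (v - v')) =ᵐ[volume.restrict (Ioo (-R) R)] coef n u - coef n u' := by
  have hsub : val (v - v') =ᵐ[volume.restrict (box R)] (1 : ℂ) • val v + (-1 : ℂ) • val v' :=
    (Lp.coeFn_sub (val v) (val v')).trans (.of_eq (by rw [one_smul, neg_one_smul, sub_eq_add_neg]))
  filter_upwards [coef_congr_ae hsub n,
    coef_smul_add_smul_ae (Lp.memLp (val v)) (Lp.memLp (val v')) 1 (-1) n,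
    coef_congr_ae hv n, coef_congr_ae hv' n] with x h_sub h_add hx hx'
  rw [h_sub, h_add, one_smul, neg_one_smul, ← sub_eq_add_neg, Pi.sub_apply, Pi.sub_apply, hx, hx']

/-- `w` is a `C¹` representative of `coef n u` satisfying the radiation condition. -/
structure IsOutgoingCoef (κ : ℂ) (n : ℕ) (u : ℝ × ℝ → ℂ) (w : ℝ → ℂ) : Prop where
  contDiff : ContDiff ℝ 1 w
  ae_eq_coef : w =ᵐ[volume] coef n u
  tendsto : Tendsto (fun x : ℝ => deriv w x * ((x / |x| : ℝ) : ℂ) - Complex.I * κ * w x)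
    (cocompact ℝ) (𝓝 0)

theorem exists_isOutgoingCoef {k : ℝ} (h : IsOutgoing k u) (n : ℕ) :
    ∃ w, IsOutgoingCoef (waveNumber k n) n u w :=
  let ⟨w, hw, hcoef, hrad⟩ := h n
  ⟨w, hw, hcoef, tendsto_zero_iff_norm_tendsto_zero.2 hrad⟩

theorem integral_smul_sub_eq_zero {f : ℝ × ℝ → ℂ} {k : ℝ} {w w' : ℝ → ℂ} {n : ℕ}
    (h : IsSolution k f u) (h' : IsSolution k f u') (hw : w =ᵐ[volume] coef n u)
    (hw' : w' =ᵐ[volume] coef n u') (hχ : IsTestLine χ) :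
    ∫ x, (deriv (deriv χ) x + (k ^ 2 - freq n ^ 2) * χ x) • (w - w') x = 0 := by
  obtain ⟨R, hR, hsupp⟩ := hχ.compact.isCompact.isBounded.subset_ball_lt 0 0
  rw [Real.ball_eq_Ioo, zero_sub, zero_add] at hsupp
  obtain ⟨v, hv⟩ := h.memH2loc R hR
  obtain ⟨v', hv'⟩ := h'.memH2loc R hR
  have hzero : ∀ x ∉ Ioo (-R) R,
      (deriv (deriv χ) x + (k ^ 2 - freq n ^ 2) * χ x) • (w - w') x = 0 := fun x hx => by
    have hx' := fun h => hx (hsupp h)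
    rw [image_eq_zero_of_notMem_tsupport hx', image_eq_zero_of_notMem_tsupport fun h =>
      hx' (tsupport_deriv_subset (tsupport_deriv_subset h)), mul_zero, add_zero, zero_smul]
  rw [← setIntegral_eq_integral_of_forall_compl_eq_zero hzero,
    ← integral_smul_coef_eq_zero (fun _ hφ => greenCLM_sub_eq_zero hR h h' hv hv' hφ)
      (laplacian_sub_add_smul_eq_zero hR h h' hv hv') hχ hsupp n]
  refine integral_congr_ae ?_
  filter_upwards [coef_val_sub_ae hv hv' n, ae_restrict_of_ae hw, ae_restrict_of_ae hw']
    with x hx hwx hwx'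
  simp only [hx, Pi.sub_apply, hwx, hwx']

theorem IsOutgoingCoef.unique {f : ℝ × ℝ → ℂ} {k : Frequency} {w w' : ℝ → ℂ} {n : ℕ}
    (h : IsSolution k f u) (h' : IsSolution k f u') (hw : IsOutgoingCoef (waveNumber k n) n u w)
    (hw' : IsOutgoingCoef (waveNumber k n) n u' w') : w = w' := by
  have hd : ContDiff ℝ 1 (w - w') := hw.contDiff.sub hw'.contDiff
  have hderiv (x : ℝ) : deriv (w - w') x = deriv w x - deriv w' x :=
    deriv_sub (hw.contDiff.differentiable (by simp) x) (hw'.contDiff.differentiable (by simp) x)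
  have hode := hasDerivAt_deriv_of_integral_smul_eq_zero hd fun χ hχ =>
    integral_smul_sub_eq_zero h h' hw.ae_eq_coef hw'.ae_eq_coef hχ
  refine sub_eq_zero.1 (funext fun x => eq_zero_of_helmholtz_of_radiation
    (waveNumber_ne_zero k n) (waveNumber_im_nonneg k n)
    (fun x => (hd.differentiable (by simp) x).hasDerivAt) (fun x => ?_) ?_ x)
  · have heq : (((k : ℝ) ^ 2 - freq n ^ 2 : ℝ) : ℂ) = waveNumber k n ^ 2 := by
      rw [waveNumber_sq k.2.1.le]
      push_cast
      rfl
    rw [← heq, ← Complex.real_smul]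
    exact hode x
  · simpa only [hderiv, Pi.sub_apply, sub_zero, sub_mul, mul_sub, sub_sub_sub_comm]
      using hw.tendsto.sub hw'.tendsto

theorem ae_eq_guide_of_forall_box {u u' : ℝ × ℝ → ℂ}
    (h : ∀ R > 0, u =ᵐ[volume.restrict (box R)] u') : u =ᵐ[volume.restrict guide] u' := by
  have hcover : guide ⊆ ⋃ m : ℕ, box (m + 1) := fun p hp => by
    obtain ⟨m, hm⟩ := exists_nat_gt |p.1|
    exact mem_iUnion.2 ⟨m, abs_lt.1 (hm.trans (lt_add_one _)), hp.2⟩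
  exact ae_restrict_of_ae_restrict_of_subset hcover
    ((ae_restrict_iUnion_iff _ _).2 fun m => h _ m.cast_add_one_pos)

theorem IsSolution.ae_eq {f : ℝ × ℝ → ℂ} {k : Frequency} (h : IsSolution k f u)
    (h' : IsSolution k f u') : u =ᵐ[volume.restrict guide] u' := by
  refine ae_eq_guide_of_forall_box fun R hR => ?_
  obtain ⟨v, hv⟩ := h.memH2loc R hR
  obtain ⟨v', hv'⟩ := h'.memH2loc R hR
  have hcoef (n : ℕ) : coef n (val (v - v')) =ᵐ[volume.restrict (Ioo (-R) R)] 0 := by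
    obtain ⟨w, hw⟩ := exists_isOutgoingCoef h.outgoing n
    obtain ⟨w', hw'⟩ := exists_isOutgoingCoef h'.outgoing n
    obtain rfl := hw.unique h h' hw'
    filter_upwards [coef_val_sub_ae hv hv' n, ae_restrict_of_ae hw.ae_eq_coef,
      ae_restrict_of_ae hw'.ae_eq_coef] with x hx hwx hwx'
    rw [hx, Pi.sub_apply, ← hwx, ← hwx', sub_self, Pi.zero_apply]
  have hval : val (v - v') = 0 := (Lp.eq_zero_iff_ae_eq_zero).2
    (ae_eq_zero_of_coef (integrable_of_memLp_box (Lp.memLp _)) hcoef)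
  have hzero : v = v' := H2.ext_val (isOpen_box R) (sub_eq_zero.1 hval)
  exact hv.symm.trans (hzero ▸ hv')

end Uniqueness

section SolutionOperator

variable {r R : ℝ} {f g : ℝ → ℂ} {κ : ℂ}

theorem outgoing_zero_congr_ae (hf : IsSource r f) (hg : IsSource r g)
    (h : f =ᵐ[volume.restrict (Ioo (-r) r)] g) : outgoing κ f 0 = outgoing κ g 0 := by
  ext x
  rw [outgoing_zero_eq_setIntegral hf, outgoing_zero_eq_setIntegral hg]
  exact congrArg _ (integral_congr_ae (h.mono fun t ht => congrArg (_ * ·) ht))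

theorem sourceCoef_ae_eq (s : L2 (box r)) (n : ℕ) :
    sourceCoef s n =ᵐ[volume.restrict (Ioo (-r) r)] coef n s :=
  coef_congr_ae (extendByZero_ae_eq s) n

theorem sourceCoef_smul_add_smul_ae (s t : L2 (box r)) (a b : ℂ) (n : ℕ) :
    sourceCoef (a • s + b • t) n
      =ᵐ[volume.restrict (Ioo (-r) r)] a • sourceCoef s n + b • sourceCoef t n := by
  have hcoe : (a • s + b • t : L2 (box r)) =ᵐ[volume.restrict (box r)] a • ⇑s + b • ⇑t :=
    (Lp.coeFn_add _ _).trans ((Lp.coeFn_smul a s).add (Lp.coeFn_smul b t))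
  filter_upwards [sourceCoef_ae_eq (a • s + b • t) n, coef_congr_ae hcoe n,
    coef_smul_add_smul_ae (Lp.memLp s) (Lp.memLp t) a b n, sourceCoef_ae_eq s n,
    sourceCoef_ae_eq t n] with x h_source h_coef h_add hs ht
  simp only [h_source, h_coef, h_add, Pi.add_apply, Pi.smul_apply, hs, ht]

theorem modalProfile_smul_add_smul (k : Frequency) (s t : L2 (box r)) (a b : ℂ) (n : ℕ) (x : ℝ) :
    modalProfile k (a • s + b • t) n 0 x
      = a * modalProfile k s n 0 x + b * modalProfile k t n 0 x := by
  have hint (s : L2 (box r)) :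
      IntegrableOn (fun u => wave (waveNumber k n) |x - u| * sourceCoef s n u) (Ioo (-r) r) :=
    ((isSource_sourceCoef s n).integrable_continuous_mul (by fun_prop)).integrableOn
  simp only [modalProfile, outgoing_zero_eq_setIntegral (isSource_sourceCoef _ n)]
  have hcongr : ∫ u in Ioo (-r) r,
        wave (waveNumber k n) |x - u| * sourceCoef (a • s + b • t) n u
      = ∫ u in Ioo (-r) r, (a * (wave (waveNumber k n) |x - u| * sourceCoef s n u)
        + b * (wave (waveNumber k n) |x - u| * sourceCoef t n u)) := by
    refine integral_congr_ae ((sourceCoef_smul_add_smul_ae s t a b n).mono fun u hu => ?_)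
    simp only [hu, Pi.add_apply, Pi.smul_apply, smul_eq_mul]
    ring
  rw [hcongr, integral_add ((hint s).const_mul a) ((hint t).const_mul b), integral_const_mul,
    integral_const_mul]
  ring

theorem solFun_smul_add_smul (k : Frequency) (s t : L2 (box r)) (a b : ℂ) :
    solFun k (a • s + b • t) = a • solFun k s + b • solFun k t := by
  ext p
  refine (hasSum_solFun k _ p).unique ?_
  convert! ((hasSum_solFun k s p).const_smul a).add ((hasSum_solFun k t p).const_smul b) using 2
    with n
  simp only [sep, modalProfile_smul_add_smul, Complex.real_smul, smul_eq_mul]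
  ring

theorem solH2_smul_add_smul (R : ℝ) (k : Frequency) (s t : L2 (box r)) (a b : ℂ) :
    solH2 R k (a • s + b • t) = a • solH2 R k s + b • solH2 R k t := by
  have hsum : IsRestriction (a • solH2 R k s + b • solH2 R k t)
      (a • solFun k s + b • solFun k t) :=
    (Lp.coeFn_add (a • val (solH2 R k s)) (b • val (solH2 R k t))).trans
      (((Lp.coeFn_smul a _).trans ((isRestriction_solH2 R k s).const_smul a)).add
        ((Lp.coeFn_smul b _).trans ((isRestriction_solH2 R k t).const_smul b)))
  exact (isRestriction_solH2 R k _).unique hsum (.of_eq (solFun_smul_add_smul k s t a b))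

/-- The solution operator `𝓗ₖ`, mapping a source to the restriction of the outgoing solution. -/
def solCLM (r : ℝ) (k : Frequency) : L2 (box r) →L[ℂ] H2 (box r) :=
  LinearMap.mkContinuousOfExistsBound
    { toFun := solH2 r k
      map_add' := fun s t => by simpa only [one_smul] using solH2_smul_add_smul r k s t 1 1
      map_smul' := fun c s => by
        simpa only [zero_smul, add_zero, RingHom.id_apply] using solH2_smul_add_smul r k s s c 0 }
    (let ⟨C, _, h⟩ := exists_norm_solH2_le r r k; ⟨C, h⟩)

end SolutionOperator

section Resonance

variable {r a : ℝ} {f : ℝ → ℂ} {κ : ℂ} {x : ℝ}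

theorem isSource_indicator_one (har : a ≤ r) : IsSource r ((Ioo (-a) a).indicator 1) where
  memLp := memLp_indicator_const 2 measurableSet_Ioo 1 (.inr (by simp))
  eq_zero _ ht := indicator_of_notMem (fun h => ht (Ioo_subset_Ioo (neg_le_neg har) har h)) _

theorem normSq_indicator_one (ha : 0 ≤ a) (har : a ≤ r) :
    normSq r ((Ioo (-a) a).indicator 1) = 2 * a := by
  have hsq (x : ℝ) : ‖(Ioo (-a) a).indicator (1 : ℝ → ℂ) x‖ ^ 2
      = (Ioo (-a) a).indicator (fun _ => (1 : ℝ)) x := by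
    by_cases hx : x ∈ Ioo (-a) a <;> simp [hx]
  simp only [normSq, hsq]
  rw [setIntegral_indicator measurableSet_Ioo,
    inter_eq_self_of_subset_right (Ioo_subset_Ioo (neg_le_neg har) har), setIntegral_const,
    Real.volume_real_Ioo_of_le (neg_le_self ha), smul_eq_mul]
  ring

theorem norm_wave_sub_one_le {t : ℝ} (h : ‖κ‖ * |t| ≤ 1) : ‖wave κ t - 1‖ ≤ 2 * (‖κ‖ * |t|) := by
  have hnorm : ‖Complex.I * κ * t‖ = ‖κ‖ * |t| := by
    rw [norm_mul, norm_mul, Complex.norm_I, one_mul, Complex.norm_real, Real.norm_eq_abs]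
  rw [wave, ← hnorm]
  exact Complex.norm_exp_sub_one_le (hnorm.trans_le h)

theorem le_norm_integral_wave (ha : 0 ≤ a) (h : 8 * (‖κ‖ * a) ≤ 1) (hx : x ∈ Ioo (-a) a) :
    a ≤ ‖∫ t in Ioo (-a) a, wave κ |x - t|‖ := by
  have hclose (t : ℝ) (ht : t ∈ Ioo (-a) a) : ‖wave κ |x - t| - 1‖ ≤ 2⁻¹ := by
    have hdist : ‖κ‖ * |(|x - t|)| ≤ ‖κ‖ * (2 * a) := by
      rw [abs_abs]
      exact mul_le_mul_of_nonneg_left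
        (abs_le.2 ⟨by linarith [hx.1, ht.2], by linarith [hx.2, ht.1]⟩) (norm_nonneg _)
    exact (norm_wave_sub_one_le (by linarith)).trans (by linarith)
  have hvol : volume.real (Ioo (-a) a) = 2 * a := by
    rw [Real.volume_real_Ioo_of_le (neg_le_self ha)]
    ring
  have hdiff : ‖(∫ t in Ioo (-a) a, wave κ |x - t|) - (2 * a : ℝ)‖ ≤ a := by
    have hbound := norm_setIntegral_le_of_norm_le_const (measure_Ioo_lt_top (μ := volume)) hclose
    have hwave : IntegrableOn (fun t => wave κ |x - t|) (Ioo (-a) a) :=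
      (by fun_prop : Continuous fun t => wave κ |x - t|).integrableOn_Icc.mono_set
        Ioo_subset_Icc_self
    rw [integral_sub hwave (integrable_const _), setIntegral_const, hvol, Complex.real_smul,
      mul_one] at hbound
    linarith
  have htri := norm_sub_norm_le ((2 * a : ℝ) : ℂ) (∫ t in Ioo (-a) a, wave κ |x - t|)
  rw [norm_sub_rev, Complex.norm_of_nonneg (by positivity)] at htri
  linarith

theorem le_norm_outgoing_indicator_one (ha : 0 ≤ a) (h : 8 * (‖κ‖ * a) ≤ 1)
    (hx : x ∈ Ioo (-a) a) : a / (2 * ‖κ‖) ≤ ‖outgoing κ ((Ioo (-a) a).indicator 1) 0 x‖ := by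
  have hconst : ∫ t in Ioo (-a) a, wave κ |x - t| * (Ioo (-a) a).indicator 1 t
      = ∫ t in Ioo (-a) a, wave κ |x - t| :=
    setIntegral_congr_fun measurableSet_Ioo fun t ht => by
      simp only [indicator_of_mem ht, Pi.one_apply, mul_one]
  rw [outgoing_zero_eq_setIntegral (isSource_indicator_one le_rfl), hconst, norm_mul, norm_div,
    Complex.norm_I, norm_mul, Complex.norm_ofNat, div_mul_eq_mul_div, one_mul]
  gcongr
  exact le_norm_integral_wave ha h hx

theorem le_normSq_outgoing_indicator_one (hκ : κ ≠ 0) (ha : 0 ≤ a) (har : a ≤ r)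
    (h : 8 * (‖κ‖ * a) ≤ 1) :
    2 * a * (a / (2 * ‖κ‖)) ^ 2 ≤ normSq r (outgoing κ ((Ioo (-a) a).indicator 1) 0) := by
  have hint : IntegrableOn (fun x => ‖outgoing κ ((Ioo (-a) a).indicator 1) 0 x‖ ^ 2)
      (Ioo (-r) r) :=
    have hw := (isProfile_outgoing hκ (isSource_indicator_one har)).memLp r 0
    (memLp_two_iff_integrable_sq_norm hw.1).1 hw
  have hsub : Ioo (-a) a ⊆ Ioo (-r) r := Ioo_subset_Ioo (neg_le_neg har) har
  calc 2 * a * (a / (2 * ‖κ‖)) ^ 2 = ∫ _ in Ioo (-a) a, (a / (2 * ‖κ‖)) ^ 2 := by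
        rw [setIntegral_const, Real.volume_real_Ioo_of_le (neg_le_self ha), smul_eq_mul]
        ring
    _ ≤ ∫ x in Ioo (-a) a, ‖outgoing κ ((Ioo (-a) a).indicator 1) 0 x‖ ^ 2 :=
        setIntegral_mono_on (integrable_const _) (hint.mono_set hsub) measurableSet_Ioo
          fun x hx => pow_le_pow_left₀ (by positivity) (le_norm_outgoing_indicator_one ha h hx) 2
    _ ≤ _ := setIntegral_mono_set hint (ae_of_all _ fun _ => sq_nonneg _) hsub.eventuallyLE

theorem sourceCoef_sepLp_mode (hf : IsSource r f) (n : ℕ) :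
    sourceCoef (sepLp (hf.memLp.restrict (Ioo (-r) r)) (continuous_mode n)) n
      =ᵐ[volume.restrict (Ioo (-r) r)] f := by
  filter_upwards [sourceCoef_ae_eq (sepLp (hf.memLp.restrict (Ioo (-r) r)) (continuous_mode n)) n,
    coef_congr_ae (coeFn_sepLp (hf.memLp.restrict (Ioo (-r) r)) (continuous_mode n)) n]
    with x hx hx'
  rw [hx, hx']
  simp only [coef, sep, smul_smul, integral_smul_const, integral_mode_sq, one_smul]

theorem normSq_outgoing_le_norm_solCLM_sq (k : Frequency) (n : ℕ) (hf : IsSource r f) :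
    (1 + freq n ^ 2 + freq n ^ 4) * normSq r (outgoing (waveNumber k n) f 0)
      ≤ ‖solCLM r k‖ ^ 2 * normSq r f := by
  set s := sepLp (hf.memLp.restrict (Ioo (-r) r)) (continuous_mode n)
  have hprofile : modalProfile k s n 0 = outgoing (waveNumber k n) f 0 :=
    outgoing_zero_congr_ae (isSource_sourceCoef s n) hf (sourceCoef_sepLp_mode hf n)
  have hs : ‖s‖ ^ 2 = normSq r f := by rw [norm_sepLp_sq, integral_mode_sq, mul_one]
  calc (1 + freq n ^ 2 + freq n ^ 4) * normSq r (outgoing (waveNumber k n) f 0)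
      ≤ ‖modalH2 r k s n‖ ^ 2 := by
        rw [modalH2, norm_sepH2_sq, hprofile]
        have h_one := normSq_nonneg r (modalProfile k s n 1)
        have h_two := normSq_nonneg r (modalProfile k s n 2)
        exact (le_add_of_nonneg_right (by positivity)).trans (le_add_of_nonneg_right h_two)
    _ ≤ ‖solH2 r k s‖ ^ 2 := by
        gcongr
        exact norm_le_norm_of_hasSum_of_pairwise_inner_eq_zero (pairwise_inner_modalH2 r k s)
          (hasSum_modalH2 r k s) n
    _ ≤ (‖solCLM r k‖ * ‖s‖) ^ 2 := by
        gcongr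
        exact (solCLM r k).le_opNorm s
    _ = ‖solCLM r k‖ ^ 2 * normSq r f := by rw [mul_pow, hs]

theorem norm_waveNumber_sq_le (k : Frequency) (n : ℕ) {δ : ℝ} (hδ : δ ≤ 1)
    (h : |(k : ℝ) - freq n| ≤ δ) : ‖waveNumber k n‖ ^ 2 ≤ 2 * δ * (1 + freq n ^ 2) := by
  have hsum : |(k : ℝ) + freq n| ≤ 2 * (1 + freq n ^ 2) := by
    rw [abs_of_nonneg (add_nonneg k.2.1.le (freq_nonneg n))]
    nlinarith [(abs_le.1 h).2, sq_nonneg (freq n - 1)]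
  calc ‖waveNumber k n‖ ^ 2 = |(k : ℝ) - freq n| * |(k : ℝ) + freq n| := by
        rw [norm_waveNumber_sq k.2.1.le, ← abs_mul]
        ring_nf
    _ ≤ δ * (2 * (1 + freq n ^ 2)) :=
        mul_le_mul h hsum (abs_nonneg _) ((abs_nonneg _).trans h)
    _ = 2 * δ * (1 + freq n ^ 2) := by ring

-- The source `φₙ` on `(-a, a) × (0, 1)` is resonant once `a ≪ 1 / |kₙ|`; the choice
-- `a² = r² / (1 + n²π²)` achieves this uniformly in `n`.
theorem sq_le_mul_norm_solCLM_sq (hr : 0 < r) (k : Frequency) (n : ℕ) {δ : ℝ} (hδ : δ ≤ 1)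
    (hδr : 128 * r ^ 2 * δ ≤ 1) (h : |(k : ℝ) - freq n| ≤ δ) :
    r ^ 2 ≤ 16 * δ * ‖solCLM r k‖ ^ 2 := by
  set X := 1 + freq n ^ 2
  set κ := waveNumber k n
  set a := r / √X
  have hX : 1 ≤ X := le_add_of_nonneg_right (sq_nonneg _)
  have ha : 0 < a := by positivity
  have ha_sq : a ^ 2 * X = r ^ 2 := by
    rw [div_pow, Real.sq_sqrt (by positivity), div_mul_cancel₀ _ (by positivity)]
  have har : a ≤ r := div_le_self hr.le (Real.one_le_sqrt.2 hX)
  have hκ : ‖κ‖ ^ 2 ≤ 2 * δ * X := norm_waveNumber_sq_le k n hδ h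
  have hκ_pos : 0 < ‖κ‖ := norm_waveNumber_pos k n
  have hκa : 8 * (‖κ‖ * a) ≤ 1 := by
    refine (sq_le_one_iff₀ (by positivity)).1 ?_
    nlinarith [mul_le_mul_of_nonneg_right hκ (sq_nonneg a)]
  have hlower := (mul_le_mul_of_nonneg_left
    (le_normSq_outgoing_indicator_one (waveNumber_ne_zero k n) ha.le har hκa)
    (by positivity : 0 ≤ 1 + freq n ^ 2 + freq n ^ 4)).trans
    (normSq_outgoing_le_norm_solCLM_sq k n (isSource_indicator_one har))
  rw [normSq_indicator_one ha.le har] at hlower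
  have hH : X ^ 2 / 2 * (a / (2 * ‖κ‖)) ^ 2 ≤ ‖solCLM r k‖ ^ 2 := by
    refine le_of_mul_le_mul_right (le_trans ?_ hlower) (by positivity : 0 < 2 * a)
    calc X ^ 2 / 2 * (a / (2 * ‖κ‖)) ^ 2 * (2 * a)
        ≤ (1 + freq n ^ 2 + freq n ^ 4) * (a / (2 * ‖κ‖)) ^ 2 * (2 * a) := by
          gcongr
          nlinarith [sq_nonneg (freq n ^ 2)]
      _ = _ := by ring
  refine le_of_mul_le_mul_left ?_ (by positivity : 0 < X)
  calc X * r ^ 2 = X ^ 2 / 2 * (a / (2 * ‖κ‖)) ^ 2 * (8 * ‖κ‖ ^ 2) := by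
        rw [← ha_sq]
        field_simp
        ring
    _ ≤ ‖solCLM r k‖ ^ 2 * (8 * (2 * δ * X)) := by gcongr
    _ = X * (16 * δ * ‖solCLM r k‖ ^ 2) := by ring

theorem exists_lt_norm_solCLM (hr : 0 < r) (M : ℝ) : ∃ δ : ℝ, 0 < δ ∧ ∀ k : Frequency,
    Metric.infDist (k : ℝ) cutoffs < δ → M < ‖solCLM r k‖ := by
  set δ := min 1 (min (1 / (128 * r ^ 2)) (r ^ 2 / (32 * (M ^ 2 + 1))))
  have hδ : 0 < δ := by positivity
  refine ⟨δ, hδ, fun k hk => ?_⟩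
  obtain ⟨-, ⟨n, rfl⟩, hn⟩ := (Metric.infDist_lt_iff (range_nonempty _)).1 hk
  have hδr : 128 * r ^ 2 * δ ≤ 1 := by
    rw [mul_comm, ← le_div_iff₀ (by positivity)]
    exact (min_le_right _ _).trans (min_le_left _ _)
  have hδM : δ * (32 * (M ^ 2 + 1)) ≤ r ^ 2 := by
    rw [← le_div_iff₀ (by positivity)]
    exact (min_le_right _ _).trans (min_le_right _ _)
  have hH := sq_le_mul_norm_solCLM_sq hr k n (min_le_left _ _) hδr hn.le
  have hM : M ^ 2 < ‖solCLM r k‖ ^ 2 := by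
    refine lt_of_mul_lt_mul_left ?_ (by positivity : 0 ≤ 16 * δ)
    nlinarith [mul_nonneg hδ.le (sq_nonneg M)]
  exact lt_of_pow_lt_pow_left₀ 2 (solCLM r k).opNorm_nonneg hM

end Resonance

end Waveguide

end

theorem mainTheorem9 (r : ℝ) (hr : 0 < r) :
    ∃ H : Waveguide.Frequency → Waveguide.L2 (Waveguide.box r) →L[ℂ]
        Waveguide.H2 (Waveguide.box r),
      (∀ (k : Waveguide.Frequency) (s : Waveguide.L2 (Waveguide.box r)),
        ∃ u : ℝ × ℝ → ℂ,
          Waveguide.IsSolution k (Waveguide.extendByZero s) u ∧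
          (∀ u' : ℝ × ℝ → ℂ, Waveguide.IsSolution k (Waveguide.extendByZero s) u' →
            u' =ᵐ[volume.restrict Waveguide.guide] u) ∧
          Waveguide.IsRestriction (H k s) u) ∧
      (∀ k : Waveguide.Frequency, ∃ C : ℝ, 0 < C ∧
        ∀ s : Waveguide.L2 (Waveguide.box r), ‖H k s‖ ≤ C * ‖s‖) ∧
      (∀ M : ℝ, ∃ δ : ℝ, 0 < δ ∧ ∀ k : Waveguide.Frequency,
        Metric.infDist (k : ℝ) Waveguide.cutoffs < δ → M < ‖H k‖) :=
  ⟨Waveguide.solCLM r,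
    fun k s => ⟨Waveguide.solFun k s, Waveguide.isSolution_solFun k s,
      fun _ hu' => hu'.ae_eq (Waveguide.isSolution_solFun k s),
      Waveguide.isRestriction_solH2 r k s⟩,
    Waveguide.exists_norm_solH2_le r r,
    Waveguide.exists_lt_norm_solCLM hr⟩
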